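/- **Syntax.** Term variables $x,y,\dots$ and type constructor variables $X,Y,\dots$; everything is taken up to renaming of bound variables. A context $\Gamma=x_1:A_1,\dots,x_n:A_n$ is a list of types; a parameter context is a context read as a list of parameters; a type constructor context $\Xi$ is a list of declarations $X:\Gamma\rightsquigarrow *$; a context morphism $\sigma=(t_1,\dots,t_n)$ is a list of terms. Types (type constructors) and terms are $$A ::= \top \mid X \mid A\,@\,t \mid (x).A \mid \rho(S)\quad(\rho\in\{\mu,\nu\}),\qquad t ::= \diamond \mid x \mid t\,@\,s \mid \alpha^S_k \mid \xi^S_k \mid \mathrm{rec}^{S,C}\,\overrightarrow{(\Gamma_k,y_k).g_k} \mid \mathrm{corec}^{S,C}\,\overrightarrow{(\Gamma_k,y_k).g_k},$$ where $S=(X:\Gamma\rightsquigarrow *;\ \vec\sigma;\ \vec A)$ has components $\sigma_k:\Gamma_k\to\Gamma$ (a context morphism together with its domain $\Gamma_k$) and $A_k$ (a type in which $X$ may occur and whose term variables are those of $\Gamma_k$), $1\le k\le n$. Put $\mu=\mu(S)$, $\nu=\nu(S)$, $A@\sigma=A@t_1@\cdots@t_n$ (likewise for terms), $\mathrm{id}_\Gamma=(x_1,\dots,x_n)$,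 $\sigma\bullet\tau=(\sigma_1[\tau],\dots,\sigma_n[\tau])$. **Type action.** Let $C$ be a type constructor with parameter context $\Gamma$ in a term context $\Gamma'$ and type constructor variables $X_i:\Gamma_i\rightsquigarrow *$. For closed type constructors $\vec A,\vec B$ with parameter contexts $\Gamma_i$ and terms $t_i$ in context $\Delta,\Gamma_i,x:A_i@\mathrm{id}_{\Gamma_i}$ of type $B_i@\mathrm{id}_{\Gamma_i}$, the term $F_C(\vec t)$ in context $\Delta,\Gamma',\Gamma,x$ is: $F_C(\vec t)=x$ if no type constructor variable is free in $C$; otherwise $F_{X_i}(\vec t)=t_i$; $F_{C'@s}(\vec t)=F_{C'}(\vec t)[s/y]$ with $y$ the first parameter of $C'$; $F_{(y).C'}(\vec t)=F_{C'}(\vec t)$; and for $S=(Y:\Gamma\rightsquigarrow *;\vec\sigma;\vec D)$ with $\sigma_k:\Delta_k\to\Gamma$, $S_{A}=S[\vec A/\vec X]$, $S_{B}=S[\vec B/\vec X]$, $$F_{\mu(S)}(\vec t)=\mathrm{rec}^{S_A,\mu(S_B)}\,\overrightarrow{(\Delta_k,x).\,\alpha^{S_B}_k@\mathrm{id}_{\Delta_k}@F_{D_k}(\vec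 t,x)}\,@\,\mathrm{id}_\Gamma@x,$$ $$F_{\nu(S)}(\vec t)=\mathrm{corec}^{S_B,\nu(S_A)}\,\overrightarrow{(\Delta_k,x).\,F_{D_k}(\vec t,x)[(\xi^{S_A}_k@\mathrm{id}_{\Delta_k}@x)/x]}\,@\,\mathrm{id}_\Gamma@x,$$ where in $F_{D_k}(\vec t,x)$ the variable $Y$ is assigned the closed constructor $\mu(S_B)$, resp. $\nu(S_A)$, as both source and target, with $x$ as its term. **Reduction.** The relation $\longrightarrow$ on terms is the closure of the following contractions (for $\tau$ of the same length as $\Gamma_k$) under $t@s$ in both positions and under the bodies $g_k$ of $\mathrm{rec}$ and $\mathrm{corec}$ (the superscripts are type information and are not reduced): $$\mathrm{rec}^{S,C}\overrightarrow{(\Gamma_k,y_k).g_k}@(\sigma_k\bullet\tau)@(\alpha^S_k@\tau@u)\ \succ\ g_k\big[F_{A_k}(\mathrm{rec}^{S,C}\overrightarrow{(\Gamma_k,y_k).g_k}@\mathrm{id}_\Gamma@x)/y_k\big][\tau,u],$$ $$\xi^S_k@\tau@(\mathrm{corec}^{S,C}\overrightarrow{(\Gamma_k,y_k).g_k}@(\sigma_k\bullet\tau)@u)\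 \succ\ F_{A_k}(\mathrm{corec}^{S,C}\overrightarrow{(\Gamma_k,y_k).g_k}@\mathrm{id}_\Gamma@x)[g_k/x][\tau,u],$$ the actions being taken for $X\mapsto(\mu,C)$, resp. $X\mapsto(C,\nu)$, as source and target. On types, $\longrightarrow_T$ is the closure under all type formers (including all parts of $S$ in $\rho(S)$) of $((x).A)@t\longrightarrow_T A[t/x]$ and of $A@t\longrightarrow_T A@t'$ for $t\longrightarrow t'$, where terms that occur in $S$ as entries of the $\sigma_k$ are reduced by $\longrightarrow$. Write $A\leftrightarrow_T B$ if $A\longrightarrow_T B$ or $B\longrightarrow_T A$ (one step). **Typing.** The judgements are defined by simultaneous induction; all contexts that occur are required to be well-formed. * Contexts: $\emptyset$ is well-formed; $\Gamma,x:A$ is if $\Gamma$ is and $\emptyset\mid\Gamma\vdash A:*$. Similarly $\Xi,X:\Gamma\rightsquigarrow *$ for well-formed $\Xi$ and $\Gamma$. (We write $*$ for $\emptyset\rightsquigarrow *$.) * Morphisms: $():\Gamma_1\to\emptyset$; and $(\sigma,t):\Gamma_1\to(\Gamma_2,x:A)$ if $\sigma:\Gamma_1\to\Gamma_2$, $\emptyset\mid\Gamma_2\vdash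 A:*$ and $\Gamma_1\vdash t:A[\sigma]$. * Types: $\emptyset\mid\emptyset\vdash\top:*$; $\Xi,X:\Gamma\rightsquigarrow *\mid\emptyset\vdash X:\Gamma\rightsquigarrow *$; weakening by a declaration $X:\Gamma\rightsquigarrow *$ of $\Xi$, and by $x:B$ with $\emptyset\mid\Gamma_1\vdash B:*$; if $\Xi\mid\Gamma_1\vdash A:(x:B,\Gamma_2)\rightsquigarrow *$ and $\Gamma_1\vdash t:B$, then $\Xi\mid\Gamma_1\vdash A@t:\Gamma_2[t/x]\rightsquigarrow *$; if $\Xi\mid\Gamma_1,x:A\vdash B:\Gamma_2\rightsquigarrow *$, then $\Xi\mid\Gamma_1\vdash(x).B:(x:A,\Gamma_2)\rightsquigarrow *$; if $\sigma_k:\Gamma_k\to\Gamma$ and $\Xi,X:\Gamma\rightsquigarrow *\mid\Gamma_k\vdash A_k:*$ for all $k$, then $\Xi\mid\emptyset\vdash\rho(S):\Gamma\rightsquigarrow *$. * Terms ($\Gamma_1\vdash t:\Gamma_2\rightsquigarrow A$; for $\Gamma_2=\emptyset$ written $\Gamma_1\vdash t:A$): $\vdash\diamond:\top$; $\Gamma,x:A\vdash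 x:A$ if $\emptyset\mid\Gamma\vdash A:*$; weakening by $x:B$ with $\emptyset\mid\Gamma_1\vdash B:*$; if $\Gamma_1\vdash t:(x:A,\Gamma_2)\rightsquigarrow B$ and $\Gamma_1\vdash s:A$, then $\Gamma_1\vdash t@s:\Gamma_2[s/x]\rightsquigarrow B[s/x]$; conversion: if $\Gamma_1\vdash t:\Gamma_2\rightsquigarrow A$, $A\leftrightarrow_T B$ and $\emptyset\mid\Gamma_1,\Gamma_2\vdash B:*$, then $\Gamma_1\vdash t:\Gamma_2\rightsquigarrow B$. If $\emptyset\mid\emptyset\vdash\mu:\Gamma\rightsquigarrow *$, resp. $\emptyset\mid\emptyset\vdash\nu:\Gamma\rightsquigarrow *$, then $\vdash\alpha^S_k:(\Gamma_k,y:A_k[\mu/X])\rightsquigarrow\mu@\sigma_k$, resp. $\vdash\xi^S_k:(\Gamma_k,y:\nu@\sigma_k)\rightsquigarrow A_k[\nu/X]$. If moreover $\emptyset\mid\emptyset\vdash C:\Gamma\rightsquigarrow *$ and, for all $k$, $\Delta,\Gamma_k,y_k:A_k[C/X]\vdash g_k:C@\sigma_k$, resp. $\Delta,\Gamma_k,y_k:C@\sigma_k\vdash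 g_k:A_k[C/X]$, then $\Delta\vdash\mathrm{rec}^{S,C}\overrightarrow{(\Gamma_k,y_k).g_k}:(\Gamma,y:\mu@\mathrm{id}_\Gamma)\rightsquigarrow C@\mathrm{id}_\Gamma$, resp. $\Delta\vdash\mathrm{corec}^{S,C}\overrightarrow{(\Gamma_k,y_k).g_k}:(\Gamma,y:C@\mathrm{id}_\Gamma)\rightsquigarrow\nu@\mathrm{id}_\Gamma$. **Theorem (Subject reduction).** If $\Gamma\vdash t_1:A$ and $t_1\longrightarrow t_2$, then $\Gamma\vdash t_2:A$. -/

import Mathlib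

/-! A dependent type theory built from inductive (`μ`) and coinductive (`ν`) types only.

Conventions.  Variables are de Bruijn indices, separately for term variables and for type
constructor variables.  Contexts, parameter contexts and context morphisms are lists whose head is
the entry added last.  So `A :: Γ` is `Γ, x : A`, the list `Γ₂ ++ Γ₁` is the concatenation
`Γ₁, Γ₂`, and `T ++ [B]` is the parameter context `(x : B, T)`. -/

namespace DTT

/-- The two kinds of fixed points. -/
inductive Fix where
  | mu
  | nu

mutual
/-- Raw type constructors. -/
inductive Ty where
  /-- the basic type `⊤` -/
  | one
  /-- a type constructor variable -/
  | tvar (X : ℕ)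
  /-- instantiation `A @ t` of the first parameter of `A` -/
  | inst (A : Ty) (t : Tm)
  /-- parameter abstraction `(x). A` -/
  | pabs (A : Ty)
  /-- `μ(X : Γ ⇝ *; σ; A)` or `ν(X : Γ ⇝ *; σ; A)` -/
  | fp (ρ : Fix) (S : Sig)
/-- Raw terms. -/
inductive Tm where
  /-- the element of `⊤` -/
  | unit
  /-- a term variable -/
  | var (x : ℕ)
  /-- instantiation `t @ s` of the first parameter of `t` -/
  | app (t s : Tm)
  /-- the `k`-th constructor of the inductive type with data `S` -/
  | con (S : Sig) (k : ℕ)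
  /-- the `k`-th destructor of the coinductive type with data `S` -/
  | des (S : Sig) (k : ℕ)
  /-- `rec (Γₖ, yₖ). gₖ` from the inductive type with data `S` to the type constructor `C` -/
  | recur (S : Sig) (C : Ty) (gs : List Tm)
  /-- `corec (Γₖ, yₖ). gₖ` from the type constructor `C` to the coinductive type with data `S` -/
  | corecur (S : Sig) (C : Ty) (gs : List Tm)
/-- One component of the data of a fixed point type: the context `dom` is `Γₖ`, the context
morphism `mor` is `σₖ : Γₖ → Γ`, and `ty` is `Aₖ`. -/
inductive Comp where
  | mk (dom : List Ty) (mor : List Tm) (ty : Ty)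
/-- The data of a fixed point type: the parameter context `Γ` of the bound variable `X`, and the
components.  The term variables in the component `(Γₖ, σₖ, Aₖ)` are bound by `Γₖ`, so that a fixed
point type has no free term variables.  The variable `X` is bound in the types `Aₖ`. -/
inductive Sig where
  | mk (par : List Ty) (comps : List Comp)
end

/-- Contexts and parameter contexts. -/
abbrev Ctx := List Ty

/-- Context morphisms. -/
abbrev Mor := List Tm

/-- Type constructor variable contexts: the parameter contexts of the variables. -/
abbrev TyCtx := List Ctx

def Comp.dom : Comp → Ctx
  | .mk d _ _ => d

def Comp.mor : Comp → Mor
  | .mk _ m _ => m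

def Comp.ty : Comp → Ty
  | .mk _ _ A => A

def Sig.par : Sig → Ctx
  | .mk p _ => p

def Sig.comps : Sig → List Comp
  | .mk _ cs => cs

/-- The numbers of term variables that are bound in the bodies `gₖ` of a (co)recursor, namely those
of `Γₖ` and `yₖ`. -/
def Sig.binders (S : Sig) : List ℕ := S.comps.map fun c => c.dom.length + 1

/-! ### Renaming and substitution of term variables -/

/-- Lift a renaming under one binder. -/
def upRen (ξ : ℕ → ℕ) : ℕ → ℕ
  | 0 => 0
  | i + 1 => ξ i + 1

/-- Lift a renaming under `n` binders. -/
def upRenN : ℕ → (ℕ → ℕ) → ℕ → ℕ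
  | 0, ξ => ξ
  | n + 1, ξ => upRen (upRenN n ξ)

mutual
/-- Renaming of the free term variables of a term. -/
def Tm.ren (ξ : ℕ → ℕ) : Tm → Tm
  | .unit => .unit
  | .var x => .var (ξ x)
  | .app t s => .app (t.ren ξ) (s.ren ξ)
  | .con S k => .con S k
  | .des S k => .des S k
  | .recur S C gs => .recur S C (renBodies ξ S.binders gs)
  | .corecur S C gs => .corecur S C (renBodies ξ S.binders gs)
/-- Renaming in a list of bodies that bind the given numbers of variables. -/
def renBodies (ξ : ℕ → ℕ) : List ℕ → List Tm → List Tm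
  | _, [] => []
  | [], g :: gs => g :: gs
  | n :: ns, g :: gs => g.ren (upRenN n ξ) :: renBodies ξ ns gs
end

/-- Weakening by one variable. -/
def Tm.shift (t : Tm) : Tm := t.ren Nat.succ

/-- Lift a substitution under one binder. -/
def up (θ : ℕ → Tm) : ℕ → Tm
  | 0 => .var 0
  | i + 1 => (θ i).shift

/-- Lift a substitution under `n` binders. -/
def upN : ℕ → (ℕ → Tm) → ℕ → Tm
  | 0, θ => θ
  | n + 1, θ => up (upN n θ)

mutual
/-- Simultaneous substitution for the free term variables of a term. -/
def Tm.subst (θ : ℕ → Tm) : Tm → Tm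
  | .unit => .unit
  | .var x => θ x
  | .app t s => .app (t.subst θ) (s.subst θ)
  | .con S k => .con S k
  | .des S k => .des S k
  | .recur S C gs => .recur S C (substBodies θ S.binders gs)
  | .corecur S C gs => .corecur S C (substBodies θ S.binders gs)
/-- Substitution in a list of bodies that bind the given numbers of variables. -/
def substBodies (θ : ℕ → Tm) : List ℕ → List Tm → List Tm
  | _, [] => []
  | [], g :: gs => g :: gs
  | n :: ns, g :: gs => g.subst (upN n θ) :: substBodies θ ns gs
end

/-- Renaming of the free term variables of a type; a fixed point type has none. -/
def Ty.ren (ξ : ℕ → ℕ) : Ty → Ty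
  | .one => .one
  | .tvar X => .tvar X
  | .inst A t => .inst (A.ren ξ) (t.ren ξ)
  | .pabs A => .pabs (A.ren (upRen ξ))
  | .fp ρ S => .fp ρ S

/-- Weakening by one variable. -/
def Ty.shift (A : Ty) : Ty := A.ren Nat.succ

/-- Simultaneous substitution for the free term variables of a type; a fixed point type has
none. -/
def Ty.subst (θ : ℕ → Tm) : Ty → Ty
  | .one => .one
  | .tvar X => .tvar X
  | .inst A t => .inst (A.subst θ) (t.subst θ)
  | .pabs A => .pabs (A.subst (up θ))
  | .fp ρ S => .fp ρ S

/-- Renaming in a parameter context, whose later entries lie under the binders of the earlier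
ones. -/
def Ctx.ren (ξ : ℕ → ℕ) : Ctx → Ctx
  | [] => []
  | A :: T => A.ren (upRenN T.length ξ) :: Ctx.ren ξ T

/-- Substitution in a parameter context. -/
def Ctx.subst (θ : ℕ → Tm) : Ctx → Ctx
  | [] => []
  | A :: T => A.subst (upN T.length θ) :: Ctx.subst θ T

/-- The substitution `[σ]`: the last variables are replaced by the entries of `σ`, the remaining
ones are kept (with their indices adapted). -/
def ofMor (σ : Mor) (i : ℕ) : Tm := (σ[i]?).getD (.var (i - σ.length))

/-- Composition of context morphisms `σ • τ = (σ₁[τ], …, σₙ[τ])`. -/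
def Mor.comp (σ τ : Mor) : Mor := σ.map (Tm.subst (ofMor τ))

/-- The substitution `[t/x]` for the last variable `x`, where `t` lives in the same context, so
that `x` may occur in `t` again (a renaming of the last variable followed by a substitution). -/
def replaceLast (t : Tm) : ℕ → Tm
  | 0 => t
  | i + 1 => .var (i + 1)

/-- The identity morphism of a context of length `n`. -/
def idMor (n : ℕ) : Mor := (List.range n).map Tm.var

/-- The morphism `id_Γ` for a context `Γ` of length `n`, weakened by one further variable. -/
def idMorS (n : ℕ) : Mor := (idMor n).map Tm.shift

/-- `A @ σ = A @ t₁ @ … @ tₙ`. -/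
def Ty.instMor (A : Ty) (σ : Mor) : Ty := σ.foldr (fun t B => .inst B t) A

/-- `t @ σ = t @ t₁ @ … @ tₙ`. -/
def Tm.appMor (t : Tm) (σ : Mor) : Tm := σ.foldr (fun s r => .app r s) t

/-! ### Renaming and substitution of type constructor variables

By the typing rules, terms and contexts contain no free type constructor variables, so the
operations below act only on the other parts of a type. -/

mutual
/-- Renaming of the free type constructor variables of a type. -/
def Ty.tyRen (ξ : ℕ → ℕ) : Ty → Ty
  | .one => .one
  | .tvar X => .tvar (ξ X)
  | .inst A t => .inst (A.tyRen ξ) t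
  | .pabs A => .pabs (A.tyRen ξ)
  | .fp ρ S => .fp ρ (S.tyRen (upRen ξ))
def Sig.tyRen (ξ : ℕ → ℕ) : Sig → Sig
  | .mk p cs => .mk p (tyRenComps ξ cs)
def Comp.tyRen (ξ : ℕ → ℕ) : Comp → Comp
  | .mk d m A => .mk d m (A.tyRen ξ)
def tyRenComps (ξ : ℕ → ℕ) : List Comp → List Comp
  | [] => []
  | c :: cs => c.tyRen ξ :: tyRenComps ξ cs
end

/-- Weakening by one type constructor variable. -/
def Ty.tyShift (A : Ty) : Ty := A.tyRen Nat.succ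

/-- Lift a substitution for type constructor variables under one binder. -/
def tyUp (θ : ℕ → Ty) : ℕ → Ty
  | 0 => .tvar 0
  | i + 1 => (θ i).tyShift

mutual
/-- Simultaneous substitution for the free type constructor variables of a type.  It is used only
for type constructors without free term variables, which can pass the binder of a parameter
abstraction unchanged. -/
def Ty.tySubst (θ : ℕ → Ty) : Ty → Ty
  | .one => .one
  | .tvar X => θ X
  | .inst A t => .inst (A.tySubst θ) t
  | .pabs A => .pabs (A.tySubst θ)
  | .fp ρ S => .fp ρ (S.tySubst (tyUp θ))
/-- Substitution in the types `Aₖ`. -/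
def Sig.tySubst (θ : ℕ → Ty) : Sig → Sig
  | .mk p cs => .mk p (tySubstComps θ cs)
def Comp.tySubst (θ : ℕ → Ty) : Comp → Comp
  | .mk d m A => .mk d m (A.tySubst θ)
def tySubstComps (θ : ℕ → Ty) : List Comp → List Comp
  | [] => []
  | c :: cs => c.tySubst θ :: tySubstComps θ cs
end

/-- Extend a family by a new value for the variable `0`. -/
def scons {α : Type} (a : α) (f : ℕ → α) : ℕ → α
  | 0 => a
  | i + 1 => f i

/-- `A[C/X]` for the last type constructor variable `X`. -/
def Ty.tySubst1 (A C : Ty) : Ty := A.tySubst (scons C Ty.tvar)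

mutual
/-- All free type constructor variables are among the last `d` ones. -/
def Ty.tyBelow (d : ℕ) : Ty → Bool
  | .one => true
  | .tvar X => X < d
  | .inst A _ => A.tyBelow d
  | .pabs A => A.tyBelow d
  | .fp _ S => S.tyBelow (d + 1)
def Sig.tyBelow (d : ℕ) : Sig → Bool
  | .mk _ cs => tyBelowComps d cs
def Comp.tyBelow (d : ℕ) : Comp → Bool
  | .mk _ _ A => A.tyBelow d
def tyBelowComps (d : ℕ) : List Comp → Bool
  | [] => true
  | c :: cs => c.tyBelow d && tyBelowComps d cs
end

/-! ### The action of types on terms -/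

mutual
/-- The action `F_C(t)` of a type constructor `C` on terms.

The type constructor variable `Xᵢ : Γᵢ ⇝ *` comes with closed type constructors
`a i, b i : Γᵢ ⇝ *` and a term `Δ, Γᵢ, x : a i @ id ⊢ ts i : b i @ id`.  If `C : Γ ⇝ *` lives in
the term context `Γ'`, where `p` and `n` are the lengths of `Γ'` and `Γ`, then the action is a term
in the context `Δ, Γ', Γ, x : C[a/X] @ id` of type `C[b/X] @ id`.

A type without free type constructor variables acts as the identity, that is, as `x`.  For `⊤`,
abstractions and instantiations this follows from the other clauses. -/
def Ty.act (a b : ℕ → Ty) (ts : ℕ → Tm) (p n : ℕ) : Ty → Tm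
  | .one => .var 0
  | .tvar X => (ts X).ren (upRenN (n + 1) (· + p))
  | .inst C s => (C.act a b ts p (n + 1)).subst (upN (n + 1) (ofMor [s]))
  | .pabs C => C.act a b ts (p + 1) (n - 1)
  | .fp .mu S =>
    if S.tyBelow 1 then .var 0 else
      let Sa := S.tySubst (tyUp a)
      let Sb := S.tySubst (tyUp b)
      let R : Ty := .fp .mu Sb
      let Fs := S.actComps (scons R a) (scons R b) (scons (.var 0) ts)
      let gs := (S.comps.zip Fs).mapIdx fun k cF =>
        let m := cF.1.dom.length
        Tm.app ((Tm.con Sb k).appMor (idMorS m))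
          (cF.2.ren (upRenN (m + 1) (· + (p + n + 1))))
      .app ((Tm.recur Sa R gs).appMor (idMorS S.par.length)) (.var 0)
  | .fp .nu S =>
    if S.tyBelow 1 then .var 0 else
      let Sa := S.tySubst (tyUp a)
      let Sb := S.tySubst (tyUp b)
      let R : Ty := .fp .nu Sa
      let Fs := S.actComps (scons R a) (scons R b) (scons (.var 0) ts)
      let gs := (S.comps.zip Fs).mapIdx fun k cF =>
        let m := cF.1.dom.length
        (cF.2.ren (upRenN (m + 1) (· + (p + n + 1)))).subst
          (replaceLast (.app ((Tm.des Sa k).appMor (idMorS m)) (.var 0)))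
      .app ((Tm.corecur Sb R gs).appMor (idMorS S.par.length)) (.var 0)
/-- The actions of the types `Aₖ`, in the contexts `Δ, Γₖ, x`. -/
def Sig.actComps (a b : ℕ → Ty) (ts : ℕ → Tm) : Sig → List Tm
  | .mk _ cs => actList a b ts cs
def Comp.act (a b : ℕ → Ty) (ts : ℕ → Tm) : Comp → Tm
  | .mk d _ A => A.act a b ts d.length 0
def actList (a b : ℕ → Ty) (ts : ℕ → Tm) : List Comp → List Tm
  | [] => []
  | c :: cs => c.act a b ts :: actList a b ts cs
end

/-- The action of a type `A` in the term context `Γ'` of length `p`, with the single type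
constructor variable `X : Γ ⇝ *`, on a term `Δ, Γ, x : B @ id ⊢ t : C @ id`. -/
def Ty.act1 (A B C : Ty) (t : Tm) (p : ℕ) : Tm :=
  A.act (scons B Ty.tvar) (scons C Ty.tvar) (scons t Tm.var) p 0

/-- The term `h @ id_Γ @ x` in the context `Δ, Γ, x`, for `h` in the context `Δ` and `Γ` of
length `n`. -/
def Tm.generic (h : Tm) (n : ℕ) : Tm :=
  .app ((h.ren (· + (n + 1))).appMor (idMorS n)) (.var 0)

/-! ### Reduction -/

/-- Contraction of terms. -/
inductive Contr : Tm → Tm → Prop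
  /-- `rec (Γₖ,yₖ).gₖ @ (σₖ • τ) @ (αₖ @ τ @ u)` contracts to
  `gₖ[F_{Aₖ}(rec (Γₖ,yₖ).gₖ @ id_Γ @ x)/yₖ][τ, u]`. -/
  | recur (S : Sig) (C : Ty) (gs : List Tm) (k : ℕ) (c : Comp) (g : Tm) (τ : Mor) (u : Tm) :
      S.comps[k]? = some c → gs[k]? = some g → τ.length = c.dom.length →
      Contr
        (.app ((Tm.recur S C gs).appMor (c.mor.comp τ)) (.app ((Tm.con S k).appMor τ) u))
        ((g.subst (replaceLast (c.ty.act1 (.fp .mu S) C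
            ((Tm.recur S C gs).generic S.par.length) c.dom.length))).subst (ofMor (u :: τ)))
  /-- `ξₖ @ τ @ (corec (Γₖ,yₖ).gₖ @ (σₖ • τ) @ u)` contracts to
  `F_{Aₖ}(corec (Γₖ,yₖ).gₖ @ id_Γ @ x)[gₖ/x][τ, u]`. -/
  | corecur (S : Sig) (C : Ty) (gs : List Tm) (k : ℕ) (c : Comp) (g : Tm) (τ : Mor) (u : Tm) :
      S.comps[k]? = some c → gs[k]? = some g → τ.length = c.dom.length →
      Contr
        (.app ((Tm.des S k).appMor τ) (.app ((Tm.corecur S C gs).appMor (c.mor.comp τ)) u))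
        (((c.ty.act1 C (.fp .nu S) ((Tm.corecur S C gs).generic S.par.length)
            c.dom.length).subst (replaceLast g)).subst (ofMor (u :: τ)))

/-- The reduction relation `t ⟶ t'` on terms: the compatible closure of contraction. -/
inductive Step : Tm → Tm → Prop
  | contr {t t' : Tm} : Contr t t' → Step t t'
  | appLeft {t t' : Tm} (s : Tm) : Step t t' → Step (.app t s) (.app t' s)
  | appRight (t : Tm) {s s' : Tm} : Step s s' → Step (.app t s) (.app t s')
  | recur (S : Sig) (C : Ty) (gs₁ gs₂ : List Tm) {g g' : Tm} : Step g g' →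
      Step (.recur S C (gs₁ ++ g :: gs₂)) (.recur S C (gs₁ ++ g' :: gs₂))
  | corecur (S : Sig) (C : Ty) (gs₁ gs₂ : List Tm) {g g' : Tm} : Step g g' →
      Step (.corecur S C (gs₁ ++ g :: gs₂)) (.corecur S C (gs₁ ++ g' :: gs₂))

mutual
/-- The reduction relation on types: the compatible closure of `((x). A) @ t ⟶ A[t/x]` and of the
reduction of terms. -/
inductive TyStep : Ty → Ty → Prop
  | beta (A : Ty) (t : Tm) : TyStep (.inst (.pabs A) t) (A.subst (ofMor [t]))
  | param (A : Ty) {t t' : Tm} : Step t t' → TyStep (.inst A t) (.inst A t')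
  | inst {A A' : Ty} (t : Tm) : TyStep A A' → TyStep (.inst A t) (.inst A' t)
  | pabs {A A' : Ty} : TyStep A A' → TyStep (.pabs A) (.pabs A')
  | par (ρ : Fix) (Γ₁ Γ₂ : Ctx) {A A' : Ty} (cs : List Comp) : TyStep A A' →
      TyStep (.fp ρ (.mk (Γ₁ ++ A :: Γ₂) cs)) (.fp ρ (.mk (Γ₁ ++ A' :: Γ₂) cs))
  | comp (ρ : Fix) (p : Ctx) (cs₁ cs₂ : List Comp) {c c' : Comp} : CompStep c c' →
      TyStep (.fp ρ (.mk p (cs₁ ++ c :: cs₂))) (.fp ρ (.mk p (cs₁ ++ c' :: cs₂)))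
/-- Reduction of one component of a fixed point type. -/
inductive CompStep : Comp → Comp → Prop
  | ty (d : Ctx) (m : Mor) {A A' : Ty} : TyStep A A' → CompStep (.mk d m A) (.mk d m A')
  | mor (d : Ctx) (σ₁ σ₂ : Mor) {t t' : Tm} (A : Ty) : Step t t' →
      CompStep (.mk d (σ₁ ++ t :: σ₂) A) (.mk d (σ₁ ++ t' :: σ₂) A)
  | dom (Γ₁ Γ₂ : Ctx) {B B' : Ty} (m : Mor) (A : Ty) : TyStep B B' →
      CompStep (.mk (Γ₁ ++ B :: Γ₂) m A) (.mk (Γ₁ ++ B' :: Γ₂) m A)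
end

/-- One-step conversion of types. -/
def TyConv (A B : Ty) : Prop := TyStep A B ∨ TyStep B A

/-! ### The judgements -/

mutual
/-- `IsCtx Γ`: the term variable context `Γ` is well-formed. -/
inductive IsCtx : Ctx → Prop
  | nil : IsCtx []
  | cons {Γ : Ctx} {A : Ty} : IsCtx Γ → HasKind [] Γ A [] → IsCtx (A :: Γ)
/-- `IsTyCtx Ξ`: the type constructor variable context `Ξ` is well-formed. -/
inductive IsTyCtx : TyCtx → Prop
  | nil : IsTyCtx []
  | cons {Ξ : TyCtx} {Γ : Ctx} : IsTyCtx Ξ → IsCtx Γ → IsTyCtx (Γ :: Ξ)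
/-- `IsMor Γ₁ σ Γ₂`: `σ` is a well-formed context morphism from `Γ₁` to `Γ₂`. -/
inductive IsMor : Ctx → Mor → Ctx → Prop
  | nil {Γ : Ctx} : IsCtx Γ → IsMor Γ [] []
  | cons {Γ₁ Γ₂ : Ctx} {σ : Mor} {t : Tm} {A : Ty} : IsMor Γ₁ σ Γ₂ → HasKind [] Γ₂ A [] →
      Typed Γ₁ t [] (A.subst (ofMor σ)) → IsMor Γ₁ (t :: σ) (A :: Γ₂)
/-- `HasKind Ξ Γ A T`: the type constructor `A` is well-formed in the combined context `Ξ | Γ` and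
has the parameter context `T`, written `Ξ | Γ ⊢ A : T ⇝ *`. -/
inductive HasKind : TyCtx → Ctx → Ty → Ctx → Prop
  | one : HasKind [] [] .one []
  | tvar {Ξ : TyCtx} {T : Ctx} : IsTyCtx Ξ → IsCtx T → HasKind (T :: Ξ) [] (.tvar 0) T
  | tyVarWeak {Ξ : TyCtx} {Γ T U : Ctx} {A : Ty} : HasKind Ξ Γ A T → IsCtx U →
      HasKind (U :: Ξ) Γ A.tyShift T
  | tyWeak {Ξ : TyCtx} {Γ T : Ctx} {A B : Ty} : HasKind Ξ Γ A T → HasKind [] Γ B [] →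
      HasKind Ξ (B :: Γ) A.shift (Ctx.ren Nat.succ T)
  | inst {Ξ : TyCtx} {Γ T : Ctx} {A B : Ty} {t : Tm} : HasKind Ξ Γ A (T ++ [B]) →
      Typed Γ t [] B → HasKind Ξ Γ (.inst A t) (Ctx.subst (ofMor [t]) T)
  | pabs {Ξ : TyCtx} {Γ T : Ctx} {A B : Ty} : HasKind Ξ (A :: Γ) B T →
      HasKind Ξ Γ (.pabs B) (T ++ [A])
  | fp {Ξ : TyCtx} (ρ : Fix) {S : Sig} : IsTyCtx Ξ → IsCtx S.par →
      (∀ c ∈ S.comps, IsMor c.dom c.mor S.par) →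
      (∀ c ∈ S.comps, HasKind (S.par :: Ξ) c.dom c.ty []) →
      HasKind Ξ [] (.fp ρ S) S.par
/-- `Typed Γ t T A`: the term `t` is well-formed in the context `Γ` and has the parameterised type
`T ⇝ A`, where `A` lives in the context `Γ, T`; for empty `T` this is `Γ ⊢ t : A`. -/
inductive Typed : Ctx → Tm → Ctx → Ty → Prop
  | unit : Typed [] .unit [] .one
  | inst {Γ T : Ctx} {t s : Tm} {A B : Ty} : Typed Γ t (T ++ [A]) B → Typed Γ s [] A →
      Typed Γ (.app t s) (Ctx.subst (ofMor [s]) T) (B.subst (upN T.length (ofMor [s])))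
  | conv {Γ T : Ctx} {t : Tm} {A B : Ty} : Typed Γ t T A → TyConv A B →
      HasKind [] (T ++ Γ) B [] → Typed Γ t T B
  | proj {Γ : Ctx} {A : Ty} : HasKind [] Γ A [] → Typed (A :: Γ) (.var 0) [] A.shift
  | weak {Γ T : Ctx} {t : Tm} {A B : Ty} : Typed Γ t T A → HasKind [] Γ B [] →
      Typed (B :: Γ) t.shift (Ctx.ren Nat.succ T) (A.ren (upRenN T.length Nat.succ))
  | con {S : Sig} {k : ℕ} {c : Comp} : HasKind [] [] (.fp .mu S) S.par →
      S.comps[k]? = some c →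
      Typed [] (.con S k) (c.ty.tySubst1 (.fp .mu S) :: c.dom)
        ((Ty.fp .mu S).instMor c.mor).shift
  | des {S : Sig} {k : ℕ} {c : Comp} : HasKind [] [] (.fp .nu S) S.par →
      S.comps[k]? = some c →
      Typed [] (.des S k) ((Ty.fp .nu S).instMor c.mor :: c.dom)
        (c.ty.tySubst1 (.fp .nu S)).shift
  | recur {Δ : Ctx} {S : Sig} {C : Ty} {gs : List Tm} : IsCtx Δ →
      HasKind [] [] (.fp .mu S) S.par → HasKind [] [] C S.par →
      gs.length = S.comps.length →
      (∀ (k : ℕ) (c : Comp) (g : Tm), S.comps[k]? = some c → gs[k]? = some g →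
        Typed (c.ty.tySubst1 C :: (c.dom ++ Δ)) g [] (C.instMor c.mor).shift) →
      Typed Δ (.recur S C gs) ((Ty.fp .mu S).instMor (idMor S.par.length) :: S.par)
        (C.instMor (idMor S.par.length)).shift
  | corecur {Δ : Ctx} {S : Sig} {C : Ty} {gs : List Tm} : IsCtx Δ →
      HasKind [] [] (.fp .nu S) S.par → HasKind [] [] C S.par →
      gs.length = S.comps.length →
      (∀ (k : ℕ) (c : Comp) (g : Tm), S.comps[k]? = some c → gs[k]? = some g →
        Typed (C.instMor c.mor :: (c.dom ++ Δ)) g [] (c.ty.tySubst1 C).shift) →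
      Typed Δ (.corecur S C gs) (C.instMor (idMor S.par.length) :: S.par)
        ((Ty.fp .nu S).instMor (idMor S.par.length)).shift
end

end DTT

-- A contraction preserves types because a redex carries all the data that its typing needs.
-- Recursor and constructor, or destructor and corecursor, are annotated with the same `S`, and the
-- conversion rule changes only the result type of a parameterised term, never its parameter
-- context. Hence inverting a spine `h @ σ` headed by such a constant returns the parameter types
-- that the rule for `h` declares, literally, and the result type up to conversion
-- (`Typed.head_spine_inv`). Neither confluence nor injectivity of type formers is needed. For a
-- recursor redex this types `τ, u` against `Γₖ, Aₖ[μ]`. The action of `Aₖ` maps `Aₖ[μ]` to `Aₖ[C]`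
-- (`HasKind.act_typed`), the body `gₖ` leads from there to `C @ σₖ`, and substituting `τ` gives `C
-- @ (σₖ • τ)`, the type of the redex. The corecursor case is dual.
--
-- The compatible closure is the harder half. If `s` reduces to `s'` inside `t @ s`, the result type
-- changes from `B[s]` to `B[s']`. Conversion consists of single steps between well-formed types,
-- whereas `s` may occur many times in `B`, in bodies of recursors and in arguments on which the
-- types of other arguments depend. A path with well-formed intermediate types has to be found. This
-- is `respects`: by simultaneous induction on derivations, convertible substitutions yield
-- convertible types and terms. A fixed point type has no free term variables, so the substitution
-- reaches only arguments and bodies, and these are converted one entry at a time (`SubstEq.chain`,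
-- `list_chain`). The intermediate stages stay well typed because the types of the context involved
-- already respect conversion.
--
-- A second obstacle is that parameter contexts cannot be converted. If `t @ s` has the remaining
-- parameters `T[s/x]`, then `t @ s'` naturally has `T[s'/x]`, so an induction cannot assert that a
-- parameterised term keeps its type. The inductive statements `TyRespects`, `TmRespects` and
-- `Step.preserves` therefore speak of constructors and terms applied to arguments for all
-- parameters. After full application the discrepancy is confined to the result type, where
-- conversion absorbs it.
--
-- These arguments rest on the substitution theorem (`substitution`), on the well-formedness of the
-- type of a typed term (`Typed.validity`), and on the stability of steps under substitution. The
-- last is established for well-scoped raw syntax, since a contraction mentions `σₖ • τ` and the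
-- action of `Aₖ`; derivable judgements are well-scoped by `wellScoped`.

namespace DTT

open Relation

/-! ### Induction principles for the raw syntax -/

/-- Signatures and types inside a term are annotations that term substitution never enters, so
hypotheses are provided only for subterms and bodies. -/
theorem Tm.ind {P : Tm → Prop} (unit : P .unit) (var : ∀ x, P (.var x))
    (app : ∀ t s, P t → P s → P (.app t s)) (con : ∀ S k, P (.con S k))
    (des : ∀ S k, P (.des S k))
    (recur : ∀ S C gs, (∀ g ∈ gs, P g) → P (.recur S C gs))
    (corecur : ∀ S C gs, (∀ g ∈ gs, P g) → P (.corecur S C gs)) : ∀ t, P t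
  | .unit => unit
  | .var x => var x
  | .app t s => app t s (Tm.ind unit var app con des recur corecur t)
      (Tm.ind unit var app con des recur corecur s)
  | .con S k => con S k
  | .des S k => des S k
  | .recur S C gs => recur S C gs fun g hg =>
      have := List.sizeOf_lt_of_mem hg
      Tm.ind unit var app con des recur corecur g
  | .corecur S C gs => corecur S C gs fun g hg =>
      have := List.sizeOf_lt_of_mem hg
      Tm.ind unit var app con des recur corecur g
termination_by t => sizeOf t
decreasing_by all_goals (simp_wf; try omega)

/-- For a fixed point type only the types `Aₖ` get a hypothesis: its contexts and morphisms are left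
alone by the operations on type constructor variables. -/
theorem Ty.ind {P : Ty → Prop} (one : P .one) (tvar : ∀ X, P (.tvar X))
    (inst : ∀ A t, P A → P (.inst A t)) (pabs : ∀ A, P A → P (.pabs A))
    (fp : ∀ ρ p cs, (∀ c ∈ cs, P c.ty) → P (.fp ρ (.mk p cs))) : ∀ A, P A
  | .one => one
  | .tvar X => tvar X
  | .inst A t => inst A t (Ty.ind one tvar inst pabs fp A)
  | .pabs A => pabs A (Ty.ind one tvar inst pabs fp A)
  | .fp ρ (.mk p cs) => fp ρ p cs fun c hc =>
      have h1 := List.sizeOf_lt_of_mem hc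
      have h2 : sizeOf c.ty < sizeOf c := by
        cases c; simp only [Comp.ty, Comp.mk.sizeOf_spec]; omega
      Ty.ind one tvar inst pabs fp c.ty
termination_by A => sizeOf A
decreasing_by
  · simp_wf; omega
  · simp_wf
  · simp_wf; omega

/-! ### Lifting of renamings and substitutions -/

theorem upRenN_lt {n i : ℕ} (ξ : ℕ → ℕ) (h : i < n) : upRenN n ξ i = i := by
  induction n generalizing i with
  | zero => omega
  | succ n ih =>
    cases i with
    | zero => rfl
    | succ i => simp only [upRenN, upRen]; rw [ih (by omega)]

theorem upRenN_add (n i : ℕ) (ξ : ℕ → ℕ) : upRenN n ξ (i + n) = ξ i + n := by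
  induction n with
  | zero => rfl
  | succ n ih => rw [← add_assoc]; simp only [upRenN, upRen]; rw [ih]; omega

theorem upRenN_ge {n i : ℕ} (ξ : ℕ → ℕ) (h : n ≤ i) : upRenN n ξ i = ξ (i - n) + n := by
  obtain ⟨j, rfl⟩ := Nat.exists_eq_add_of_le' h
  rw [upRenN_add]; simp

/-- With this closed form, laws about lifted renamings split into the cases of a bound and of a free
index, without another induction on `n`. -/
theorem upRenN_apply (n i : ℕ) (ξ : ℕ → ℕ) :
    upRenN n ξ i = if i < n then i else ξ (i - n) + n := by
  split_ifs with h
  · exact upRenN_lt ξ h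
  · exact upRenN_ge ξ (by omega)

theorem upRenN_comp (n : ℕ) (ξ ζ : ℕ → ℕ) :
    (fun i => upRenN n ζ (upRenN n ξ i)) = upRenN n fun i => ζ (ξ i) := by
  funext i
  simp only [upRenN_apply n i]
  split_ifs with h
  · rw [upRenN_lt _ h]
  · rw [upRenN_add]

theorem upRenN_upRenN (m n : ℕ) (ξ : ℕ → ℕ) : upRenN m (upRenN n ξ) = upRenN (m + n) ξ := by
  induction m with
  | zero => simp [upRenN]
  | succ m ih => rw [Nat.succ_add]; simp only [upRenN, ih]

theorem upRen_eq (ξ : ℕ → ℕ) : upRen ξ = upRenN 1 ξ := rfl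

theorem up_eq (θ : ℕ → Tm) : up θ = upN 1 θ := rfl

theorem upN_upN (m n : ℕ) (θ : ℕ → Tm) : upN m (upN n θ) = upN (m + n) θ := by
  induction m with
  | zero => simp [upN]
  | succ m ih => rw [Nat.succ_add]; simp only [upN, ih]

theorem Tm.ren_ren (ξ ζ : ℕ → ℕ) (t : Tm) : (t.ren ξ).ren ζ = t.ren fun i => ζ (ξ i) := by
  have key : ∀ (ns : List ℕ) (gs : List Tm) (ξ ζ : ℕ → ℕ),
      (∀ g ∈ gs, ∀ ξ ζ : ℕ → ℕ, (g.ren ξ).ren ζ = g.ren fun i => ζ (ξ i)) →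
      renBodies ζ ns (renBodies ξ ns gs) = renBodies (fun i => ζ (ξ i)) ns gs := by
    intro ns gs ξ ζ h
    induction gs generalizing ns with
    | nil => cases ns <;> simp [renBodies]
    | cons g gs ih =>
      cases ns with
      | nil => simp [renBodies]
      | cons n ns =>
        simp only [renBodies]
        rw [h g (by simp), upRenN_comp, ih _ fun g hg => h g (by simp [hg])]
  induction t using Tm.ind generalizing ξ ζ with
  | unit | var | con | des => simp [Tm.ren]
  | app t s iht ihs => simp [Tm.ren, iht, ihs]
  | recur S C gs ih => simp only [Tm.ren]; rw [key _ _ _ _ ih]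
  | corecur S C gs ih => simp only [Tm.ren]; rw [key _ _ _ _ ih]

theorem upN_lt {n i : ℕ} (θ : ℕ → Tm) (h : i < n) : upN n θ i = .var i := by
  induction n generalizing i with
  | zero => omega
  | succ n ih =>
    cases i with
    | zero => rfl
    | succ i => simp only [upN, up]; rw [ih (by omega)]; simp [Tm.shift, Tm.ren]

theorem Tm.ren_id (t : Tm) : t.ren (fun i => i) = t := by
  have hup : ∀ n, upRenN n (fun i => i) = fun i => i := by
    intro n; funext i; rw [upRenN_apply]; split_ifs <;> omega
  have key : ∀ (ns : List ℕ) (gs : List Tm), (∀ g ∈ gs, g.ren (fun i => i) = g) →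
      renBodies (fun i => i) ns gs = gs := by
    intro ns gs h
    induction gs generalizing ns with
    | nil => cases ns <;> simp [renBodies]
    | cons g gs ih =>
      cases ns with
      | nil => simp [renBodies]
      | cons n ns =>
        simp only [renBodies]
        rw [hup, h g (by simp), ih _ fun g hg => h g (by simp [hg])]
  induction t using Tm.ind with
  | unit | var | con | des => simp [Tm.ren]
  | app t s iht ihs => simp [Tm.ren, iht, ihs]
  | recur S C gs ih => simp only [Tm.ren]; rw [key _ _ ih]
  | corecur S C gs ih => simp only [Tm.ren]; rw [key _ _ ih]

theorem upN_add (n i : ℕ) (θ : ℕ → Tm) : upN n θ (i + n) = (θ i).ren (· + n) := by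
  induction n with
  | zero => simp [upN, Tm.ren_id]
  | succ n ih =>
    rw [← add_assoc]; simp only [upN, up]; rw [ih, Tm.shift, Tm.ren_ren]; rfl

theorem upN_apply (n i : ℕ) (θ : ℕ → Tm) :
    upN n θ i = if i < n then .var i else (θ (i - n)).ren (· + n) := by
  split_ifs with h
  · exact upN_lt θ h
  · obtain ⟨j, rfl⟩ := Nat.exists_eq_add_of_le' (not_lt.1 h)
    rw [upN_add]; simp

theorem upN_var (n : ℕ) (ξ : ℕ → ℕ) :
    (upN n fun i => .var (ξ i)) = fun i => .var (upRenN n ξ i) := by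
  funext i
  rw [upN_apply, upRenN_apply]
  split_ifs <;> simp [Tm.ren]

/-- Renaming is substitution by variables. -/
theorem Tm.ren_eq_subst (ξ : ℕ → ℕ) (t : Tm) : t.ren ξ = t.subst fun i => .var (ξ i) := by
  have key : ∀ (ns : List ℕ) (gs : List Tm) (ξ : ℕ → ℕ),
      (∀ g ∈ gs, ∀ ξ : ℕ → ℕ, g.ren ξ = g.subst fun i => .var (ξ i)) →
      renBodies ξ ns gs = substBodies (fun i => .var (ξ i)) ns gs := by
    intro ns gs ξ h
    induction gs generalizing ns with
    | nil => cases ns <;> simp [renBodies, substBodies]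
    | cons g gs ih =>
      cases ns with
      | nil => simp [renBodies, substBodies]
      | cons n ns =>
        simp only [renBodies, substBodies]
        rw [h g (by simp), upN_var, ih _ fun g hg => h g (by simp [hg])]
  induction t using Tm.ind generalizing ξ with
  | unit | var | con | des => simp [Tm.ren, Tm.subst]
  | app t s iht ihs => simp [Tm.ren, Tm.subst, iht ξ, ihs ξ]
  | recur S C gs ih => simp only [Tm.ren, Tm.subst]; rw [key _ _ _ ih]
  | corecur S C gs ih => simp only [Tm.ren, Tm.subst]; rw [key _ _ _ ih]

theorem upN_upRenN (n : ℕ) (ξ : ℕ → ℕ) (θ : ℕ → Tm) :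
    (fun i => upN n θ (upRenN n ξ i)) = upN n fun i => θ (ξ i) := by
  funext i
  rw [upRenN_apply, upN_apply n i]
  split_ifs with h
  · rw [upN_lt _ h]
  · rw [upN_add]

theorem Tm.subst_ren (ξ : ℕ → ℕ) (θ : ℕ → Tm) (t : Tm) :
    (t.ren ξ).subst θ = t.subst fun i => θ (ξ i) := by
  have key : ∀ (ns : List ℕ) (gs : List Tm) (ξ : ℕ → ℕ) (θ : ℕ → Tm),
      (∀ g ∈ gs, ∀ (ξ : ℕ → ℕ) (θ : ℕ → Tm), (g.ren ξ).subst θ = g.subst fun i => θ (ξ i)) →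
      substBodies θ ns (renBodies ξ ns gs) = substBodies (fun i => θ (ξ i)) ns gs := by
    intro ns gs ξ θ h
    induction gs generalizing ns with
    | nil => cases ns <;> simp [renBodies, substBodies]
    | cons g gs ih =>
      cases ns with
      | nil => simp [renBodies, substBodies]
      | cons n ns =>
        simp only [renBodies, substBodies]
        rw [h g (by simp), upN_upRenN, ih _ fun g hg => h g (by simp [hg])]
  induction t using Tm.ind generalizing ξ θ with
  | unit | var | con | des => simp [Tm.ren, Tm.subst]
  | app t s iht ihs => simp [Tm.ren, Tm.subst, iht, ihs]
  | recur S C gs ih => simp only [Tm.ren, Tm.subst]; rw [key _ _ _ _ ih]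
  | corecur S C gs ih => simp only [Tm.ren, Tm.subst]; rw [key _ _ _ _ ih]

theorem upN_ren (n : ℕ) (ξ : ℕ → ℕ) (θ : ℕ → Tm) :
    (fun i => (upN n θ i).ren (upRenN n ξ)) = upN n fun i => (θ i).ren ξ := by
  funext i
  rw [upN_apply, upN_apply n i]
  split_ifs with h
  · simp [Tm.ren, upRenN_lt _ h]
  · simp only [Tm.ren_ren, upRenN_add]

theorem Tm.ren_subst (θ : ℕ → Tm) (ξ : ℕ → ℕ) (t : Tm) :
    (t.subst θ).ren ξ = t.subst fun i => (θ i).ren ξ := by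
  have key : ∀ (ns : List ℕ) (gs : List Tm) (ξ : ℕ → ℕ) (θ : ℕ → Tm),
      (∀ g ∈ gs, ∀ (θ : ℕ → Tm) (ξ : ℕ → ℕ), (g.subst θ).ren ξ = g.subst fun i => (θ i).ren ξ) →
      renBodies ξ ns (substBodies θ ns gs) = substBodies (fun i => (θ i).ren ξ) ns gs := by
    intro ns gs ξ θ h
    induction gs generalizing ns with
    | nil => cases ns <;> simp [renBodies, substBodies]
    | cons g gs ih =>
      cases ns with
      | nil => simp [renBodies, substBodies]
      | cons n ns =>
        simp only [renBodies, substBodies]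
        rw [h g (by simp), upN_ren, ih _ fun g hg => h g (by simp [hg])]
  induction t using Tm.ind generalizing ξ θ with
  | unit | var | con | des => simp [Tm.ren, Tm.subst]
  | app t s iht ihs => simp [Tm.ren, Tm.subst, iht, ihs]
  | recur S C gs ih => simp only [Tm.ren, Tm.subst]; rw [key _ _ _ _ ih]
  | corecur S C gs ih => simp only [Tm.ren, Tm.subst]; rw [key _ _ _ _ ih]

/-- For a free index the shift past the `n` binders has to cross `φ`, which is why the two mixed
laws `Tm.subst_ren` and `Tm.ren_subst` precede the composition of substitutions. -/
theorem upN_subst (n : ℕ) (θ φ : ℕ → Tm) :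
    (fun i => (upN n θ i).subst (upN n φ)) = upN n fun i => (θ i).subst φ := by
  funext i
  rw [upN_apply n i, upN_apply n i]
  split_ifs with h
  · simp [Tm.subst, upN_lt _ h]
  · rw [Tm.subst_ren, Tm.ren_subst]; simp only [upN_add]

theorem Tm.subst_subst (θ φ : ℕ → Tm) (t : Tm) :
    (t.subst θ).subst φ = t.subst fun i => (θ i).subst φ := by
  have key : ∀ (ns : List ℕ) (gs : List Tm) (θ φ : ℕ → Tm),
      (∀ g ∈ gs, ∀ (θ φ : ℕ → Tm), (g.subst θ).subst φ = g.subst fun i => (θ i).subst φ) →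
      substBodies φ ns (substBodies θ ns gs) = substBodies (fun i => (θ i).subst φ) ns gs := by
    intro ns gs θ φ h
    induction gs generalizing ns with
    | nil => cases ns <;> simp [substBodies]
    | cons g gs ih =>
      cases ns with
      | nil => simp [substBodies]
      | cons n ns =>
        simp only [substBodies]
        rw [h g (by simp), upN_subst, ih _ fun g hg => h g (by simp [hg])]
  induction t using Tm.ind generalizing θ φ with
  | unit | var | con | des => simp [Tm.subst]
  | app t s iht ihs => simp [Tm.subst, iht, ihs]
  | recur S C gs ih => simp only [Tm.subst]; rw [key _ _ _ _ ih]
  | corecur S C gs ih => simp only [Tm.subst]; rw [key _ _ _ _ ih]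

theorem Tm.subst_var (t : Tm) : t.subst Tm.var = t := by
  rw [← Tm.ren_eq_subst fun i => i, Tm.ren_id]

-- Entries and lengths of renamed and substituted lists of bodies.

theorem renBodies_getElem? (ξ : ℕ → ℕ) (ns : List ℕ) (gs : List Tm) (k : ℕ) :
    (renBodies ξ ns gs)[k]? = gs[k]?.map fun g => (ns[k]?).elim g fun n => g.ren (upRenN n ξ) := by
  induction gs generalizing ns k with
  | nil => cases ns <;> simp [renBodies]
  | cons g gs ih =>
    cases ns with
    | nil => simp [renBodies]
    | cons n ns => cases k <;> simp [renBodies, ih]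

theorem substBodies_getElem? (θ : ℕ → Tm) (ns : List ℕ) (gs : List Tm) (k : ℕ) :
    (substBodies θ ns gs)[k]? =
      gs[k]?.map fun g => (ns[k]?).elim g fun n => g.subst (upN n θ) := by
  induction gs generalizing ns k with
  | nil => cases ns <;> simp [substBodies]
  | cons g gs ih =>
    cases ns with
    | nil => simp [substBodies]
    | cons n ns => cases k <;> simp [substBodies, ih]

theorem renBodies_length (ξ : ℕ → ℕ) (ns : List ℕ) (gs : List Tm) :
    (renBodies ξ ns gs).length = gs.length := by
  induction gs generalizing ns with
  | nil => cases ns <;> simp [renBodies]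
  | cons g gs ih => cases ns <;> simp [renBodies, ih]

theorem substBodies_length (θ : ℕ → Tm) (ns : List ℕ) (gs : List Tm) :
    (substBodies θ ns gs).length = gs.length := by
  induction gs generalizing ns with
  | nil => cases ns <;> simp [substBodies]
  | cons g gs ih => cases ns <;> simp [substBodies, ih]

/-! ### Types -/

theorem Ty.ren_eq_subst (ξ : ℕ → ℕ) (A : Ty) : A.ren ξ = A.subst fun i => .var (ξ i) := by
  induction A using Ty.ind generalizing ξ with
  | one | tvar | fp => simp [Ty.ren, Ty.subst]
  | inst A t ih => simp only [Ty.ren, Ty.subst, ih ξ, Tm.ren_eq_subst]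
  | pabs A ih => simp only [Ty.ren, Ty.subst, ih, upRen_eq, up_eq, upN_var]

theorem Ty.subst_subst (θ φ : ℕ → Tm) (A : Ty) :
    (A.subst θ).subst φ = A.subst fun i => (θ i).subst φ := by
  induction A using Ty.ind generalizing θ φ with
  | one | tvar | fp => simp [Ty.subst]
  | inst A t ih => simp only [Ty.subst, ih, Tm.subst_subst]
  | pabs A ih => simp only [Ty.subst, ih, up_eq, upN_subst]

theorem Ty.subst_var (A : Ty) : A.subst Tm.var = A := by
  induction A using Ty.ind with
  | one | tvar | fp => simp [Ty.subst]
  | inst A t ih => simp only [Ty.subst, ih, Tm.subst_var]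
  | pabs A ih =>
    have : up Tm.var = Tm.var := by funext i; cases i <;> simp [up, Tm.shift, Tm.ren]
    simp only [Ty.subst, this, ih]

theorem Ty.subst_ren (ξ : ℕ → ℕ) (θ : ℕ → Tm) (A : Ty) :
    (A.ren ξ).subst θ = A.subst fun i => θ (ξ i) := by
  rw [Ty.ren_eq_subst, Ty.subst_subst]; simp only [Tm.subst]

theorem Ty.ren_subst (θ : ℕ → Tm) (ξ : ℕ → ℕ) (A : Ty) :
    (A.subst θ).ren ξ = A.subst fun i => (θ i).ren ξ := by
  rw [Ty.ren_eq_subst, Ty.subst_subst]; simp only [← Tm.ren_eq_subst]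

theorem Ty.subst_shift (θ : ℕ → Tm) (A : Ty) : A.shift.subst θ = A.subst fun i => θ (i + 1) :=
  Ty.subst_ren _ _ _

theorem Tm.subst_shift (θ : ℕ → Tm) (t : Tm) : t.shift.subst θ = t.subst fun i => θ (i + 1) :=
  Tm.subst_ren _ _ _

/-! ### Parameter contexts -/

theorem Ctx.ren_eq_subst (ξ : ℕ → ℕ) (T : Ctx) : T.ren ξ = T.subst fun i => .var (ξ i) := by
  induction T with
  | nil => rfl
  | cons A T ih => simp only [Ctx.ren, Ctx.subst, ih, upN_var, Ty.ren_eq_subst]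

@[simp] theorem Ctx.subst_length (θ : ℕ → Tm) (T : Ctx) : (T.subst θ).length = T.length := by
  induction T with
  | nil => rfl
  | cons A T ih => simp [Ctx.subst, ih]

@[simp] theorem Ctx.ren_length (ξ : ℕ → ℕ) (T : Ctx) : (T.ren ξ).length = T.length := by
  rw [Ctx.ren_eq_subst, Ctx.subst_length]

theorem Ctx.subst_subst (θ φ : ℕ → Tm) (T : Ctx) :
    (T.subst θ).subst φ = T.subst fun i => (θ i).subst φ := by
  induction T with
  | nil => rfl
  | cons A T ih => simp only [Ctx.subst, Ctx.subst_length, Ty.subst_subst, upN_subst, ih]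

theorem Ctx.subst_append (θ : ℕ → Tm) (T U : Ctx) :
    (T ++ U : List Ty).subst θ = (T.subst (upN U.length θ) ++ U.subst θ : List Ty) := by
  induction T with
  | nil => rfl
  | cons A T ih =>
    simp only [List.cons_append, Ctx.subst, ih, List.length_append, upN_upN]

theorem upN_var_id (n : ℕ) : upN n Tm.var = Tm.var := by
  rw [show Tm.var = fun i => Tm.var ((fun j => j) i) from rfl, upN_var]
  funext i; rw [upRenN_apply]; split_ifs <;> simp; omega

theorem Ctx.subst_var (T : Ctx) : T.subst Tm.var = T := by
  induction T with
  | nil => rfl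
  | cons A T ih => simp only [Ctx.subst, ih, upN_var_id, Ty.subst_var]

/-! ### Morphisms -/

/-- The morphism whose entries are the first `n` values of a substitution. -/
def argsOf (n : ℕ) (η : ℕ → Tm) : Mor := (List.range n).map η

@[simp] theorem argsOf_zero (η : ℕ → Tm) : argsOf 0 η = [] := rfl

theorem argsOf_succ (n : ℕ) (η : ℕ → Tm) :
    argsOf (n + 1) η = η 0 :: argsOf n fun i => η (i + 1) := by
  simp [argsOf, List.range_succ_eq_map, Function.comp_def]

theorem argsOf_congr {n : ℕ} {η η' : ℕ → Tm} (h : ∀ i < n, η i = η' i) :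
    argsOf n η = argsOf n η' :=
  List.map_congr_left fun i hi => h i (by simpa using hi)

theorem argsOf_map (n : ℕ) (η : ℕ → Tm) (f : Tm → Tm) :
    (argsOf n η).map f = argsOf n fun i => f (η i) := by
  simp [argsOf, Function.comp_def]

theorem idMor_eq (n : ℕ) : idMor n = argsOf n Tm.var := rfl

theorem idMorS_eq (n : ℕ) : idMorS n = argsOf n fun i => .var (i + 1) := by
  rw [idMorS, idMor_eq, argsOf_map]; simp [Tm.shift, Tm.ren]

theorem ofMor_nil : ofMor [] = Tm.var := by funext i; simp [ofMor]

@[simp] theorem ofMor_cons_zero (t : Tm) (σ : Mor) : ofMor (t :: σ) 0 = t := by simp [ofMor]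

@[simp] theorem ofMor_cons_succ (t : Tm) (σ : Mor) (i : ℕ) :
    ofMor (t :: σ) (i + 1) = ofMor σ i := by simp [ofMor]

theorem ofMor_lt {σ : Mor} {i : ℕ} (h : i < σ.length) : ofMor σ i = σ[i] := by
  simp [ofMor, h]

theorem ofMor_add (σ : Mor) (i : ℕ) : ofMor σ (i + σ.length) = .var i := by
  simp [ofMor]

theorem argsOf_ofMor (σ : Mor) : argsOf σ.length (ofMor σ) = σ := by
  induction σ with
  | nil => rfl
  | cons t σ ih => simp [argsOf_succ, ih]

theorem ofMor_map_lt {σ : Mor} {i : ℕ} (f : Tm → Tm) (h : i < σ.length) :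
    ofMor (σ.map f) i = f (ofMor σ i) := by
  simp [ofMor, h]

theorem Ty.instMor_subst (A : Ty) (σ : Mor) (θ : ℕ → Tm) :
    (A.instMor σ).subst θ = (A.subst θ).instMor (σ.map (Tm.subst θ)) := by
  induction σ with
  | nil => rfl
  | cons t σ ih => simpa [Ty.instMor, Ty.subst] using ih

theorem Tm.appMor_subst (t : Tm) (σ : Mor) (θ : ℕ → Tm) :
    (t.appMor σ).subst θ = (t.subst θ).appMor (σ.map (Tm.subst θ)) := by
  induction σ with
  | nil => rfl
  | cons s σ ih => simpa [Tm.appMor, Tm.subst] using ih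

theorem Ty.instMor_cons (A : Ty) (t : Tm) (σ : Mor) :
    A.instMor (t :: σ) = .inst (A.instMor σ) t := rfl

theorem Tm.appMor_cons (t s : Tm) (σ : Mor) : t.appMor (s :: σ) = .app (t.appMor σ) s := rfl

theorem Ty.instMor_append (A : Ty) (σ τ : Mor) :
    A.instMor (σ ++ τ) = (A.instMor τ).instMor σ := by
  simp [Ty.instMor]

theorem Tm.appMor_append (t : Tm) (σ τ : Mor) :
    t.appMor (σ ++ τ) = (t.appMor τ).appMor σ := by
  simp [Tm.appMor]

theorem argsOf_add (m n : ℕ) (η : ℕ → Tm) :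
    argsOf (m + n) η = argsOf m η ++ argsOf n fun i => η (i + m) := by
  simp [argsOf, List.range_add, Function.comp_def, add_comm]

/-! ### Type constructor variables -/

theorem tyRenComps_eq (ξ : ℕ → ℕ) (cs : List Comp) : tyRenComps ξ cs = cs.map (Comp.tyRen ξ) := by
  induction cs with
  | nil => simp [tyRenComps]
  | cons c cs ih => simp [tyRenComps, ih]

theorem tySubstComps_eq (a : ℕ → Ty) (cs : List Comp) :
    tySubstComps a cs = cs.map (Comp.tySubst a) := by
  induction cs with
  | nil => simp [tySubstComps]
  | cons c cs ih => simp [tySubstComps, ih]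

theorem tyBelowComps_eq (d : ℕ) (cs : List Comp) : tyBelowComps d cs = cs.all (Comp.tyBelow d) := by
  induction cs with
  | nil => simp [tyBelowComps]
  | cons c cs ih => simp [tyBelowComps, ih]

theorem actList_eq (a b : ℕ → Ty) (ts : ℕ → Tm) (cs : List Comp) :
    actList a b ts cs = cs.map (Comp.act a b ts) := by
  induction cs with
  | nil => simp [actList]
  | cons c cs ih => simp [actList, ih]

@[simp] theorem Comp.tySubst_dom (a : ℕ → Ty) (c : Comp) : (c.tySubst a).dom = c.dom := by
  cases c; simp [Comp.tySubst, Comp.dom]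

@[simp] theorem Comp.tySubst_mor (a : ℕ → Ty) (c : Comp) : (c.tySubst a).mor = c.mor := by
  cases c; simp [Comp.tySubst, Comp.mor]

@[simp] theorem Comp.tySubst_ty (a : ℕ → Ty) (c : Comp) : (c.tySubst a).ty = c.ty.tySubst a := by
  cases c; simp [Comp.tySubst, Comp.ty]

@[simp] theorem Comp.tyRen_dom (ξ : ℕ → ℕ) (c : Comp) : (c.tyRen ξ).dom = c.dom := by
  cases c; simp [Comp.tyRen, Comp.dom]

@[simp] theorem Comp.tyRen_mor (ξ : ℕ → ℕ) (c : Comp) : (c.tyRen ξ).mor = c.mor := by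
  cases c; simp [Comp.tyRen, Comp.mor]

@[simp] theorem Comp.tyRen_ty (ξ : ℕ → ℕ) (c : Comp) : (c.tyRen ξ).ty = c.ty.tyRen ξ := by
  cases c; simp [Comp.tyRen, Comp.ty]

theorem Comp.tyBelow_eq (d : ℕ) (c : Comp) : c.tyBelow d = c.ty.tyBelow d := by
  cases c; simp [Comp.tyBelow, Comp.ty]

theorem Comp.act_eq (a b : ℕ → Ty) (ts : ℕ → Tm) (c : Comp) :
    c.act a b ts = c.ty.act a b ts c.dom.length 0 := by
  cases c; simp [Comp.act, Comp.ty, Comp.dom]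

@[simp] theorem Sig.tySubst_par (a : ℕ → Ty) (S : Sig) : (S.tySubst a).par = S.par := by
  cases S; simp [Sig.tySubst, Sig.par]

@[simp] theorem Sig.tySubst_comps (a : ℕ → Ty) (S : Sig) :
    (S.tySubst a).comps = S.comps.map (Comp.tySubst a) := by
  cases S; simp [Sig.tySubst, Sig.comps, tySubstComps_eq]

@[simp] theorem Sig.tyRen_par (ξ : ℕ → ℕ) (S : Sig) : (S.tyRen ξ).par = S.par := by
  cases S; simp [Sig.tyRen, Sig.par]

@[simp] theorem Sig.tyRen_comps (ξ : ℕ → ℕ) (S : Sig) :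
    (S.tyRen ξ).comps = S.comps.map (Comp.tyRen ξ) := by
  cases S; simp [Sig.tyRen, Sig.comps, tyRenComps_eq]

theorem Sig.actComps_eq (a b : ℕ → Ty) (ts : ℕ → Tm) (S : Sig) :
    S.actComps a b ts = S.comps.map (Comp.act a b ts) := by
  cases S; simp [Sig.actComps, Sig.comps, actList_eq]

theorem Comp.ext {c c' : Comp} (h₁ : c.dom = c'.dom) (h₂ : c.mor = c'.mor) (h₃ : c.ty = c'.ty) :
    c = c' := by
  cases c; cases c'; simp_all [Comp.dom, Comp.mor, Comp.ty]

theorem Ty.tyRen_subst (ξ : ℕ → ℕ) (θ : ℕ → Tm) (A : Ty) :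
    (A.tyRen ξ).subst θ = (A.subst θ).tyRen ξ := by
  induction A using Ty.ind generalizing θ with
  | one | tvar | fp => simp [Ty.tyRen, Ty.subst]
  | inst A t ih => simp only [Ty.tyRen, Ty.subst, ih]
  | pabs A ih => simp only [Ty.tyRen, Ty.subst, ih]

/-- A type without free term variables. -/
def Ty.Closed (A : Ty) : Prop := ∀ θ, A.subst θ = A

theorem Ty.Closed.ren {A : Ty} (h : A.Closed) (ξ : ℕ → ℕ) : A.ren ξ = A := by
  rw [Ty.ren_eq_subst, h]

theorem Ty.closed_fp (ρ : Fix) (S : Sig) : (Ty.fp ρ S).Closed := fun _ => by simp [Ty.subst]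

theorem Ty.closed_tvar (X : ℕ) : (Ty.tvar X).Closed := fun _ => by simp [Ty.subst]

theorem Ty.Closed.tyShift {A : Ty} (h : A.Closed) : A.tyShift.Closed := fun θ => by
  rw [Ty.tyShift, Ty.tyRen_subst, h]

theorem closed_scons {A : Ty} {a : ℕ → Ty} (hA : A.Closed) (ha : ∀ X, (a X).Closed) :
    ∀ X, (scons A a X).Closed
  | 0 => hA
  | X + 1 => ha X

theorem closed_tyUp {a : ℕ → Ty} (ha : ∀ X, (a X).Closed) : ∀ X, (tyUp a X).Closed
  | 0 => Ty.closed_tvar 0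
  | X + 1 => (ha X).tyShift

/-- A replacing constructor inserted before `θ` is exposed to `θ`, one inserted afterwards is not;
closedness removes the difference. -/
theorem Ty.tySubst_subst {a : ℕ → Ty} (ha : ∀ X, (a X).Closed) (θ : ℕ → Tm) (A : Ty) :
    (A.subst θ).tySubst a = (A.tySubst a).subst θ := by
  induction A using Ty.ind generalizing θ with
  | one | fp => simp [Ty.tySubst, Ty.subst]
  | tvar X => simp only [Ty.tySubst, Ty.subst, ha X θ]
  | inst A t ih => simp only [Ty.tySubst, Ty.subst, ih]
  | pabs A ih => simp only [Ty.tySubst, Ty.subst, ih]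

theorem Ty.tyRen_tyRen (ξ ζ : ℕ → ℕ) (A : Ty) :
    (A.tyRen ξ).tyRen ζ = A.tyRen fun i => ζ (ξ i) := by
  induction A using Ty.ind generalizing ξ ζ with
  | one | tvar => simp [Ty.tyRen]
  | inst A t ih => simp only [Ty.tyRen, ih]
  | pabs A ih => simp only [Ty.tyRen, ih]
  | fp ρ p cs ih =>
    simp only [Ty.tyRen, Sig.tyRen, tyRenComps_eq, List.map_map]
    congr 2
    refine List.map_congr_left fun c hc => ?_
    exact Comp.ext (by simp) (by simp) (by
      simp only [Function.comp, Comp.tyRen_ty, ih c hc, upRen_eq, upRenN_comp])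

theorem tyUp_upRen (a : ℕ → Ty) (ξ : ℕ → ℕ) :
    (fun i => tyUp a (upRen ξ i)) = tyUp fun i => a (ξ i) := by
  funext i; cases i <;> rfl

theorem Ty.tySubst_tyRen (ξ : ℕ → ℕ) (a : ℕ → Ty) (A : Ty) :
    (A.tyRen ξ).tySubst a = A.tySubst fun i => a (ξ i) := by
  induction A using Ty.ind generalizing ξ a with
  | one | tvar => simp [Ty.tyRen, Ty.tySubst]
  | inst A t ih => simp only [Ty.tyRen, Ty.tySubst, ih]
  | pabs A ih => simp only [Ty.tyRen, Ty.tySubst, ih]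
  | fp ρ p cs ih =>
    simp only [Ty.tyRen, Sig.tyRen, Ty.tySubst, Sig.tySubst, tyRenComps_eq, tySubstComps_eq,
      List.map_map]
    congr 2
    refine List.map_congr_left fun c hc => ?_
    exact Comp.ext (by simp) (by simp) (by
      simp only [Function.comp, Comp.tyRen_ty, Comp.tySubst_ty, ih c hc, tyUp_upRen])

theorem tyUp_tyRen (a : ℕ → Ty) (ξ : ℕ → ℕ) :
    (fun i => (tyUp a i).tyRen (upRen ξ)) = tyUp fun i => (a i).tyRen ξ := by
  funext i
  cases i
  · simp [tyUp, Ty.tyRen, upRen]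
  · simp only [tyUp, Ty.tyShift, Ty.tyRen_tyRen]; rfl

theorem Ty.tyRen_tySubst (ξ : ℕ → ℕ) (a : ℕ → Ty) (A : Ty) :
    (A.tySubst a).tyRen ξ = A.tySubst fun i => (a i).tyRen ξ := by
  induction A using Ty.ind generalizing ξ a with
  | one | tvar => simp [Ty.tyRen, Ty.tySubst]
  | inst A t ih => simp only [Ty.tyRen, Ty.tySubst, ih]
  | pabs A ih => simp only [Ty.tyRen, Ty.tySubst, ih]
  | fp ρ p cs ih =>
    simp only [Ty.tyRen, Sig.tyRen, Ty.tySubst, Sig.tySubst, tyRenComps_eq, tySubstComps_eq,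
      List.map_map]
    congr 2
    refine List.map_congr_left fun c hc => ?_
    exact Comp.ext (by simp) (by simp) (by
      simp only [Function.comp, Comp.tyRen_ty, Comp.tySubst_ty, ih c hc, tyUp_tyRen])

theorem tyUp_tySubst (a b : ℕ → Ty) :
    (fun i => (tyUp a i).tySubst (tyUp b)) = tyUp fun i => (a i).tySubst b := by
  funext i
  cases i
  · simp [tyUp, Ty.tySubst]
  · simp only [tyUp, Ty.tyShift, Ty.tySubst_tyRen, Ty.tyRen_tySubst]

theorem Ty.tySubst_tySubst (a b : ℕ → Ty) (A : Ty) :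
    (A.tySubst a).tySubst b = A.tySubst fun i => (a i).tySubst b := by
  induction A using Ty.ind generalizing a b with
  | one | tvar => simp [Ty.tySubst]
  | inst A t ih => simp only [Ty.tySubst, ih]
  | pabs A ih => simp only [Ty.tySubst, ih]
  | fp ρ p cs ih =>
    simp only [Ty.tySubst, Sig.tySubst, tySubstComps_eq, List.map_map]
    congr 2
    refine List.map_congr_left fun c hc => ?_
    exact Comp.ext (by simp) (by simp) (by
      simp only [Function.comp, Comp.tySubst_ty, ih c hc, tyUp_tySubst])

theorem tyUp_tvar : tyUp Ty.tvar = Ty.tvar := by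
  funext i; cases i <;> simp [tyUp, Ty.tyShift, Ty.tyRen]

theorem Ty.tySubst_eq_of_tyBelow {d : ℕ} {a b : ℕ → Ty} {A : Ty} (hA : A.tyBelow d = true)
    (h : ∀ X < d, a X = b X) : A.tySubst a = A.tySubst b := by
  induction A using Ty.ind generalizing d a b with
  | one => simp [Ty.tySubst]
  | tvar X => simp only [Ty.tyBelow, decide_eq_true_eq] at hA; simp [Ty.tySubst, h X hA]
  | inst A t ih => simp only [Ty.tyBelow] at hA; simp only [Ty.tySubst, ih hA h]
  | pabs A ih => simp only [Ty.tyBelow] at hA; simp only [Ty.tySubst, ih hA h]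
  | fp ρ p cs ih =>
    simp only [Ty.tyBelow, Sig.tyBelow, tyBelowComps_eq, List.all_eq_true, Comp.tyBelow_eq] at hA
    simp only [Ty.tySubst, Sig.tySubst, tySubstComps_eq]
    congr 2
    refine List.map_congr_left fun c hc => Comp.ext (by simp) (by simp) ?_
    simp only [Comp.tySubst_ty]
    refine ih c hc (hA c hc) fun X hX => ?_
    cases X with
    | zero => rfl
    | succ X => simp [tyUp, h X (by omega)]

/-- This makes the identity branch of the action well typed: source and target type coincide. -/
theorem Sig.tySubst_eq_of_tyBelow {a b : ℕ → Ty} {S : Sig} (hS : S.tyBelow 1 = true) :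
    S.tySubst (tyUp a) = S.tySubst (tyUp b) := by
  have h := Ty.tySubst_eq_of_tyBelow (d := 0) (a := a) (b := b) (A := .fp .mu S)
    (by simpa [Ty.tyBelow] using hS) (by simp)
  simpa [Ty.tySubst] using h

theorem Ty.tySubst_tvar (A : Ty) : A.tySubst Ty.tvar = A := by
  induction A using Ty.ind with
  | one | tvar => simp [Ty.tySubst]
  | inst A t ih => simp only [Ty.tySubst, ih]
  | pabs A ih => simp only [Ty.tySubst, ih]
  | fp ρ p cs ih =>
    simp only [Ty.tySubst, Sig.tySubst, tySubstComps_eq, tyUp_tvar]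
    congr 2
    conv_rhs => rw [← List.map_id cs]
    exact List.map_congr_left fun c hc => Comp.ext (by simp) (by simp) (by simp [ih c hc])

theorem Ty.tyBelow_tyRen (ξ : ℕ → ℕ) (d : ℕ) (A : Ty) :
    (A.tyRen (upRenN d ξ)).tyBelow d = A.tyBelow d := by
  induction A using Ty.ind generalizing d with
  | one => simp [Ty.tyRen]
  | tvar X =>
    simp only [Ty.tyRen, Ty.tyBelow, upRenN_apply]
    split_ifs with h <;> simp [h]
  | inst A t ih => simp only [Ty.tyRen, Ty.tyBelow, ih]
  | pabs A ih => simp only [Ty.tyRen, Ty.tyBelow, ih]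
  | fp ρ p cs ih =>
    simp only [Ty.tyRen, Ty.tyBelow, Sig.tyRen, Sig.tyBelow, tyRenComps_eq, tyBelowComps_eq]
    rw [List.all_map]
    rw [Bool.eq_iff_iff, List.all_eq_true, List.all_eq_true]
    refine forall₂_congr fun c hc => ?_
    simp only [Function.comp, Comp.tyBelow_eq, Comp.tyRen_ty]
    rw [← ih c hc (d + 1)]; rfl

/-- The action branches on this test, so its outcome must not depend on the names of the variables.
-/
theorem Sig.tyBelow_tyRen (ξ : ℕ → ℕ) (S : Sig) :
    (S.tyRen (upRen ξ)).tyBelow 1 = S.tyBelow 1 := by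
  have h := Ty.tyBelow_tyRen ξ 0 (.fp .mu S)
  simpa [Ty.tyRen, Ty.tyBelow, upRenN] using h

/-! ### Well-scoped raw syntax -/

mutual
/-- `TyWS Ξ p n A`: the type `A` has `n` parameters, its term variables are below `p` and its type
constructor variables have the arities listed in `Ξ`. -/
inductive TyWS : List ℕ → ℕ → ℕ → Ty → Prop
  | one {Ξ : List ℕ} {p : ℕ} : TyWS Ξ p 0 .one
  | tvar {Ξ : List ℕ} {p n X : ℕ} : Ξ[X]? = some n → TyWS Ξ p n (.tvar X)
  | inst {Ξ : List ℕ} {p n : ℕ} {A : Ty} {t : Tm} :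
      TyWS Ξ p (n + 1) A → TmWS p t → TyWS Ξ p n (.inst A t)
  | pabs {Ξ : List ℕ} {p n : ℕ} {A : Ty} : TyWS Ξ (p + 1) n A → TyWS Ξ p (n + 1) (.pabs A)
  | fp {Ξ : List ℕ} {p : ℕ} {ρ : Fix} {S : Sig} : SigWS Ξ S → TyWS Ξ p S.par.length (.fp ρ S)
/-- Well-scoped data of a fixed point type. -/
inductive SigWS : List ℕ → Sig → Prop
  | mk {Ξ : List ℕ} {S : Sig} : (∀ c ∈ S.comps, c.mor.length = S.par.length) →
      (∀ c ∈ S.comps, ∀ t ∈ c.mor, TmWS c.dom.length t) →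
      (∀ c ∈ S.comps, TyWS (S.par.length :: Ξ) c.dom.length 0 c.ty) → SigWS Ξ S
/-- `TmWS p t`: the variables of the term `t` are below `p`. -/
inductive TmWS : ℕ → Tm → Prop
  | unit {p : ℕ} : TmWS p .unit
  | var {p x : ℕ} : x < p → TmWS p (.var x)
  | app {p : ℕ} {t s : Tm} : TmWS p t → TmWS p s → TmWS p (.app t s)
  | con {p k : ℕ} {S : Sig} : SigWS [] S → TmWS p (.con S k)
  | des {p k : ℕ} {S : Sig} : SigWS [] S → TmWS p (.des S k)
  | recur {p : ℕ} {S : Sig} {C : Ty} {gs : List Tm} : SigWS [] S →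
      gs.length = S.comps.length →
      (∀ (k : ℕ) (c : Comp) (g : Tm), S.comps[k]? = some c → gs[k]? = some g →
        TmWS (c.dom.length + 1 + p) g) → TmWS p (.recur S C gs)
  | corecur {p : ℕ} {S : Sig} {C : Ty} {gs : List Tm} : SigWS [] S →
      gs.length = S.comps.length →
      (∀ (k : ℕ) (c : Comp) (g : Tm), S.comps[k]? = some c → gs[k]? = some g →
        TmWS (c.dom.length + 1 + p) g) → TmWS p (.corecur S C gs)
end

theorem SigWS.mor_length {Ξ : List ℕ} {S : Sig} (h : SigWS Ξ S) {c : Comp} (hc : c ∈ S.comps) :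
    c.mor.length = S.par.length := by
  cases h with | mk h₁ h₂ h₃ => exact h₁ c hc

theorem SigWS.mor {Ξ : List ℕ} {S : Sig} (h : SigWS Ξ S) {c : Comp} (hc : c ∈ S.comps) :
    ∀ t ∈ c.mor, TmWS c.dom.length t := by
  cases h with | mk h₁ h₂ h₃ => exact h₂ c hc

theorem SigWS.ty {Ξ : List ℕ} {S : Sig} (h : SigWS Ξ S) {c : Comp} (hc : c ∈ S.comps) :
    TyWS (S.par.length :: Ξ) c.dom.length 0 c.ty := by
  cases h with | mk h₁ h₂ h₃ => exact h₃ c hc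

theorem Sig.binders_getElem? (S : Sig) (k : ℕ) :
    S.binders[k]? = S.comps[k]?.map fun c => c.dom.length + 1 := by
  simp [Sig.binders]

theorem exists_comp {S : Sig} {gs : List Tm} (h : gs.length = S.comps.length) {k : ℕ} {g : Tm}
    (hg : gs[k]? = some g) : ∃ c, S.comps[k]? = some c := by
  have : k < gs.length := by
    by_contra hk; rw [List.getElem?_eq_none (by omega)] at hg; simp at hg
  exact ⟨S.comps[k], List.getElem?_eq_getElem (by omega)⟩

theorem substBodies_some {S : Sig} {gs : List Tm} {k : ℕ} {c : Comp} {g : Tm} (θ : ℕ → Tm)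
    (hc : S.comps[k]? = some c) (hg : gs[k]? = some g) :
    (substBodies θ S.binders gs)[k]? = some (g.subst (upN (c.dom.length + 1) θ)) := by
  rw [substBodies_getElem?, hg, Sig.binders_getElem?, hc]; rfl

theorem substBodies_some_inv {S : Sig} {gs : List Tm} {k : ℕ} {c : Comp} {g' : Tm} {θ : ℕ → Tm}
    (hc : S.comps[k]? = some c) (hg : (substBodies θ S.binders gs)[k]? = some g') :
    ∃ g, gs[k]? = some g ∧ g' = g.subst (upN (c.dom.length + 1) θ) := by
  rw [substBodies_getElem?, Sig.binders_getElem?, hc] at hg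
  cases h : gs[k]? with
  | none => simp [h] at hg
  | some g => exact ⟨g, rfl, by simpa [h] using hg.symm⟩

theorem renBodies_some_inv {S : Sig} {gs : List Tm} {k : ℕ} {c : Comp} {g' : Tm} {ξ : ℕ → ℕ}
    (hc : S.comps[k]? = some c) (hg : (renBodies ξ S.binders gs)[k]? = some g') :
    ∃ g, gs[k]? = some g ∧ g' = g.ren (upRenN (c.dom.length + 1) ξ) := by
  rw [renBodies_getElem?, Sig.binders_getElem?, hc] at hg
  cases h : gs[k]? with
  | none => simp [h] at hg
  | some g => exact ⟨g, rfl, by simpa [h] using hg.symm⟩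

-- Well-scopedness under renaming and substitution.

theorem TmWS.ren {p q : ℕ} {t : Tm} {ξ : ℕ → ℕ} (h : TmWS p t) (hξ : ∀ i < p, ξ i < q) :
    TmWS q (t.ren ξ) := by
  have lift : ∀ {p q : ℕ} {ξ : ℕ → ℕ} (n : ℕ), (∀ i < p, ξ i < q) →
      ∀ i < n + p, upRenN n ξ i < n + q := by
    intro p q ξ n hξ i hi
    rw [upRenN_apply]
    split_ifs with hn
    · omega
    · have := hξ (i - n) (by omega); omega
  induction t using Tm.ind generalizing p q ξ with
  | unit => exact .unit
  | var x => cases h with | var h => exact .var (hξ _ h)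
  | app t s iht ihs => cases h with | app h₁ h₂ => exact .app (iht h₁ hξ) (ihs h₂ hξ)
  | con S k => cases h with | con h => exact .con h
  | des S k => cases h with | des h => exact .des h
  | recur S C gs ih =>
    cases h with | recur hS hl h =>
    refine .recur hS (by rw [renBodies_length, hl]) fun k c g' hc hg' => ?_
    obtain ⟨g, hg, rfl⟩ := renBodies_some_inv hc hg'
    exact ih g (List.mem_of_getElem? hg) (h k c g hc hg) (lift _ hξ)
  | corecur S C gs ih =>
    cases h with | corecur hS hl h =>
    refine .corecur hS (by rw [renBodies_length, hl]) fun k c g' hc hg' => ?_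
    obtain ⟨g, hg, rfl⟩ := renBodies_some_inv hc hg'
    exact ih g (List.mem_of_getElem? hg) (h k c g hc hg) (lift _ hξ)

theorem TmWS.mono {p q : ℕ} {t : Tm} (h : TmWS p t) (hpq : p ≤ q) : TmWS q t := by
  have := h.ren (ξ := fun i => i) (q := q) fun i hi => by omega
  rwa [Tm.ren_id] at this

theorem TmWS.upN {p q : ℕ} {θ : ℕ → Tm} (n : ℕ) (hθ : ∀ i < p, TmWS q (θ i)) :
    ∀ i < n + p, TmWS (n + q) (DTT.upN n θ i) := by
  intro i hi
  rw [upN_apply]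
  split_ifs with hn
  · exact .var (by omega)
  · exact (hθ (i - n) (by omega)).ren fun j hj => by omega

theorem TmWS.subst {p q : ℕ} {t : Tm} {θ : ℕ → Tm} (h : TmWS p t) (hθ : ∀ i < p, TmWS q (θ i)) :
    TmWS q (t.subst θ) := by
  induction t using Tm.ind generalizing p q θ with
  | unit => exact .unit
  | var x => cases h with | var h => exact hθ _ h
  | app t s iht ihs => cases h with | app h₁ h₂ => exact .app (iht h₁ hθ) (ihs h₂ hθ)
  | con S k => cases h with | con h => exact .con h
  | des S k => cases h with | des h => exact .des h
  | recur S C gs ih =>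
    cases h with | recur hS hl h =>
    refine .recur hS (by rw [substBodies_length, hl]) fun k c g' hc hg' => ?_
    obtain ⟨g, hg, rfl⟩ := substBodies_some_inv hc hg'
    exact ih g (List.mem_of_getElem? hg) (h k c g hc hg) (TmWS.upN _ hθ)
  | corecur S C gs ih =>
    cases h with | corecur hS hl h =>
    refine .corecur hS (by rw [substBodies_length, hl]) fun k c g' hc hg' => ?_
    obtain ⟨g, hg, rfl⟩ := substBodies_some_inv hc hg'
    exact ih g (List.mem_of_getElem? hg) (h k c g hc hg) (TmWS.upN _ hθ)

theorem upN_congr {p : ℕ} {θ φ : ℕ → Tm} (n : ℕ) (h : ∀ i < p, θ i = φ i) :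
    ∀ i < n + p, upN n θ i = upN n φ i := by
  intro i hi
  rw [upN_apply, upN_apply]
  split_ifs
  · rfl
  · rw [h _ (by omega)]

theorem TmWS.subst_congr {p : ℕ} {t : Tm} {θ φ : ℕ → Tm} (h : TmWS p t)
    (hθ : ∀ i < p, θ i = φ i) : t.subst θ = t.subst φ := by
  have key : ∀ {p : ℕ} {S : Sig} {gs : List Tm} {θ φ : ℕ → Tm}, (∀ i < p, θ i = φ i) →
      gs.length = S.comps.length →
      (∀ (k : ℕ) (c : Comp) (g : Tm), S.comps[k]? = some c → gs[k]? = some g →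
        TmWS (c.dom.length + 1 + p) g) →
      (∀ g ∈ gs, ∀ {p : ℕ} {θ φ : ℕ → Tm}, TmWS p g → (∀ i < p, θ i = φ i) →
        g.subst θ = g.subst φ) → substBodies θ S.binders gs = substBodies φ S.binders gs := by
    intro p S gs θ φ hθ hl h ih
    refine List.ext_getElem? fun k => ?_
    cases hg : gs[k]? with
    | none => simp [substBodies_getElem?, hg]
    | some g =>
      obtain ⟨c, hc⟩ := exists_comp hl hg
      rw [substBodies_some θ hc hg, substBodies_some φ hc hg,
        ih g (List.mem_of_getElem? hg) (h k c g hc hg) (upN_congr _ hθ)]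
  induction t using Tm.ind generalizing p θ φ with
  | unit | con | des => rfl
  | var x => cases h with | var h => exact hθ _ h
  | app t s iht ihs =>
    cases h with | app h₁ h₂ => simp only [Tm.subst]; rw [iht h₁ hθ, ihs h₂ hθ]
  | recur S C gs ih =>
    cases h with | recur hS hl h => simp only [Tm.subst]; rw [key hθ hl h ih]
  | corecur S C gs ih =>
    cases h with | corecur hS hl h => simp only [Tm.subst]; rw [key hθ hl h ih]

theorem TyWS.subst {Ξ : List ℕ} {p q n : ℕ} {A : Ty} {θ : ℕ → Tm} (h : TyWS Ξ p n A)
    (hθ : ∀ i < p, TmWS q (θ i)) : TyWS Ξ q n (A.subst θ) := by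
  induction A using Ty.ind generalizing p q n θ with
  | one => cases h; exact .one
  | tvar X => cases h with | tvar h => exact .tvar h
  | inst A t ih => cases h with | inst h₁ h₂ => exact .inst (ih h₁ hθ) (h₂.subst hθ)
  | pabs A ih =>
    cases h with | pabs h =>
    refine .pabs (ih h ?_)
    have := TmWS.upN 1 hθ
    intro i hi
    rw [add_comm q]; exact this i (by omega)
  | fp ρ p cs ih => cases h with | fp h => exact .fp h

theorem TyWS.mono {Ξ : List ℕ} {p q n : ℕ} {A : Ty} (h : TyWS Ξ p n A) (hpq : p ≤ q) :
    TyWS Ξ q n A := by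
  have := h.subst (θ := Tm.var) (q := q) fun i hi => .var (by omega)
  rwa [Ty.subst_var] at this

theorem TyWS.shift {Ξ : List ℕ} {p n : ℕ} {A : Ty} (h : TyWS Ξ p n A) :
    TyWS Ξ (p + 1) n A.shift := by
  rw [Ty.shift, Ty.ren_eq_subst]; exact h.subst fun i hi => .var (by omega)

theorem TyWS.subst_congr {Ξ : List ℕ} {p n : ℕ} {A : Ty} {θ φ : ℕ → Tm} (h : TyWS Ξ p n A)
    (hθ : ∀ i < p, θ i = φ i) : A.subst θ = A.subst φ := by
  induction A using Ty.ind generalizing p n θ φ with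
  | one | tvar | fp => rfl
  | inst A t ih =>
    cases h with | inst h₁ h₂ => simp only [Ty.subst]; rw [ih h₁ hθ, h₂.subst_congr hθ]
  | pabs A ih =>
    cases h with | pabs h =>
    have : ∀ i < p + 1, up θ i = up φ i := fun i hi => upN_congr 1 hθ i (by omega)
    simp only [Ty.subst]; rw [ih h this]

theorem TyWS.closed {Ξ : List ℕ} {n : ℕ} {A : Ty} (h : TyWS Ξ 0 n A) : A.Closed := fun θ => by
  rw [h.subst_congr (φ := Tm.var) (by simp), Ty.subst_var]

theorem TyWS.tyRen {Ξ Ξ' : List ℕ} {p n : ℕ} {A : Ty} {ξ : ℕ → ℕ} (h : TyWS Ξ p n A)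
    (hξ : ∀ X m, Ξ[X]? = some m → Ξ'[ξ X]? = some m) : TyWS Ξ' p n (A.tyRen ξ) := by
  induction A using Ty.ind generalizing Ξ Ξ' p n ξ with
  | one => cases h; exact .one
  | tvar X => cases h with | tvar h => exact .tvar (hξ _ _ h)
  | inst A t ih => cases h with | inst h₁ h₂ => exact .inst (ih h₁ hξ) h₂
  | pabs A ih => cases h with | pabs h => exact .pabs (ih h hξ)
  | fp ρ P cs ih =>
    cases h with | fp h =>
    have : SigWS Ξ' (Sig.tyRen (upRen ξ) (.mk P cs)) := by
      refine .mk ?_ ?_ ?_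
      · simp only [Sig.tyRen_comps, List.mem_map, Sig.tyRen_par]
        rintro _ ⟨c, hc, rfl⟩
        simpa using h.mor_length hc
      · simp only [Sig.tyRen_comps, List.mem_map]
        rintro _ ⟨c, hc, rfl⟩
        simpa using h.mor hc
      · simp only [Sig.tyRen_comps, List.mem_map, Sig.tyRen_par]
        rintro _ ⟨c, hc, rfl⟩
        simp only [Comp.tyRen_dom, Comp.tyRen_ty]
        refine ih c hc (h.ty hc) fun X m hX => ?_
        cases X with
        | zero => exact hX
        | succ X => exact hξ X m hX
    have h' := TyWS.fp (p := p) (ρ := ρ) this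
    simpa only [Ty.tyRen, Sig.tyRen_par] using h'

theorem TyWS.tyShift {Ξ : List ℕ} {p n : ℕ} {A : Ty} (m : ℕ) (h : TyWS Ξ p n A) :
    TyWS (m :: Ξ) p n A.tyShift :=
  h.tyRen fun _ _ hX => by simpa using hX

theorem TyWS.tySubst {Ξ Ξ' : List ℕ} {p n : ℕ} {A : Ty} {a : ℕ → Ty} (h : TyWS Ξ p n A)
    (ha : ∀ X m, Ξ[X]? = some m → TyWS Ξ' 0 m (a X)) : TyWS Ξ' p n (A.tySubst a) := by
  induction A using Ty.ind generalizing Ξ Ξ' p n a with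
  | one => cases h; exact .one
  | tvar X => cases h with | tvar h => exact (ha _ _ h).mono (Nat.zero_le _)
  | inst A t ih => cases h with | inst h₁ h₂ => exact .inst (ih h₁ ha) h₂
  | pabs A ih => cases h with | pabs h => exact .pabs (ih h ha)
  | fp ρ P cs ih =>
    cases h with | fp h =>
    have : SigWS Ξ' (Sig.tySubst (tyUp a) (.mk P cs)) := by
      refine .mk ?_ ?_ ?_
      · simp only [Sig.tySubst_comps, List.mem_map, Sig.tySubst_par]
        rintro _ ⟨c, hc, rfl⟩
        simpa using h.mor_length hc
      · simp only [Sig.tySubst_comps, List.mem_map]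
        rintro _ ⟨c, hc, rfl⟩
        simpa using h.mor hc
      · simp only [Sig.tySubst_comps, List.mem_map, Sig.tySubst_par]
        rintro _ ⟨c, hc, rfl⟩
        simp only [Comp.tySubst_dom, Comp.tySubst_ty]
        refine ih c hc (h.ty hc) fun X m hX => ?_
        cases X with
        | zero => exact .tvar hX
        | succ X => exact (ha X m hX).tyShift _
    have h' := TyWS.fp (p := p) (ρ := ρ) this
    simpa only [Ty.tySubst, Sig.tySubst_par] using h'

theorem TyWS.instMor {Ξ : List ℕ} {p n : ℕ} {A : Ty} {σ : Mor} (h : TyWS Ξ p (n + σ.length) A)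
    (hσ : ∀ t ∈ σ, TmWS p t) : TyWS Ξ p n (A.instMor σ) := by
  induction σ generalizing n with
  | nil => exact h
  | cons t σ ih =>
    refine .inst (ih ?_ fun s hs => hσ s (by simp [hs])) (hσ t (by simp))
    rwa [List.length_cons, ← add_assoc, add_right_comm] at h

/-! ### Substitution of morphisms -/

/-- On the first variables both sides are `σᵢ[θ]`; on the others the shift made by `upN` is
cancelled by the substitution of the entries. -/
theorem upN_ofMor (σ : Mor) (θ : ℕ → Tm) :
    (fun i => (upN σ.length θ i).subst (ofMor (σ.map (Tm.subst θ)))) =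
      fun i => (ofMor σ i).subst θ := by
  funext i
  rw [upN_apply]
  split_ifs with h
  · simp [Tm.subst, ofMor, h]
  · obtain ⟨j, rfl⟩ := Nat.exists_eq_add_of_le' (not_lt.1 h)
    rw [ofMor_add, Tm.subst_ren]
    simp only [add_tsub_cancel_right, Tm.subst]
    have : (fun i => ofMor (σ.map (Tm.subst θ)) (i + σ.length)) = Tm.var := by
      funext i
      have := ofMor_add (σ.map (Tm.subst θ)) i
      simpa using this
    rw [this, Tm.subst_var]

theorem Tm.subst_ofMor (t : Tm) (σ : Mor) (θ : ℕ → Tm) :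
    (t.subst (ofMor σ)).subst θ =
      (t.subst (upN σ.length θ)).subst (ofMor (σ.map (Tm.subst θ))) := by
  rw [Tm.subst_subst, Tm.subst_subst, upN_ofMor]

theorem Ty.subst_ofMor (A : Ty) (σ : Mor) (θ : ℕ → Tm) :
    (A.subst (ofMor σ)).subst θ =
      (A.subst (upN σ.length θ)).subst (ofMor (σ.map (Tm.subst θ))) := by
  rw [Ty.subst_subst, Ty.subst_subst, upN_ofMor]

theorem Ctx.subst_ofMor (T : Ctx) (σ : Mor) (θ : ℕ → Tm) :
    (T.subst (ofMor σ)).subst θ =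
      (T.subst (upN σ.length θ)).subst (ofMor (σ.map (Tm.subst θ))) := by
  rw [Ctx.subst_subst, Ctx.subst_subst, upN_ofMor]

/-- A variable of `σ` beyond the length of `τ` would be replaced by `θ` on the left but not on the
right. This is one of the reasons why stability of contraction needs scoping. -/
theorem Mor.comp_map {σ τ : Mor} (θ : ℕ → Tm) (hσ : ∀ t ∈ σ, TmWS τ.length t) :
    (σ.comp τ).map (Tm.subst θ) = σ.comp (τ.map (Tm.subst θ)) := by
  simp only [Mor.comp, List.map_map]
  refine List.map_congr_left fun t ht => ?_
  simp only [Function.comp]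
  rw [Tm.subst_subst]
  exact (hσ t ht).subst_congr fun i hi => (ofMor_map_lt _ hi).symm

theorem Tm.subst_replaceLast (g F : Tm) (n : ℕ) (θ : ℕ → Tm) :
    (g.subst (replaceLast F)).subst (upN (n + 1) θ) =
      (g.subst (upN (n + 1) θ)).subst (replaceLast (F.subst (upN (n + 1) θ))) := by
  rw [Tm.subst_subst, Tm.subst_subst]
  congr 1
  funext i
  cases i with
  | zero => simp [replaceLast, upN, up, Tm.subst]
  | succ i =>
    simp only [replaceLast, Tm.subst, upN, up, Tm.subst_shift]
    rw [Tm.shift, Tm.ren_eq_subst]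

theorem idMorS_map (n : ℕ) (θ : ℕ → Tm) :
    (idMorS n).map (Tm.subst (upN (n + 1) θ)) = idMorS n := by
  rw [idMorS_eq, argsOf_map]
  refine argsOf_congr fun i hi => ?_
  simp only [Tm.subst]
  rw [upN_lt _ (by omega)]

theorem Tm.generic_subst (h : Tm) (n : ℕ) (θ : ℕ → Tm) :
    (h.generic n).subst (upN (n + 1) θ) = (h.subst θ).generic n := by
  simp only [Tm.generic, Tm.subst, Tm.appMor_subst, idMorS_map, Tm.subst_ren, upN_add,
    Tm.ren_subst]
  rw [upN_lt _ (by omega)]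

/-! ### The action of types and substitution -/

theorem zip_mapIdx (f : Comp → Tm) (h : ℕ → Comp × Tm → Tm) (cs : List Comp) :
    (cs.zip (cs.map f)).mapIdx h = cs.mapIdx fun k c => h k (c, f c) := by
  refine List.ext_getElem? fun k => ?_
  simp only [List.getElem?_mapIdx, List.zip, List.getElem?_zipWith,
    List.getElem?_map]
  cases cs[k]? <;> simp

/-- The zip of the components with their actions becomes one indexed map over the components, the
form in which hypotheses about each `Aₖ` apply. -/
theorem Ty.act_mu (a b : ℕ → Ty) (ts : ℕ → Tm) (p n : ℕ) (S : Sig) :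
    (Ty.fp .mu S).act a b ts p n = if S.tyBelow 1 then .var 0 else
      .app ((Tm.recur (S.tySubst (tyUp a)) (.fp .mu (S.tySubst (tyUp b)))
        (S.comps.mapIdx fun k c =>
          .app ((Tm.con (S.tySubst (tyUp b)) k).appMor (idMorS c.dom.length))
            ((c.ty.act (scons (.fp .mu (S.tySubst (tyUp b))) a)
              (scons (.fp .mu (S.tySubst (tyUp b))) b) (scons (.var 0) ts) c.dom.length 0).ren
                (upRenN (c.dom.length + 1) (· + (p + n + 1)))))).appMor (idMorS S.par.length))
        (.var 0) := by
  simp only [Ty.act, Sig.actComps_eq, zip_mapIdx, Comp.act_eq]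

theorem Ty.act_nu (a b : ℕ → Ty) (ts : ℕ → Tm) (p n : ℕ) (S : Sig) :
    (Ty.fp .nu S).act a b ts p n = if S.tyBelow 1 then .var 0 else
      .app ((Tm.corecur (S.tySubst (tyUp b)) (.fp .nu (S.tySubst (tyUp a)))
        (S.comps.mapIdx fun k c =>
          ((c.ty.act (scons (.fp .nu (S.tySubst (tyUp a))) a)
            (scons (.fp .nu (S.tySubst (tyUp a))) b) (scons (.var 0) ts) c.dom.length 0).ren
              (upRenN (c.dom.length + 1) (· + (p + n + 1)))).subst
            (replaceLast (.app ((Tm.des (S.tySubst (tyUp a)) k).appMor (idMorS c.dom.length))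
              (.var 0))))).appMor (idMorS S.par.length))
        (.var 0) := by
  simp only [Ty.act, Sig.actComps_eq, zip_mapIdx, Comp.act_eq]

theorem scons_upRen {α : Type} (x : α) (f : ℕ → α) (ξ : ℕ → ℕ) :
    (fun i => scons x f (upRen ξ i)) = scons x fun i => f (ξ i) := by
  funext i; cases i <;> rfl

theorem mapIdx_map_congr (f : Comp → Comp) {g h : ℕ → Comp → Tm} {cs : List Comp}
    (H : ∀ c ∈ cs, ∀ k, g k (f c) = h k c) : (cs.map f).mapIdx g = cs.mapIdx h := by
  refine List.ext_getElem? fun k => ?_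
  simp only [List.getElem?_mapIdx, List.getElem?_map]
  cases hc : cs[k]? with
  | none => rfl
  | some c => simp [H c (List.mem_of_getElem? hc)]

theorem mapIdx_congr {g h : ℕ → Comp → Tm} {cs : List Comp}
    (H : ∀ c ∈ cs, ∀ k, g k c = h k c) : cs.mapIdx g = cs.mapIdx h := by
  refine List.ext_getElem? fun k => ?_
  simp only [List.getElem?_mapIdx]
  cases hc : cs[k]? with
  | none => rfl
  | some c => simp [H c (List.mem_of_getElem? hc)]

theorem Sig.tySubst_tyRen (ξ : ℕ → ℕ) (a : ℕ → Ty) (S : Sig) :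
    (S.tyRen (upRen ξ)).tySubst (tyUp a) = S.tySubst (tyUp fun i => a (ξ i)) := by
  have := Ty.tySubst_tyRen ξ a (.fp .mu S)
  simpa [Ty.tyRen, Ty.tySubst] using this

theorem Ty.act_tyRen (ξ : ℕ → ℕ) (a b : ℕ → Ty) (ts : ℕ → Tm) (p n : ℕ) (A : Ty) :
    (A.tyRen ξ).act a b ts p n =
      A.act (fun i => a (ξ i)) (fun i => b (ξ i)) (fun i => ts (ξ i)) p n := by
  induction A using Ty.ind generalizing ξ a b ts p n with
  | one | tvar => simp [Ty.tyRen, Ty.act]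
  | inst A t ih => simp only [Ty.tyRen, Ty.act, ih]
  | pabs A ih => simp only [Ty.tyRen, Ty.act, ih]
  | fp ρ P cs ih =>
    have ih' : ∀ c ∈ cs, ∀ R : Ty, (c.ty.tyRen (upRen ξ)).act (scons R a) (scons R b)
        (scons (.var 0) ts) c.dom.length 0 = c.ty.act (scons R fun i => a (ξ i))
        (scons R fun i => b (ξ i)) (scons (.var 0) fun i => ts (ξ i)) c.dom.length 0 := by
      intro c hc R
      rw [ih c hc]; simp only [scons_upRen]
    cases ρ with
    | mu =>
      simp only [Ty.tyRen, Ty.act_mu, Sig.tyBelow_tyRen, Sig.tySubst_tyRen, Sig.tyRen_comps,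
        Sig.tyRen_par]
      split_ifs
      · rfl
      · congr 3
        refine mapIdx_map_congr _ fun c hc k => ?_
        simp only [Comp.tyRen_dom, Comp.tyRen_ty, ih' c hc]
    | nu =>
      simp only [Ty.tyRen, Ty.act_nu, Sig.tyBelow_tyRen, Sig.tySubst_tyRen, Sig.tyRen_comps,
        Sig.tyRen_par]
      split_ifs
      · rfl
      · congr 3
        refine mapIdx_map_congr _ fun c hc k => ?_
        simp only [Comp.tyRen_dom, Comp.tyRen_ty, ih' c hc]

theorem substBodies_mapIdx {S : Sig} {cs : List Comp}
    (hS : S.binders = cs.map fun c => c.dom.length + 1)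
    (θ : ℕ → Tm) (f : ℕ → Comp → Tm) :
    substBodies θ S.binders (cs.mapIdx f) =
      cs.mapIdx fun k c => (f k c).subst (upN (c.dom.length + 1) θ) := by
  refine List.ext_getElem? fun k => ?_
  rw [substBodies_getElem?, hS]
  simp only [List.getElem?_mapIdx, List.getElem?_map]
  cases cs[k]? <;> simp

theorem Tm.subst_congr {t : Tm} {θ φ : ℕ → Tm} (h : ∀ i, θ i = φ i) : t.subst θ = t.subst φ := by
  rw [funext h]

theorem Tm.ren_ren_subst (F : Tm) (m q : ℕ) (ψ : ℕ → Tm) :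
    (F.ren (upRenN m (· + q))).subst (upN m ψ) = F.subst (upN m fun i => ψ (i + q)) := by
  rw [Tm.subst_ren, upN_upRenN]

/-- A substitution `ψ` that is the given one, `θ`, on the variables from `q` on acts on the bodies
of the (co)recursors in the action of a fixed point type. -/
theorem Ty.act_fp_subst {ρ : Fix} {S : Sig} {a b : ℕ → Ty} {ts ts' : ℕ → Tm} {p n p' : ℕ}
    {ψ θ : ℕ → Tm} (hn : S.par.length = n) (hlt : ∀ i < n + 1, ψ i = .var i)
    (hψ : ∀ i, ψ (i + (p + n + 1)) = (θ i).ren (· + (p' + n + 1)))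
    (ih : ∀ c ∈ S.comps, ∀ R, (c.ty.act (scons R a) (scons R b) (scons (.var 0) ts)
      c.dom.length 0).subst (upN (c.dom.length + 1) θ) =
      c.ty.act (scons R a) (scons R b) (scons (.var 0) ts') c.dom.length 0) :
    ((Ty.fp ρ S).act a b ts p n).subst ψ = (Ty.fp ρ S).act a b ts' p' n := by
  have hid : (idMorS S.par.length).map (Tm.subst ψ) = idMorS S.par.length := by
    rw [idMorS_eq, argsOf_map]
    exact argsOf_congr fun i hi => by simp only [Tm.subst]; exact hlt _ (by omega)
  have h0 : ψ 0 = .var 0 := hlt 0 (by omega)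
  -- The bodies are shifted past the `p + n + 1` variables in front of `Δ`, so they meet only the
  -- later values of `ψ`, which come from `θ`.
  have hF : ∀ (F : Tm) (m : ℕ), (F.ren (upRenN m (· + (p + n + 1)))).subst (upN m ψ) =
      (F.subst (upN m θ)).ren (upRenN m (· + (p' + n + 1))) := by
    intro F m
    rw [Tm.ren_ren_subst, Tm.ren_subst, upN_ren]
    simp only [hψ]
  cases ρ with
  | mu =>
    simp only [Ty.act_mu]
    split_ifs
    · simpa [Tm.subst] using h0
    · simp only [Tm.subst, Tm.appMor_subst, hid, h0]
      rw [substBodies_mapIdx (by simp [Sig.binders])]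
      congr 3
      refine mapIdx_congr fun c hc k => ?_
      simp only [Tm.subst, Tm.appMor_subst, idMorS_map, hF, ih c hc]
  | nu =>
    simp only [Ty.act_nu]
    split_ifs
    · simpa [Tm.subst] using h0
    · simp only [Tm.subst, Tm.appMor_subst, hid, h0]
      rw [substBodies_mapIdx (by simp [Sig.binders])]
      congr 3
      refine mapIdx_congr fun c hc k => ?_
      rw [Tm.subst_replaceLast, hF, ih c hc]
      simp only [Tm.subst, Tm.appMor_subst, idMorS_map]
      rw [upN_lt _ (by omega)]

/-- The terms that occur in a well-scoped `A` use only the `p` variables of `Γ'`, so the action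
depends on `Δ` through `ts` alone, and a substitution for `Δ` can be moved into `ts`. -/
theorem Ty.act_subst {Ξ : List ℕ} {p n : ℕ} {A : Ty} {a b : ℕ → Ty} {ts ts' : ℕ → Tm}
    {θ : ℕ → Tm} (h : TyWS Ξ p n A)
    (hts : ∀ X m, Ξ[X]? = some m → ts' X = (ts X).subst (upN (m + 1) θ)) :
    (A.act a b ts p n).subst (upN (p + n + 1) θ) = A.act a b ts' p n := by
  induction A using Ty.ind generalizing Ξ p n a b ts ts' with
  | one => simp only [Ty.act, Tm.subst]; rw [upN_lt _ (by omega)]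
  | tvar X =>
    cases h with | tvar h =>
    simp only [Ty.act, hts X n h]
    rw [show p + n + 1 = (n + 1) + p by omega, ← upN_upN, Tm.ren_ren_subst, Tm.ren_subst, upN_ren]
    simp only [upN_add]
  | inst A t ih =>
    cases h with | inst h₁ h₂ =>
    simp only [Ty.act]
    rw [← ih h₁ hts, Tm.subst_subst, Tm.subst_subst]
    refine Tm.subst_congr fun i => ?_
    rw [show p + n + 1 = (n + 1) + p by omega, ← upN_upN (n + 1) p,
      show p + (n + 1) + 1 = (n + 1) + (1 + p) by omega, ← upN_upN (n + 1) (1 + p)]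
    have h₃ := congrFun (upN_subst (n + 1) (ofMor [t]) (DTT.upN p θ)) i
    have h₄ := congrFun (upN_subst (n + 1) (DTT.upN (1 + p) θ) (ofMor [t])) i
    rw [h₃, h₄]
    congr 2
    funext j
    -- The lifted substitution fixes the first `p` variables, and `t` has no others; hence it
    -- commutes with `[t]`.
    have ht : t.subst (DTT.upN p θ) = t := by
      rw [h₂.subst_congr (φ := Tm.var) fun i hi => upN_lt _ hi, Tm.subst_var]
    have := congrFun (upN_ofMor [t] (DTT.upN p θ)) j
    simp only [List.length_singleton, upN_upN, List.map_cons, List.map_nil, ht] at this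
    exact this.symm
  | pabs A ih =>
    cases h with | pabs h =>
    rename_i n
    simp only [Ty.act]
    have := ih (a := a) (b := b) h hts
    rwa [show p + 1 + n + 1 = p + (n + 1) + 1 by omega] at this
  | fp ρ P cs ih =>
    cases h with | fp h =>
    refine Ty.act_fp_subst (n := (Sig.mk P cs).par.length) (θ := θ) rfl
      (fun i hi => upN_lt _ (by omega)) (fun i => upN_add _ _ _) ?_
    intro c hc R
    have h' := ih c hc (a := scons R a) (b := scons R b) (ts := scons (.var 0) ts)
      (ts' := scons (.var 0) ts') (h.ty hc) (by
        intro X m hX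
        cases X with
        | zero => simp only [scons, Tm.subst]; rw [upN_lt _ (by omega)]
        | succ X => exact hts X m (by simpa using hX))
    simpa using h'

/-- Weakening inserts the new variable at `k = 0`. Larger `k` is forced by parameter abstraction,
which moves a parameter into `Γ'` in front of the inserted variable. -/
theorem Ty.act_ren {Ξ : List ℕ} {p n k : ℕ} {A : Ty} {a b : ℕ → Ty} {ts : ℕ → Tm}
    (h : TyWS Ξ p n A) (hk : k ≤ p) :
    (A.ren (upRenN k Nat.succ)).act a b ts (p + 1) n =
      (A.act a b ts p n).ren (upRenN (n + 1 + k) Nat.succ) := by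
  induction A using Ty.ind generalizing Ξ p n k a b ts with
  | one => simp only [Ty.ren, Ty.act, Tm.ren]; rw [upRenN_lt _ (by omega)]
  | tvar X =>
    simp only [Ty.act, Ty.ren]
    rw [Tm.ren_ren, ← upRenN_upRenN (n + 1) k, upRenN_comp]
    congr 2
    funext i
    -- As `k ≤ p`, the index `i + p` lies beyond the `k` fixed variables.
    rw [upRenN_ge _ (by omega)]; omega
  | inst A t ih =>
    cases h with | inst h₁ h₂ =>
    simp only [Ty.act, Ty.ren]
    rw [ih h₁ hk, Tm.subst_ren, Tm.ren_subst]
    refine Tm.subst_congr fun i => ?_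
    rw [show n + 1 + 1 + k = (n + 1) + (1 + k) by omega, ← upRenN_upRenN (n + 1),
      ← upRenN_upRenN (n + 1)]
    have h₃ := congrFun (upN_upRenN (n + 1) (upRenN (1 + k) Nat.succ)
      (ofMor [t.ren (upRenN k Nat.succ)])) i
    have h₄ := congrFun (upN_ren (n + 1) (upRenN k Nat.succ) (ofMor [t])) i
    rw [h₃, h₄]
    congr 2
    funext j
    cases j with
    | zero => rw [upRenN_lt _ (by omega)]; simp
    | succ j =>
      rw [add_comm 1 k]
      simp [upRenN, upRen, ofMor_nil, Tm.ren]
  | pabs A ih =>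
    cases h with | pabs h =>
    simp only [Ty.act, Ty.ren]
    rename_i n
    simp only [Nat.add_sub_cancel]
    have := ih (a := a) (b := b) (ts := ts) (k := k + 1) h (by omega)
    rwa [show n + 1 + (k + 1) = n + 1 + 1 + k by omega] at this
  | fp ρ P cs ih =>
    cases h with | fp h =>
    rw [Tm.ren_eq_subst]
    simp only [Ty.ren]
    symm
    -- The bodies come from `Δ, Γₖ, x` and do not see `Γ'`: nothing is substituted in them, and only
    -- their outer shift grows by one.
    refine Ty.act_fp_subst (n := (Sig.mk P cs).par.length) (p' := p + 1) (θ := Tm.var) rfl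
      (fun i hi => by rw [upRenN_lt _ (by omega)])
      (fun i => ?_) ?_
    · rw [upRenN_ge _ (by omega)]; simp only [Tm.ren, Tm.var.injEq]; omega
    · intro c hc R
      rw [upN_var_id, Tm.subst_var]

/-! ### Reduction and substitution -/

theorem Ty.act1_subst {N p : ℕ} {A B C : Ty} {t : Tm} {θ : ℕ → Tm} (h : TyWS [N] p 0 A) :
    (A.act1 B C t p).subst (upN (p + 1) θ) = A.act1 B C (t.subst (upN (N + 1) θ)) p := by
  refine Ty.act_subst (n := 0) h fun X m hX => ?_
  cases X with
  | zero => simp only [List.getElem?_cons_zero, Option.some.injEq] at hX; subst hX; rfl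
  | succ X => simp at hX

/-- Scoping enters twice: to move `θ` through `σₖ • τ`, so that the redex keeps its shape, and to
move it through the action of `Aₖ` into the (co)recursor. -/
theorem Contr.subst {p : ℕ} {t t' : Tm} (h : Contr t t') (ht : TmWS p t) (θ : ℕ → Tm) :
    Contr (t.subst θ) (t'.subst θ) := by
  have head : ∀ {p : ℕ} {t : Tm} {σ : Mor}, TmWS p (t.appMor σ) → TmWS p t := by
    intro p t σ h
    induction σ with
    | nil => exact h
    | cons s σ ih => rw [Tm.appMor_cons] at h; cases h with | app h _ => exact ih h
  cases h with
  | recur S C gs k c g τ u hc hg hτ =>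
    have hS : SigWS [] S := by
      cases ht with | app h _ => cases head h with | recur h _ _ => exact h
    have hmem := List.mem_of_getElem? hc
    simp only [Tm.subst, Tm.appMor_subst]
    rw [Mor.comp_map θ (by rw [hτ]; exact hS.mor hmem), Tm.subst_ofMor]
    simp only [List.length_cons, hτ, List.map_cons]
    rw [Tm.subst_replaceLast, Ty.act1_subst (hS.ty hmem), Tm.generic_subst]
    exact .recur S C _ k c _ _ _ hc (substBodies_some θ hc hg) (by simpa using hτ)
  | corecur S C gs k c g τ u hc hg hτ =>
    have hS : SigWS [] S := by
      cases ht with | app h _ => cases head h with | des h => exact h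
    have hmem := List.mem_of_getElem? hc
    simp only [Tm.subst, Tm.appMor_subst]
    rw [Mor.comp_map θ (by rw [hτ]; exact hS.mor hmem), Tm.subst_ofMor]
    simp only [List.length_cons, hτ, List.map_cons]
    rw [Tm.subst_replaceLast, Ty.act1_subst (hS.ty hmem), Tm.generic_subst]
    exact .corecur S C _ k c _ _ _ hc (substBodies_some θ hc hg) (by simpa using hτ)

theorem substBodies_append (θ : ℕ → Tm) (ns : List ℕ) (gs₁ gs₂ : List Tm) :
    substBodies θ ns (gs₁ ++ gs₂) =
      substBodies θ ns gs₁ ++ substBodies θ (ns.drop gs₁.length) gs₂ := by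
  induction gs₁ generalizing ns with
  | nil => cases ns <;> simp [substBodies]
  | cons g gs₁ ih =>
    cases ns with
    | nil => cases gs₂ <;> simp [substBodies]
    | cons n ns => simp [substBodies, ih]

theorem Step.subst {p : ℕ} {t t' : Tm} (h : Step t t') (ht : TmWS p t) (θ : ℕ → Tm) :
    Step (t.subst θ) (t'.subst θ) := by
  have key : ∀ {S : Sig} {gs₁ gs₂ : List Tm} {g g' : Tm} {p : ℕ} {θ : ℕ → Tm},
      (gs₁ ++ g :: gs₂).length = S.comps.length →
      (∀ (k : ℕ) (c : Comp) (g₀ : Tm), S.comps[k]? = some c →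
        (gs₁ ++ g :: gs₂)[k]? = some g₀ → TmWS (c.dom.length + 1 + p) g₀) →
      (∀ {p : ℕ}, TmWS p g → ∀ θ, Step (g.subst θ) (g'.subst θ)) →
      ∃ hs₁ hs₂ r r', Step r r' ∧ substBodies θ S.binders (gs₁ ++ g :: gs₂) = hs₁ ++ r :: hs₂ ∧
        substBodies θ S.binders (gs₁ ++ g' :: gs₂) = hs₁ ++ r' :: hs₂ := by
    intro S gs₁ gs₂ g g' p θ hl h ih
    have hg : (gs₁ ++ g :: gs₂)[gs₁.length]? = some g := by simp
    obtain ⟨c, hc⟩ := exists_comp hl hg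
    have hd : S.binders.drop gs₁.length =
        (c.dom.length + 1) :: S.binders.drop (gs₁.length + 1) := by
      have hb : S.binders[gs₁.length]? = some (c.dom.length + 1) := by
        rw [Sig.binders_getElem?, hc]; rfl
      obtain ⟨hlt, hb⟩ := List.getElem?_eq_some_iff.1 hb
      rw [List.drop_eq_getElem_cons hlt, hb]
    refine ⟨substBodies θ S.binders gs₁, substBodies θ (S.binders.drop (gs₁.length + 1)) gs₂, _, _,
      ih (h _ c g hc hg) (upN (c.dom.length + 1) θ), ?_, ?_⟩ <;>
      rw [substBodies_append, hd, substBodies]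
  induction h generalizing p θ with
  | contr h => exact .contr (h.subst ht θ)
  | appLeft s h ih => cases ht with | app h₁ h₂ => exact .appLeft _ (ih h₁ θ)
  | appRight t h ih => cases ht with | app h₁ h₂ => exact .appRight _ (ih h₂ θ)
  | recur S C gs₁ gs₂ h ih =>
    cases ht with | recur hS hl h =>
    obtain ⟨hs₁, hs₂, r, r', hr, h₁, h₂⟩ := key (θ := θ) hl h ih
    simp only [Tm.subst, h₁, h₂]
    exact .recur S C hs₁ hs₂ hr
  | corecur S C gs₁ gs₂ h ih =>
    cases ht with | corecur hS hl h =>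
    obtain ⟨hs₁, hs₂, r, r', hr, h₁, h₂⟩ := key (θ := θ) hl h ih
    simp only [Tm.subst, h₁, h₂]
    exact .corecur S C hs₁ hs₂ hr

theorem TyStep.subst {Ξ : List ℕ} {p n : ℕ} {A A' : Ty} (h : TyStep A A') (hA : TyWS Ξ p n A)
    (θ : ℕ → Tm) : TyStep (A.subst θ) (A'.subst θ) := by
  induction A using Ty.ind generalizing Ξ p n A' θ with
  | one => cases h
  | tvar X => cases h
  | inst A t ih =>
    cases hA with | inst h₁ h₂ =>
    cases h with
    | beta A t =>
      rw [Ty.subst_ofMor]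
      exact .beta _ _
    | param A h => exact .param _ (h.subst h₂ θ)
    | inst t h => exact .inst _ (ih h h₁ θ)
  | pabs A ih =>
    cases hA with | pabs hA =>
    cases h with | pabs h => exact .pabs (ih h hA _)
  | fp ρ P cs ih =>
    -- Substitution leaves a fixed point type and its reduct unchanged, so the given step is reused
    -- as it is.
    generalize hB : Ty.fp ρ (.mk P cs) = B at h
    cases h with
    | beta | param | inst | pabs => cases hB
    | par => exact .par _ _ _ _ ‹_›
    | comp => exact .comp _ _ _ _ ‹_›

theorem TyConv.subst {Ξ : List ℕ} {p q m n : ℕ} {A B : Ty} (h : TyConv A B) (hA : TyWS Ξ p n A)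
    (hB : TyWS Ξ q m B) (θ : ℕ → Tm) : TyConv (A.subst θ) (B.subst θ) :=
  h.imp (fun h => h.subst hA θ) fun h => h.subst hB θ

/-! ### Induction on derivations -/

/-- The five judgements get motives that do not depend on the derivations. Every induction over the
simultaneous judgements below is an instance of this principle. -/
theorem judgement_induction {mC : Ctx → Prop} {mX : TyCtx → Prop} {mM : Ctx → Mor → Ctx → Prop}
    {mK : TyCtx → Ctx → Ty → Ctx → Prop} {mT : Ctx → Tm → Ctx → Ty → Prop}
    (ctx_nil : mC [])
    (ctx_cons : ∀ {Γ : Ctx} {A : Ty}, IsCtx Γ → HasKind [] Γ A [] → mC Γ → mK [] Γ A [] →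
      mC (A :: Γ))
    (tyCtx_nil : mX [])
    (tyCtx_cons : ∀ {Ξ : TyCtx} {Γ : Ctx}, IsTyCtx Ξ → IsCtx Γ → mX Ξ → mC Γ → mX (Γ :: Ξ))
    (mor_nil : ∀ {Γ : Ctx}, IsCtx Γ → mC Γ → mM Γ [] [])
    (mor_cons : ∀ {Γ₁ Γ₂ : Ctx} {σ : Mor} {t : Tm} {A : Ty}, IsMor Γ₁ σ Γ₂ → HasKind [] Γ₂ A [] →
      Typed Γ₁ t [] (A.subst (ofMor σ)) → mM Γ₁ σ Γ₂ → mK [] Γ₂ A [] →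
      mT Γ₁ t [] (A.subst (ofMor σ)) → mM Γ₁ (t :: σ) (A :: Γ₂))
    (one : mK [] [] .one [])
    (tvar : ∀ {Ξ : TyCtx} {T : Ctx}, IsTyCtx Ξ → IsCtx T → mX Ξ → mC T →
      mK (T :: Ξ) [] (.tvar 0) T)
    (tyVarWeak : ∀ {Ξ : TyCtx} {Γ T U : Ctx} {A : Ty}, HasKind Ξ Γ A T → IsCtx U → mK Ξ Γ A T →
      mC U → mK (U :: Ξ) Γ A.tyShift T)
    (tyWeak : ∀ {Ξ : TyCtx} {Γ T : Ctx} {A B : Ty}, HasKind Ξ Γ A T → HasKind [] Γ B [] →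
      mK Ξ Γ A T → mK [] Γ B [] → mK Ξ (B :: Γ) A.shift (Ctx.ren Nat.succ T))
    (kinst : ∀ {Ξ : TyCtx} {Γ T : Ctx} {A B : Ty} {t : Tm}, HasKind Ξ Γ A (T ++ [B]) →
      Typed Γ t [] B → mK Ξ Γ A (T ++ [B]) → mT Γ t [] B →
      mK Ξ Γ (.inst A t) (Ctx.subst (ofMor [t]) T))
    (pabs : ∀ {Ξ : TyCtx} {Γ T : Ctx} {A B : Ty}, HasKind Ξ (A :: Γ) B T → mK Ξ (A :: Γ) B T →
      mK Ξ Γ (.pabs B) (T ++ [A]))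
    (fp : ∀ {Ξ : TyCtx} (ρ : Fix) {S : Sig}, IsTyCtx Ξ → IsCtx S.par →
      (∀ c ∈ S.comps, IsMor c.dom c.mor S.par) →
      (∀ c ∈ S.comps, HasKind (S.par :: Ξ) c.dom c.ty []) →
      mX Ξ → mC S.par → (∀ c ∈ S.comps, mM c.dom c.mor S.par) →
      (∀ c ∈ S.comps, mK (S.par :: Ξ) c.dom c.ty []) → mK Ξ [] (.fp ρ S) S.par)
    (unit : mT [] .unit [] .one)
    (inst : ∀ {Γ T : Ctx} {t s : Tm} {A B : Ty}, Typed Γ t (T ++ [A]) B → Typed Γ s [] A →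
      mT Γ t (T ++ [A]) B → mT Γ s [] A →
      mT Γ (.app t s) (Ctx.subst (ofMor [s]) T) (B.subst (upN T.length (ofMor [s]))))
    (conv : ∀ {Γ T : Ctx} {t : Tm} {A B : Ty}, Typed Γ t T A → TyConv A B →
      HasKind [] (T ++ Γ) B [] → mT Γ t T A → mK [] (T ++ Γ) B [] → mT Γ t T B)
    (proj : ∀ {Γ : Ctx} {A : Ty}, HasKind [] Γ A [] → mK [] Γ A [] →
      mT (A :: Γ) (.var 0) [] A.shift)
    (weak : ∀ {Γ T : Ctx} {t : Tm} {A B : Ty}, Typed Γ t T A → HasKind [] Γ B [] →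
      mT Γ t T A → mK [] Γ B [] →
      mT (B :: Γ) t.shift (Ctx.ren Nat.succ T) (A.ren (upRenN T.length Nat.succ)))
    (con : ∀ {S : Sig} {k : ℕ} {c : Comp}, HasKind [] [] (.fp .mu S) S.par →
      S.comps[k]? = some c → mK [] [] (.fp .mu S) S.par →
      mT [] (.con S k) (c.ty.tySubst1 (.fp .mu S) :: c.dom)
        ((Ty.fp .mu S).instMor c.mor).shift)
    (des : ∀ {S : Sig} {k : ℕ} {c : Comp}, HasKind [] [] (.fp .nu S) S.par →
      S.comps[k]? = some c → mK [] [] (.fp .nu S) S.par →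
      mT [] (.des S k) ((Ty.fp .nu S).instMor c.mor :: c.dom)
        (c.ty.tySubst1 (.fp .nu S)).shift)
    (recur : ∀ {Δ : Ctx} {S : Sig} {C : Ty} {gs : List Tm}, IsCtx Δ →
      HasKind [] [] (.fp .mu S) S.par → HasKind [] [] C S.par →
      gs.length = S.comps.length →
      (∀ (k : ℕ) (c : Comp) (g : Tm), S.comps[k]? = some c → gs[k]? = some g →
        Typed (c.ty.tySubst1 C :: (c.dom ++ Δ)) g [] (C.instMor c.mor).shift) →
      mC Δ → mK [] [] (.fp .mu S) S.par → mK [] [] C S.par →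
      (∀ (k : ℕ) (c : Comp) (g : Tm), S.comps[k]? = some c → gs[k]? = some g →
        mT (c.ty.tySubst1 C :: (c.dom ++ Δ)) g [] (C.instMor c.mor).shift) →
      mT Δ (.recur S C gs) ((Ty.fp .mu S).instMor (idMor S.par.length) :: S.par)
        (C.instMor (idMor S.par.length)).shift)
    (corecur : ∀ {Δ : Ctx} {S : Sig} {C : Ty} {gs : List Tm}, IsCtx Δ →
      HasKind [] [] (.fp .nu S) S.par → HasKind [] [] C S.par →
      gs.length = S.comps.length →
      (∀ (k : ℕ) (c : Comp) (g : Tm), S.comps[k]? = some c → gs[k]? = some g →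
        Typed (C.instMor c.mor :: (c.dom ++ Δ)) g [] (c.ty.tySubst1 C).shift) →
      mC Δ → mK [] [] (.fp .nu S) S.par → mK [] [] C S.par →
      (∀ (k : ℕ) (c : Comp) (g : Tm), S.comps[k]? = some c → gs[k]? = some g →
        mT (C.instMor c.mor :: (c.dom ++ Δ)) g [] (c.ty.tySubst1 C).shift) →
      mT Δ (.corecur S C gs) (C.instMor (idMor S.par.length) :: S.par)
        ((Ty.fp .nu S).instMor (idMor S.par.length)).shift) :
    (∀ {Γ}, IsCtx Γ → mC Γ) ∧ (∀ {Γ₁ σ Γ₂}, IsMor Γ₁ σ Γ₂ → mM Γ₁ σ Γ₂) ∧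
      (∀ {Ξ Γ A T}, HasKind Ξ Γ A T → mK Ξ Γ A T) ∧ (∀ {Γ t T A}, Typed Γ t T A → mT Γ t T A) :=
  ⟨@IsCtx.rec (fun Γ _ => mC Γ) (fun Ξ _ => mX Ξ) (fun Γ₁ σ Γ₂ _ => mM Γ₁ σ Γ₂)
      (fun Ξ Γ A T _ => mK Ξ Γ A T) (fun Γ t T A _ => mT Γ t T A)
      ctx_nil ctx_cons tyCtx_nil tyCtx_cons mor_nil mor_cons one tvar tyVarWeak tyWeak kinst pabs
      fp unit inst conv proj weak con des recur corecur,
    @IsMor.rec (fun Γ _ => mC Γ) (fun Ξ _ => mX Ξ) (fun Γ₁ σ Γ₂ _ => mM Γ₁ σ Γ₂)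
      (fun Ξ Γ A T _ => mK Ξ Γ A T) (fun Γ t T A _ => mT Γ t T A)
      ctx_nil ctx_cons tyCtx_nil tyCtx_cons mor_nil mor_cons one tvar tyVarWeak tyWeak kinst pabs
      fp unit inst conv proj weak con des recur corecur,
    @HasKind.rec (fun Γ _ => mC Γ) (fun Ξ _ => mX Ξ) (fun Γ₁ σ Γ₂ _ => mM Γ₁ σ Γ₂)
      (fun Ξ Γ A T _ => mK Ξ Γ A T) (fun Γ t T A _ => mT Γ t T A)
      ctx_nil ctx_cons tyCtx_nil tyCtx_cons mor_nil mor_cons one tvar tyVarWeak tyWeak kinst pabs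
      fp unit inst conv proj weak con des recur corecur,
    @Typed.rec (fun Γ _ => mC Γ) (fun Ξ _ => mX Ξ) (fun Γ₁ σ Γ₂ _ => mM Γ₁ σ Γ₂)
      (fun Ξ Γ A T _ => mK Ξ Γ A T) (fun Γ t T A _ => mT Γ t T A)
      ctx_nil ctx_cons tyCtx_nil tyCtx_cons mor_nil mor_cons one tvar tyVarWeak tyWeak kinst pabs
      fp unit inst conv proj weak con des recur corecur⟩

theorem HasKind.ind {mK : TyCtx → Ctx → Ty → Ctx → Prop}
    (one : mK [] [] .one [])
    (tvar : ∀ {Ξ : TyCtx} {T : Ctx}, IsTyCtx Ξ → IsCtx T → mK (T :: Ξ) [] (.tvar 0) T)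
    (tyVarWeak : ∀ {Ξ : TyCtx} {Γ T U : Ctx} {A : Ty}, HasKind Ξ Γ A T → IsCtx U → mK Ξ Γ A T →
      mK (U :: Ξ) Γ A.tyShift T)
    (tyWeak : ∀ {Ξ : TyCtx} {Γ T : Ctx} {A B : Ty}, HasKind Ξ Γ A T → HasKind [] Γ B [] →
      mK Ξ Γ A T → mK Ξ (B :: Γ) A.shift (Ctx.ren Nat.succ T))
    (inst : ∀ {Ξ : TyCtx} {Γ T : Ctx} {A B : Ty} {t : Tm}, HasKind Ξ Γ A (T ++ [B]) →
      Typed Γ t [] B → mK Ξ Γ A (T ++ [B]) → mK Ξ Γ (.inst A t) (Ctx.subst (ofMor [t]) T))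
    (pabs : ∀ {Ξ : TyCtx} {Γ T : Ctx} {A B : Ty}, HasKind Ξ (A :: Γ) B T → mK Ξ (A :: Γ) B T →
      mK Ξ Γ (.pabs B) (T ++ [A]))
    (fp : ∀ {Ξ : TyCtx} (ρ : Fix) {S : Sig}, IsTyCtx Ξ → IsCtx S.par →
      (∀ c ∈ S.comps, IsMor c.dom c.mor S.par) →
      (∀ c ∈ S.comps, HasKind (S.par :: Ξ) c.dom c.ty []) →
      (∀ c ∈ S.comps, mK (S.par :: Ξ) c.dom c.ty []) → mK Ξ [] (.fp ρ S) S.par)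
    {Ξ : TyCtx} {Γ : Ctx} {A : Ty} {T : Ctx} (h : HasKind Ξ Γ A T) : mK Ξ Γ A T :=
  (judgement_induction (mC := fun _ => True) (mX := fun _ => True) (mM := fun _ _ _ => True)
    (mK := mK) (mT := fun _ _ _ _ => True) trivial (fun _ _ _ _ => trivial) trivial
    (fun _ _ _ _ => trivial) (fun _ _ => trivial) (fun _ _ _ _ _ _ => trivial) one
    (fun h₁ h₂ _ _ => tvar h₁ h₂) (fun h₁ h₂ h₃ _ => tyVarWeak h₁ h₂ h₃)
    (fun h₁ h₂ h₃ _ => tyWeak h₁ h₂ h₃) (fun h₁ h₂ h₃ _ => inst h₁ h₂ h₃) pabs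
    (fun ρ _ h₁ h₂ h₃ h₄ _ _ _ h₈ => fp ρ h₁ h₂ h₃ h₄ h₈) trivial (fun _ _ _ _ => trivial)
    (fun _ _ _ _ _ => trivial) (fun _ _ => trivial) (fun _ _ _ _ => trivial)
    (fun _ _ _ => trivial) (fun _ _ _ => trivial) (fun _ _ _ _ _ _ _ _ _ => trivial)
    (fun _ _ _ _ _ _ _ _ _ => trivial)).2.2.1 h

theorem Typed.ind {mT : Ctx → Tm → Ctx → Ty → Prop}
    (unit : mT [] .unit [] .one)
    (inst : ∀ {Γ T : Ctx} {t s : Tm} {A B : Ty}, Typed Γ t (T ++ [A]) B → Typed Γ s [] A →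
      mT Γ t (T ++ [A]) B → mT Γ s [] A →
      mT Γ (.app t s) (Ctx.subst (ofMor [s]) T) (B.subst (upN T.length (ofMor [s]))))
    (conv : ∀ {Γ T : Ctx} {t : Tm} {A B : Ty}, Typed Γ t T A → TyConv A B →
      HasKind [] (T ++ Γ) B [] → mT Γ t T A → mT Γ t T B)
    (proj : ∀ {Γ : Ctx} {A : Ty}, HasKind [] Γ A [] → mT (A :: Γ) (.var 0) [] A.shift)
    (weak : ∀ {Γ T : Ctx} {t : Tm} {A B : Ty}, Typed Γ t T A → HasKind [] Γ B [] →
      mT Γ t T A →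
      mT (B :: Γ) t.shift (Ctx.ren Nat.succ T) (A.ren (upRenN T.length Nat.succ)))
    (con : ∀ {S : Sig} {k : ℕ} {c : Comp}, HasKind [] [] (.fp .mu S) S.par →
      S.comps[k]? = some c →
      mT [] (.con S k) (c.ty.tySubst1 (.fp .mu S) :: c.dom)
        ((Ty.fp .mu S).instMor c.mor).shift)
    (des : ∀ {S : Sig} {k : ℕ} {c : Comp}, HasKind [] [] (.fp .nu S) S.par →
      S.comps[k]? = some c →
      mT [] (.des S k) ((Ty.fp .nu S).instMor c.mor :: c.dom)
        (c.ty.tySubst1 (.fp .nu S)).shift)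
    (recur : ∀ {Δ : Ctx} {S : Sig} {C : Ty} {gs : List Tm}, IsCtx Δ →
      HasKind [] [] (.fp .mu S) S.par → HasKind [] [] C S.par →
      gs.length = S.comps.length →
      (∀ (k : ℕ) (c : Comp) (g : Tm), S.comps[k]? = some c → gs[k]? = some g →
        Typed (c.ty.tySubst1 C :: (c.dom ++ Δ)) g [] (C.instMor c.mor).shift) →
      mT Δ (.recur S C gs) ((Ty.fp .mu S).instMor (idMor S.par.length) :: S.par)
        (C.instMor (idMor S.par.length)).shift)
    (corecur : ∀ {Δ : Ctx} {S : Sig} {C : Ty} {gs : List Tm}, IsCtx Δ →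
      HasKind [] [] (.fp .nu S) S.par → HasKind [] [] C S.par →
      gs.length = S.comps.length →
      (∀ (k : ℕ) (c : Comp) (g : Tm), S.comps[k]? = some c → gs[k]? = some g →
        Typed (C.instMor c.mor :: (c.dom ++ Δ)) g [] (c.ty.tySubst1 C).shift) →
      mT Δ (.corecur S C gs) (C.instMor (idMor S.par.length) :: S.par)
        ((Ty.fp .nu S).instMor (idMor S.par.length)).shift)
    {Γ : Ctx} {t : Tm} {T : Ctx} {A : Ty} (h : Typed Γ t T A) : mT Γ t T A :=
  (judgement_induction (mC := fun _ => True) (mX := fun _ => True) (mM := fun _ _ _ => True)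
    (mK := fun _ _ _ _ => True) (mT := mT) trivial (fun _ _ _ _ => trivial) trivial
    (fun _ _ _ _ => trivial) (fun _ _ => trivial) (fun _ _ _ _ _ _ => trivial) trivial
    (fun _ _ _ _ => trivial) (fun _ _ _ _ => trivial) (fun _ _ _ _ => trivial)
    (fun _ _ _ _ => trivial) (fun _ _ => trivial) (fun _ _ _ _ _ _ _ _ _ _ => trivial) unit inst
    (fun h₁ h₂ h₃ h₄ _ => conv h₁ h₂ h₃ h₄) (fun h _ => proj h)
    (fun h₁ h₂ h₃ _ => weak h₁ h₂ h₃) (fun h₁ h₂ _ => con h₁ h₂) (fun h₁ h₂ _ => des h₁ h₂)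
    (fun h₁ h₂ h₃ h₄ h₅ _ _ _ _ => recur h₁ h₂ h₃ h₄ h₅)
    (fun h₁ h₂ h₃ h₄ h₅ _ _ _ _ => corecur h₁ h₂ h₃ h₄ h₅)).2.2.2 h

/-! ### Derivable judgements are well-scoped -/

/-- Well-scoped contexts. -/
def CtxWS : Ctx → Prop
  | [] => True
  | A :: Γ => CtxWS Γ ∧ TyWS [] Γ.length 0 A

theorem CtxWS.closed {T : Ctx} (h : CtxWS T) (θ : ℕ → Tm) : T.subst θ = T := by
  induction T with
  | nil => rfl
  | cons A T ih =>
    simp only [Ctx.subst]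
    rw [ih h.1, h.2.subst_congr (φ := Tm.var) fun i hi => upN_lt _ hi, Ty.subst_var]

theorem TyWS.subst_upN {Ξ : List ℕ} {p q n : ℕ} {A : Ty} (h : TyWS Ξ p n A) (hq : p ≤ q)
    (θ : ℕ → Tm) : A.subst (upN q θ) = A := by
  rw [h.subst_congr (φ := Tm.var) fun i hi => upN_lt _ (by omega), Ty.subst_var]

theorem TyWS.tySubst1 {p n m : ℕ} {A C : Ty} (h : TyWS [m] p n A) (hC : TyWS [] 0 m C) :
    TyWS [] p n (A.tySubst1 C) := by
  refine h.tySubst fun X k hX => ?_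
  cases X with
  | zero => simp only [List.getElem?_cons_zero, Option.some.injEq] at hX; subst hX; exact hC
  | succ X => simp at hX

theorem TyWS.sig {Ξ : List ℕ} {p n : ℕ} {ρ : Fix} {S : Sig} (h : TyWS Ξ p n (.fp ρ S)) :
    SigWS Ξ S := by
  cases h with | fp h => exact h

theorem TyWS.instMor_idMor {n : ℕ} {C : Ty} (h : TyWS [] 0 n C) :
    TyWS [] n 0 (C.instMor (idMor n)) := by
  refine TyWS.instMor (by simpa [idMor] using h.mono (Nat.zero_le n)) ?_
  simp only [idMor, List.mem_map, List.mem_range]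
  rintro _ ⟨i, hi, rfl⟩
  exact .var hi

/-- Brings derivable judgements into the range of the stability lemmas for steps, and shows that
whatever is derivable in the empty term context is closed. -/
theorem wellScoped :
    (∀ {Γ}, IsCtx Γ → CtxWS Γ) ∧
    (∀ {Γ₁ σ Γ₂}, IsMor Γ₁ σ Γ₂ → σ.length = Γ₂.length ∧ ∀ t ∈ σ, TmWS Γ₁.length t) ∧
    (∀ {Ξ Γ A T}, HasKind Ξ Γ A T → TyWS (Ξ.map List.length) Γ.length T.length A) ∧
    (∀ {Γ t T A}, Typed Γ t T A → TmWS Γ.length t ∧ TyWS [] (T.length + Γ.length) 0 A) := by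
  refine judgement_induction (mX := fun _ => True) trivial ?_ trivial (fun _ _ _ _ => trivial)
    ?_ ?_ ?_ ?_ ?_ ?_ ?_ ?_ ?_ ?_ ?_ ?_ ?_ ?_ ?_ ?_ ?_ ?_
  · exact fun _ _ h₁ h₂ => ⟨h₁, h₂⟩
  · simp
  · intro Γ₁ Γ₂ σ t A _ _ _ h₁ _ h₂
    refine ⟨by simp [h₁.1], fun s hs => ?_⟩
    rcases List.mem_cons.1 hs with rfl | hs
    · exact h₂.1
    · exact h₁.2 s hs
  · exact .one
  · exact fun _ _ _ _ => .tvar (by simp)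
  · exact fun _ _ h _ => h.tyShift _
  · intro Ξ Γ T A B _ _ h _
    simpa using h.shift
  · intro Ξ Γ T A B t _ _ h₁ h₂
    simp only [Ctx.subst_length]
    exact .inst (by simpa using h₁) h₂.1
  · intro Ξ Γ T A B _ h
    simp only [List.length_append, List.length_singleton]
    exact .pabs (by simpa using h)
  · intro Ξ ρ S _ _ _ _ _ _ h₁ h₂
    exact .fp (.mk (fun c hc => (h₁ c hc).1) (fun c hc => (h₁ c hc).2) h₂)
  · exact ⟨.unit, .one⟩
  · intro Γ T t s A B _ _ h₁ h₂
    refine ⟨.app h₁.1 h₂.1, h₁.2.subst fun i hi => ?_⟩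
    rw [Ctx.subst_length]
    refine TmWS.upN (p := Γ.length + 1) _ (fun j hj => ?_) i (by simp at hi; omega)
    cases j with
    | zero => exact h₂.1
    | succ j => exact .var (by simp; omega)
  · exact fun _ _ _ h₁ h₂ => ⟨h₁.1, by simpa using h₂⟩
  · exact fun _ h => ⟨.var (by simp), by simpa using h.shift⟩
  · intro Γ T t A B _ _ h _
    refine ⟨h.1.ren fun i hi => by simp; omega, ?_⟩
    rw [Ty.ren_eq_subst]
    refine h.2.subst fun i hi => .var ?_
    rw [upRenN_apply]
    simp only [Ctx.ren_length, List.length_cons]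
    split_ifs <;> omega
  · intro S k c _ hc h
    have hS := h.sig
    have hmem := List.mem_of_getElem? hc
    refine ⟨.con hS, ?_⟩
    simp only [List.length_cons, List.length_nil, add_zero]
    refine TyWS.shift (TyWS.instMor ?_ (hS.mor hmem))
    rw [hS.mor_length hmem, zero_add]
    exact h.mono (Nat.zero_le _)
  · intro S k c _ hc h
    have hS := h.sig
    have hmem := List.mem_of_getElem? hc
    exact ⟨.des hS, TyWS.shift ((hS.ty hmem).tySubst1 h)⟩
  · intro Δ S C gs _ _ _ hl _ _ h hC hg
    refine ⟨.recur h.sig hl fun k c g hc hk => ?_, ?_⟩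
    · have := (hg k c g hc hk).1
      simp only [List.length_cons, List.length_append] at this
      exact this.mono (by omega)
    · exact (TyWS.shift (TyWS.instMor_idMor hC)).mono (by simp)
  · intro Δ S C gs _ _ _ hl _ _ h hC hg
    refine ⟨.corecur h.sig hl fun k c g hc hk => ?_, ?_⟩
    · have := (hg k c g hc hk).1
      simp only [List.length_cons, List.length_append] at this
      exact this.mono (by omega)
    · exact (TyWS.shift (TyWS.instMor_idMor h)).mono (by simp)

theorem IsCtx.ws {Γ : Ctx} (h : IsCtx Γ) : CtxWS Γ := wellScoped.1 h

theorem IsMor.length_eq {Γ₁ Γ₂ : Ctx} {σ : Mor} (h : IsMor Γ₁ σ Γ₂) : σ.length = Γ₂.length :=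
  (wellScoped.2.1 h).1

theorem HasKind.ws {Ξ : TyCtx} {Γ T : Ctx} {A : Ty} (h : HasKind Ξ Γ A T) :
    TyWS (Ξ.map List.length) Γ.length T.length A := wellScoped.2.2.1 h

theorem Typed.ws {Γ T : Ctx} {t : Tm} {A : Ty} (h : Typed Γ t T A) : TmWS Γ.length t :=
  (wellScoped.2.2.2 h).1

theorem Typed.ty_ws {Γ T : Ctx} {t : Tm} {A : Ty} (h : Typed Γ t T A) :
    TyWS [] (T.length + Γ.length) 0 A := (wellScoped.2.2.2 h).2

theorem IsCtx.closed {T : Ctx} (h : IsCtx T) (θ : ℕ → Tm) : T.subst θ = T := h.ws.closed θ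

theorem HasKind.closed {Ξ : TyCtx} {T : Ctx} {A : Ty} (h : HasKind Ξ [] A T) : A.Closed :=
  h.ws.closed

/-! ### Substitution -/

/-- `SubstOk Δ η Γ`: the first values of `η` form a context morphism from `Δ` to `Γ`. -/
def SubstOk (Δ : Ctx) : (ℕ → Tm) → Ctx → Prop
  | _, [] => IsCtx Δ
  | η, A :: Γ => SubstOk Δ (fun i => η (i + 1)) Γ ∧
      Typed Δ (η 0) [] (A.subst fun i => η (i + 1))

theorem SubstOk.isCtx {Δ Γ : Ctx} {η : ℕ → Tm} (h : SubstOk Δ η Γ) : IsCtx Δ := by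
  induction Γ generalizing η with
  | nil => exact h
  | cons A Γ ih => exact ih h.1

theorem SubstOk.tail {Δ T Γ : Ctx} {η : ℕ → Tm} (h : SubstOk Δ η (T ++ Γ)) :
    SubstOk Δ (fun i => η (i + T.length)) Γ := by
  induction T generalizing η with
  | nil => exact h
  | cons A T ih =>
    have := ih h.1
    simpa only [List.length_cons, add_assoc, add_comm 1] using this

theorem SubstOk.weak {Δ Γ : Ctx} {η : ℕ → Tm} {B : Ty} (h : SubstOk Δ η Γ)
    (hB : HasKind [] Δ B []) : SubstOk (B :: Δ) (fun i => (η i).shift) Γ := by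
  induction Γ generalizing η with
  | nil => exact .cons h hB
  | cons A Γ ih =>
    refine ⟨ih h.1, ?_⟩
    have := Typed.weak h.2 hB
    rw [List.length_nil, upRenN, Ty.ren_subst] at this
    exact this

/-- Every type in the context is preserved by substitutions. -/
def CtxSub : Ctx → Prop
  | [] => True
  | A :: Γ => CtxSub Γ ∧ ∀ Δ θ, SubstOk Δ θ Γ → HasKind [] Δ (A.subst θ) []

/-- Lifting over a variable of type `A` requires `A[θ]` to be a type, which is part of what the
substitution theorem proves. `CtxSub` makes this available during that induction. -/
theorem CtxSub.lift {T Γ Δ : Ctx} {θ : ℕ → Tm} (h : CtxSub (T ++ Γ)) (hθ : SubstOk Δ θ Γ) :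
    SubstOk (T.subst θ ++ Δ) (upN T.length θ) (T ++ Γ) := by
  induction T with
  | nil => exact hθ
  | cons A T ih =>
    have hA := h.2 _ _ (ih h.1)
    refine ⟨(ih h.1).weak hA, ?_⟩
    have := Typed.proj hA
    rw [Ty.shift, Ty.ren_subst] at this
    exact this

/-- Axioms such as those for `⊤`, constructor variables and fixed points conclude in the empty
context; repeated weakening reaches `Δ` and does not alter closed data. -/
theorem HasKind.weak_closed {Ξ : TyCtx} {T Δ : Ctx} {A : Ty} (h : HasKind Ξ [] A T)
    (hT : CtxWS T) (hΔ : IsCtx Δ) : HasKind Ξ Δ A T := by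
  induction Δ with
  | nil => exact h
  | cons B Δ ih =>
    cases hΔ with | cons h₁ h₂ =>
    have := HasKind.tyWeak (ih h₁) h₂
    rwa [Ty.shift, h.closed.ren, Ctx.ren_eq_subst, hT.closed] at this

theorem Typed.weak_closed {T Δ : Ctx} {t : Tm} {A : Ty} (h : Typed [] t T A)
    (hT : CtxWS T) (hΔ : IsCtx Δ) : Typed Δ t T A := by
  induction Δ with
  | nil => exact h
  | cons B Δ ih =>
    cases hΔ with | cons h₁ h₂ =>
    have := Typed.weak (ih h₁) h₂
    rwa [Tm.shift, Tm.ren_eq_subst, h.ws.subst_congr (φ := Tm.var) (by simp), Tm.subst_var,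
      Ctx.ren_eq_subst, hT.closed, Ty.ren_eq_subst,
      h.ty_ws.subst_congr (φ := Tm.var) (fun i hi => by rw [upRenN_lt _ (by simpa using hi)]),
      Ty.subst_var] at this

/-- With both contexts empty no weakening rule can come last, so the derivation ends with the
formation rule. -/
theorem HasKind.fp_inv {ρ : Fix} {S : Sig} {T : Ctx} (h : HasKind [] [] (.fp ρ S) T) :
    T = S.par ∧ IsCtx S.par ∧ (∀ c ∈ S.comps, IsMor c.dom c.mor S.par) ∧
      ∀ c ∈ S.comps, HasKind [S.par] c.dom c.ty [] := by
  refine HasKind.ind (mK := fun Ξ Γ A T => Ξ = [] → Γ = [] → A = .fp ρ S →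
    T = S.par ∧ IsCtx S.par ∧ (∀ c ∈ S.comps, IsMor c.dom c.mor S.par) ∧
      ∀ c ∈ S.comps, HasKind [S.par] c.dom c.ty []) ?_ ?_ ?_ ?_ ?_ ?_ ?_ h rfl rfl rfl
  · simp
  · simp
  · simp
  · simp
  · simp
  · simp
  · rintro Ξ ρ S _ h₁ h₂ h₃ _ rfl _ h
    cases h
    exact ⟨rfl, h₁, h₂, h₃⟩

theorem IsMor.isCtx_dom {Γ₁ Γ₂ : Ctx} {σ : Mor} (h : IsMor Γ₁ σ Γ₂) : IsCtx Γ₁ := by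
  induction σ generalizing Γ₂ with
  | nil => cases h with | nil h => exact h
  | cons t σ ih => cases h with | cons h _ _ => exact ih h

theorem fp_ctxWS {ρ : Fix} {S : Sig} (h : HasKind [] [] (.fp ρ S) S.par) {c : Comp}
    (hc : c ∈ S.comps) : CtxWS c.dom := (h.fp_inv.2.2.1 c hc).isCtx_dom.ws

theorem subst_app_ty (B : Ty) (n : ℕ) (s : Tm) (θ : ℕ → Tm) :
    (B.subst (upN n (ofMor [s]))).subst (upN n θ) =
      (B.subst (upN (n + 1) θ)).subst (upN n (ofMor [s.subst θ])) := by
  rw [Ty.subst_subst, Ty.subst_subst, ← upN_upN n 1, upN_subst, upN_subst]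
  have := upN_ofMor [s] θ
  simp only [List.length_singleton, List.map_cons, List.map_nil] at this
  rw [this]

/-- The conclusion `CtxSub Γ` strengthens the induction enough to pass under binders. A weakening
rule turns into forgetting the first value of `θ`, and weakening at any depth becomes a special
case. -/
theorem substitution :
    (∀ {Γ}, IsCtx Γ → CtxSub Γ) ∧ (∀ {Γ₁ σ Γ₂}, IsMor Γ₁ σ Γ₂ → True) ∧
    (∀ {Ξ Γ A T}, HasKind Ξ Γ A T → CtxSub Γ ∧ ∀ Δ θ, SubstOk Δ θ Γ →
      HasKind Ξ Δ (A.subst θ) (T.subst θ)) ∧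
    (∀ {Γ t T A}, Typed Γ t T A → CtxSub Γ ∧ ∀ Δ θ, SubstOk Δ θ Γ →
      Typed Δ (t.subst θ) (T.subst θ) (A.subst (upN T.length θ))) := by
  refine judgement_induction (mX := fun _ => True) trivial ?_ trivial (fun _ _ _ _ => trivial)
    (fun _ _ => trivial) (fun _ _ _ _ _ _ => trivial) ?_ ?_ ?_ ?_ ?_ ?_ ?_ ?_ ?_ ?_ ?_ ?_ ?_ ?_
    ?_ ?_
  · exact fun _ _ h₁ h₂ => ⟨h₁, h₂.2⟩
  · exact ⟨trivial, fun Δ θ hθ => HasKind.one.weak_closed trivial hθ⟩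
  · intro Ξ T hΞ hT _ _
    refine ⟨trivial, fun Δ θ hθ => ?_⟩
    rw [hT.closed, Ty.subst]
    exact (HasKind.tvar hΞ hT).weak_closed hT.ws hθ
  · intro Ξ Γ T U A _ hU h _
    refine ⟨h.1, fun Δ θ hθ => ?_⟩
    rw [Ty.tyShift, Ty.tyRen_subst]
    exact .tyVarWeak (h.2 Δ θ hθ) hU
  · intro Ξ Γ T A B _ _ h hB
    refine ⟨⟨h.1, hB.2⟩, fun Δ θ hθ => ?_⟩
    rw [Ty.subst_shift, Ctx.ren_eq_subst, Ctx.subst_subst]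
    exact h.2 Δ _ hθ.1
  · intro Ξ Γ T A B t _ _ h₁ h₂
    refine ⟨h₁.1, fun Δ θ hθ => ?_⟩
    have h₃ := h₁.2 Δ θ hθ
    rw [Ctx.subst_append] at h₃
    rw [Ctx.subst_ofMor]
    exact .inst h₃ (h₂.2 Δ θ hθ)
  · intro Ξ Γ T A B _ h
    refine ⟨h.1.1, fun Δ θ hθ => ?_⟩
    rw [Ctx.subst_append]
    exact .pabs (h.2 _ _ (CtxSub.lift (T := [A]) h.1 hθ))
  · intro Ξ ρ S hΞ hp hm hk _ _ _ _
    refine ⟨trivial, fun Δ θ hθ => ?_⟩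
    rw [hp.closed, Ty.subst]
    exact (HasKind.fp ρ hΞ hp hm hk).weak_closed hp.ws hθ
  · exact ⟨trivial, fun Δ θ hθ => Typed.unit.weak_closed trivial hθ⟩
  · intro Γ T t s A B _ _ h₁ h₂
    refine ⟨h₁.1, fun Δ θ hθ => ?_⟩
    have h₃ := h₁.2 Δ θ hθ
    rw [Ctx.subst_append] at h₃
    rw [Ctx.subst_ofMor, Ctx.subst_length, subst_app_ty]
    have := Typed.inst h₃ (h₂.2 Δ θ hθ)
    rw [Ctx.subst_length] at this
    simp only [List.length_append, List.length_singleton] at this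
    exact this
  · intro Γ T t A B ht hc hB h₁ h₂
    refine ⟨h₁.1, fun Δ θ hθ => .conv (h₁.2 Δ θ hθ) (hc.subst ht.ty_ws hB.ws _) ?_⟩
    -- `B` lives over `T ++ Γ`, so its own hypothesis supplies the `CtxSub` needed to lift `θ` over
    -- `T`.
    exact h₂.2 _ _ (h₂.1.lift hθ)
  · intro Γ A hA h
    refine ⟨⟨h.1, h.2⟩, fun Δ θ hθ => ?_⟩
    rw [List.length_nil, upN, Ty.subst_shift]
    exact hθ.2
  · intro Γ T t A B _ _ h hB
    refine ⟨⟨h.1, hB.2⟩, fun Δ θ hθ => ?_⟩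
    rw [Tm.subst_shift, Ctx.ren_eq_subst, Ctx.subst_subst, Ctx.subst_length, Ty.subst_ren,
      upN_upRenN]
    exact h.2 Δ _ hθ.1
  · intro S k c h hc _
    refine ⟨trivial, fun Δ θ hθ => ?_⟩
    have ht := Typed.con h hc
    have hmem := List.mem_of_getElem? hc
    have hT : CtxWS (c.ty.tySubst1 (.fp .mu S) :: c.dom) :=
      ⟨fp_ctxWS h hmem, (h.ws.sig.ty hmem).tySubst1 h.ws⟩
    rw [hT.closed, ht.ty_ws.subst_upN (by simp)]
    exact ht.weak_closed hT hθ
  · intro S k c h hc _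
    refine ⟨trivial, fun Δ θ hθ => ?_⟩
    have ht := Typed.des h hc
    have hmem := List.mem_of_getElem? hc
    have hT : CtxWS ((Ty.fp .nu S).instMor c.mor :: c.dom) := by
      refine ⟨fp_ctxWS h hmem, TyWS.instMor ?_ (h.ws.sig.mor hmem)⟩
      rw [h.ws.sig.mor_length hmem, zero_add]
      exact h.ws.mono (Nat.zero_le _)
    rw [hT.closed, ht.ty_ws.subst_upN (by simp)]
    exact ht.weak_closed hT hθ
  · intro Δ S C gs hΔ h hC hl hg h₁ _ _ ih
    refine ⟨h₁, fun Δ' θ hθ => ?_⟩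
    have hT : CtxWS ((Ty.fp .mu S).instMor (idMor S.par.length) :: S.par) :=
      ⟨h.fp_inv.2.1.ws, h.ws.instMor_idMor⟩
    rw [hT.closed, (TyWS.shift hC.ws.instMor_idMor).subst_upN (by simp)]
    refine .recur hθ.isCtx h hC (by rw [substBodies_length, hl]) fun k c g' hc hg' => ?_
    obtain ⟨g, hk, rfl⟩ := substBodies_some_inv hc hg'
    have hmem := List.mem_of_getElem? hc
    -- The variables bound in a body have types that do not mention `Δ`, and neither does the result
    -- type; the substitution changes only the body.
    have hD : CtxWS (c.ty.tySubst1 C :: c.dom) :=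
      ⟨fp_ctxWS h hmem, (h.ws.sig.ty hmem).tySubst1 hC.ws⟩
    have := (ih k c g hc hk).2 _ _ ((ih k c g hc hk).1.lift (T := c.ty.tySubst1 C :: c.dom) hθ)
    rw [hD.closed] at this
    have hA : TyWS [] (c.dom.length + 1) 0 (C.instMor c.mor).shift := by
      refine TyWS.shift (TyWS.instMor ?_ (h.ws.sig.mor hmem))
      rw [h.ws.sig.mor_length hmem, zero_add]
      exact hC.ws.mono (Nat.zero_le _)
    rwa [List.length_nil, upN, hA.subst_upN (by simp)] at this
  · intro Δ S C gs hΔ h hC hl hg h₁ _ _ ih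
    refine ⟨h₁, fun Δ' θ hθ => ?_⟩
    have hT : CtxWS (C.instMor (idMor S.par.length) :: S.par) :=
      ⟨h.fp_inv.2.1.ws, hC.ws.instMor_idMor⟩
    rw [hT.closed, (TyWS.shift h.ws.instMor_idMor).subst_upN (by simp)]
    refine .corecur hθ.isCtx h hC (by rw [substBodies_length, hl]) fun k c g' hc hg' => ?_
    obtain ⟨g, hk, rfl⟩ := substBodies_some_inv hc hg'
    have hmem := List.mem_of_getElem? hc
    have hD : CtxWS (C.instMor c.mor :: c.dom) := by
      refine ⟨fp_ctxWS h hmem, TyWS.instMor ?_ (h.ws.sig.mor hmem)⟩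
      rw [h.ws.sig.mor_length hmem, zero_add]
      exact hC.ws.mono (Nat.zero_le _)
    have := (ih k c g hc hk).2 _ _ ((ih k c g hc hk).1.lift (T := C.instMor c.mor :: c.dom) hθ)
    rw [hD.closed] at this
    have hA : TyWS [] (c.dom.length + 1) 0 (c.ty.tySubst1 C).shift :=
      TyWS.shift ((h.ws.sig.ty hmem).tySubst1 hC.ws)
    rwa [List.length_nil, upN, hA.subst_upN (by simp)] at this

theorem HasKind.subst {Ξ : TyCtx} {Γ Δ T : Ctx} {A : Ty} {θ : ℕ → Tm} (h : HasKind Ξ Γ A T)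
    (hθ : SubstOk Δ θ Γ) : HasKind Ξ Δ (A.subst θ) (T.subst θ) :=
  (substitution.2.2.1 h).2 Δ θ hθ

theorem Typed.subst {Γ Δ T : Ctx} {t : Tm} {A : Ty} {θ : ℕ → Tm} (h : Typed Γ t T A)
    (hθ : SubstOk Δ θ Γ) : Typed Δ (t.subst θ) (T.subst θ) (A.subst (upN T.length θ)) :=
  (substitution.2.2.2 h).2 Δ θ hθ

theorem SubstOk.lift {T Γ Δ : Ctx} {θ : ℕ → Tm} (hθ : SubstOk Δ θ Γ) (h : IsCtx (T ++ Γ)) :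
    SubstOk (T.subst θ ++ Δ) (upN T.length θ) (T ++ Γ) :=
  (substitution.1 h).lift hθ

theorem IsCtx.subst {T Γ Δ : Ctx} {θ : ℕ → Tm} (h : IsCtx (T ++ Γ)) (hθ : SubstOk Δ θ Γ) :
    IsCtx (T.subst θ ++ Δ) :=
  (hθ.lift h).isCtx

theorem SubstOk.id {Γ : Ctx} (h : IsCtx Γ) : SubstOk Γ Tm.var Γ := by
  have := (CtxSub.lift (T := Γ) (Γ := []) (Δ := []) (θ := Tm.var)
    (by simpa using substitution.1 h) IsCtx.nil)
  simpa [upN_var_id, Ctx.subst_var] using this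

theorem SubstOk.drop {T Γ : Ctx} (h : IsCtx (T ++ Γ)) :
    SubstOk (T ++ Γ) (fun i => .var (i + T.length)) Γ := (SubstOk.id h).tail

theorem SubstOk.append_closed {T Δ : Ctx} (hT : IsCtx T) (hΔ : IsCtx Δ) :
    SubstOk (T ++ Δ) Tm.var T := by
  have := SubstOk.lift (T := T) (Γ := []) (Δ := Δ) (θ := Tm.var) hΔ (by simpa using hT)
  simpa [upN_var_id, Ctx.subst_var] using this

theorem SubstOk.comp {Γ Γ' Δ : Ctx} {ρ θ : ℕ → Tm} (h : SubstOk Γ' ρ Γ) (hθ : SubstOk Δ θ Γ') :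
    SubstOk Δ (fun i => (ρ i).subst θ) Γ := by
  induction Γ generalizing ρ with
  | nil => exact hθ.isCtx
  | cons A Γ ih =>
    refine ⟨ih h.1, ?_⟩
    have := h.2.subst hθ
    rwa [List.length_nil, upN, Ty.subst_subst] at this

theorem HasKind.isCtx {Ξ : TyCtx} {Γ T : Ctx} {A : Ty} (h : HasKind Ξ Γ A T) : IsCtx Γ := by
  refine h.ind (mK := fun _ Γ _ _ => IsCtx Γ) .nil (fun _ _ => .nil) (fun _ _ h => h)
    (fun _ hB h => .cons h hB) (fun _ _ h => h) (fun _ h => ?_) (fun _ _ _ _ _ _ _ => .nil)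
  cases h with | cons h _ => exact h

theorem HasKind.append_closed {Ξ : TyCtx} {Γ Δ T : Ctx} {A : Ty} (h : HasKind Ξ Γ A T)
    (hΔ : IsCtx Δ) : HasKind Ξ (Γ ++ Δ) A T := by
  have := h.subst (SubstOk.append_closed h.isCtx hΔ)
  rwa [Ty.subst_var, Ctx.subst_var] at this

theorem IsCtx.tail {T Γ : Ctx} (h : IsCtx (T ++ Γ)) : IsCtx Γ := by
  induction T with
  | nil => exact h
  | cons A T ih => cases h with | cons h _ => exact ih h

theorem Typed.isCtx {Γ T : Ctx} {t : Tm} {A : Ty} (h : Typed Γ t T A) : IsCtx Γ := by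
  refine h.ind (mT := fun Γ _ _ _ => IsCtx Γ) .nil (fun _ _ h _ => h) (fun _ _ _ h => h)
    (fun h => .cons h.isCtx h) (fun _ hB h => .cons h hB) (fun _ _ => .nil) (fun _ _ => .nil)
    (fun h _ _ _ _ => h) (fun h _ _ _ _ => h)

theorem SubstOk.single {Γ : Ctx} {t : Tm} {B : Ty} (h : Typed Γ t [] B) :
    SubstOk Γ (ofMor [t]) (B :: Γ) := by
  simp only [SubstOk, ofMor_cons_succ, ofMor_nil, ofMor_cons_zero]
  exact ⟨.id h.isCtx, by rwa [show (fun i => Tm.var i) = Tm.var from rfl, Ty.subst_var]⟩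

theorem HasKind.isCtx_params {Ξ : TyCtx} {Γ T : Ctx} {A : Ty} (h : HasKind Ξ Γ A T) :
    IsCtx (T ++ Γ) := by
  refine h.ind (mK := fun _ Γ _ T => IsCtx (T ++ Γ)) .nil (fun _ h => by simpa using h)
    (fun _ _ h => h) ?_ ?_ ?_ (fun _ _ _ h _ _ _ => by simpa using h)
  · intro Ξ Γ T A B _ hB h
    rw [Ctx.ren_eq_subst]
    exact h.subst (SubstOk.drop (T := [B]) (.cons h.tail hB))
  · intro Ξ Γ T A B t _ ht h
    rw [List.append_assoc] at h
    exact h.subst (SubstOk.single ht)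
  · intro Ξ Γ T A B _ h
    rwa [List.append_assoc]

/-! ### Substitution of type constructors -/

theorem IsTyCtx.one {Ξ : TyCtx} (h : IsTyCtx Ξ) : HasKind Ξ [] .one [] := by
  induction Ξ with
  | nil => exact .one
  | cons P Ξ ih =>
    cases h with | cons h₁ h₂ =>
    have := HasKind.tyVarWeak (ih h₁) h₂
    simpa [Ty.tyShift, Ty.tyRen] using this

/-- Closedness is required at every index, even outside `Ξ`, because commutation with term weakening
is used as an equation of raw operations. -/
theorem HasKind.tySubst {Ξ Ξ' : TyCtx} {Γ T : Ctx} {A : Ty} {a : ℕ → Ty} (h : HasKind Ξ Γ A T)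
    (hΞ : IsTyCtx Ξ') (hc : ∀ X, (a X).Closed)
    (ha : ∀ X P, Ξ[X]? = some P → HasKind Ξ' [] (a X) P) : HasKind Ξ' Γ (A.tySubst a) T := by
  revert Ξ' a
  refine h.ind (mK := fun Ξ Γ A T => ∀ {Ξ' : TyCtx} {a : ℕ → Ty}, IsTyCtx Ξ' →
    (∀ X, (a X).Closed) → (∀ X P, Ξ[X]? = some P → HasKind Ξ' [] (a X) P) →
    HasKind Ξ' Γ (A.tySubst a) T) ?_ ?_ ?_ ?_ ?_ ?_ ?_
  · intro Ξ' a hΞ _ _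
    rw [Ty.tySubst]
    exact hΞ.one
  · intro Ξ T _ _ Ξ' a _ _ ha
    exact ha 0 T (by simp)
  · intro Ξ Γ T U A _ _ ih Ξ' a hΞ hc ha
    rw [Ty.tyShift, Ty.tySubst_tyRen]
    exact ih hΞ (fun X => hc _) fun X P hX => ha (X + 1) P (by simpa using hX)
  · intro Ξ Γ T A B _ hB ih Ξ' a hΞ hc ha
    rw [Ty.shift, Ty.ren_eq_subst, Ty.tySubst_subst hc, ← Ty.ren_eq_subst]
    exact .tyWeak (ih hΞ hc ha) hB
  · intro Ξ Γ T A B t _ ht ih Ξ' a hΞ hc ha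
    exact .inst (ih hΞ hc ha) ht
  · intro Ξ Γ T A B _ ih Ξ' a hΞ hc ha
    exact .pabs (ih hΞ hc ha)
  · intro Ξ ρ S _ hp hm _ ih Ξ' a hΞ hc ha
    have := HasKind.fp (Ξ := Ξ') ρ (S := S.tySubst (tyUp a)) hΞ (by simpa using hp)
      (by
        simp only [Sig.tySubst_comps, List.mem_map, Sig.tySubst_par]
        rintro _ ⟨c, hc, rfl⟩
        simpa using hm c hc)
      (by
        simp only [Sig.tySubst_comps, List.mem_map, Sig.tySubst_par]
        rintro _ ⟨c, hmem, rfl⟩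
        simp only [Comp.tySubst_dom, Comp.tySubst_ty]
        refine ih c hmem (.cons hΞ hp) (closed_tyUp hc) fun X P hX => ?_
        cases X with
        | zero =>
          simp only [List.getElem?_cons_zero, Option.some.injEq] at hX
          subst hX
          exact .tvar hΞ hp
        | succ X => exact .tyVarWeak (ha X P (by simpa using hX)) hp)
    simpa [Ty.tySubst] using this

theorem HasKind.tySubst1 {P Γ T : Ctx} {A C : Ty} (h : HasKind [P] Γ A T)
    (hC : HasKind [] [] C P) : HasKind [] Γ (A.tySubst1 C) T := by
  refine h.tySubst .nil (closed_scons hC.closed Ty.closed_tvar) fun X Q hX => ?_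
  cases X with
  | zero => simp only [List.getElem?_cons_zero, Option.some.injEq] at hX; subst hX; exact hC
  | succ X => simp at hX

/-! ### Spines -/

/-- The head of `U` is the parameter filled last, so the induction peels off the outermost argument.
`Q` collects the parameters still open, and the substitutions made by the instantiation rule merge
into `η`. -/
theorem HasKind.spine {Ξ : TyCtx} {Γ Δ Q U : Ctx} {H : Ty} {η : ℕ → Tm}
    (h : HasKind Ξ Δ H (Ctx.subst (fun i => η (i + U.length)) (Q ++ U)))
    (hη : SubstOk Δ η (U ++ Γ)) :
    HasKind Ξ Δ (H.instMor (argsOf U.length η)) (Q.subst η) := by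
  induction U generalizing η Q with
  | nil => simpa [Ty.instMor] using h
  | cons B U ih =>
    rw [List.length_cons, argsOf_succ, Ty.instMor_cons]
    have h' := ih (Q := Q ++ [B]) (η := fun i => η (i + 1)) (by
      simpa only [List.append_assoc, List.singleton_append, List.length_cons, add_assoc,
        add_comm 1] using h) hη.1
    rw [Ctx.subst_append] at h'
    have := HasKind.inst h' hη.2
    rw [Ctx.subst_subst] at this
    convert this using 2
    funext i
    cases i with
    | zero => rfl
    | succ i => simp [upN, up, Tm.subst_shift, ofMor_nil, Tm.subst_var]

theorem Typed.spine {Γ Δ Q U : Ctx} {t : Tm} {D : Ty} {η : ℕ → Tm}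
    (h : Typed Δ t (Ctx.subst (fun i => η (i + U.length)) (Q ++ U))
      (D.subst (upN (Q.length + U.length) fun i => η (i + U.length))))
    (hη : SubstOk Δ η (U ++ Γ)) :
    Typed Δ (t.appMor (argsOf U.length η)) (Q.subst η) (D.subst (upN Q.length η)) := by
  induction U generalizing η Q with
  | nil => simpa [Tm.appMor] using h
  | cons B U ih =>
    rw [List.length_cons, argsOf_succ, Tm.appMor_cons]
    have h' := ih (Q := Q ++ [B]) (η := fun i => η (i + 1)) (by
      simpa only [List.append_assoc, List.singleton_append, List.length_cons, add_assoc,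
        add_comm 1, List.length_append, List.length_nil, zero_add] using h) hη.1
    rw [Ctx.subst_append] at h'
    have := Typed.inst h' hη.2
    have key : (fun i => (upN 1 (fun i => η (i + 1)) i).subst (ofMor [η 0])) = η := by
      funext i
      cases i with
      | zero => rfl
      | succ i => simp [upN, up, Tm.subst_shift, ofMor_nil, Tm.subst_var]
    rw [Ctx.subst_subst, List.length_singleton, Ctx.subst_length, Ty.subst_subst,
      List.length_append, List.length_singleton, ← upN_upN Q.length 1, upN_subst, key] at this
    exact this

theorem HasKind.instArgs {Ξ : TyCtx} {Γ Δ T : Ctx} {A : Ty} {η : ℕ → Tm} (h : HasKind Ξ Γ A T)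
    (hη : SubstOk Δ η (T ++ Γ)) :
    HasKind Ξ Δ ((A.subst fun i => η (i + T.length)).instMor (argsOf T.length η)) [] :=
  HasKind.spine (Q := []) (h.subst hη.tail) hη

theorem Typed.appArgs {Γ Δ T : Ctx} {t : Tm} {A : Ty} {η : ℕ → Tm} (h : Typed Γ t T A)
    (hη : SubstOk Δ η (T ++ Γ)) :
    Typed Δ ((t.subst fun i => η (i + T.length)).appMor (argsOf T.length η)) [] (A.subst η) :=
  Typed.spine (Q := []) (by simpa using h.subst hη.tail) hη

theorem IsMor.substOk {Γ₁ Γ₂ : Ctx} {σ : Mor} (h : IsMor Γ₁ σ Γ₂) : SubstOk Γ₁ (ofMor σ) Γ₂ := by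
  induction σ generalizing Γ₂ with
  | nil => cases h with | nil h => exact h
  | cons t σ ih =>
    cases h with | cons h₁ h₂ h₃ =>
    simp only [SubstOk, ofMor_cons_succ, ofMor_cons_zero]
    exact ⟨ih h₁, h₃⟩

/-- A closed type constructor instantiated by a substitution. -/
theorem HasKind.instClosed {P Δ : Ctx} {C : Ty} {η : ℕ → Tm} (h : HasKind [] [] C P)
    (hη : SubstOk Δ η P) : HasKind [] Δ (C.instMor (argsOf P.length η)) [] := by
  have := h.instArgs (η := η) (by simpa using hη)
  rwa [h.closed] at this

theorem HasKind.instMor {P Δ : Ctx} {C : Ty} {σ : Mor} (h : HasKind [] [] C P)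
    (hσ : IsMor Δ σ P) : HasKind [] Δ (C.instMor σ) [] := by
  have := h.instClosed hσ.substOk
  rwa [← hσ.length_eq, argsOf_ofMor] at this

theorem HasKind.instMor_id {P : Ctx} {C : Ty} (h : HasKind [] [] C P) (hP : IsCtx P) :
    HasKind [] P (C.instMor (idMor P.length)) [] :=
  h.instClosed (SubstOk.id hP)

theorem HasKind.shift {Ξ : TyCtx} {Γ : Ctx} {A B : Ty} (h : HasKind Ξ Γ A [])
    (hB : HasKind [] Γ B []) : HasKind Ξ (B :: Γ) A.shift [] := HasKind.tyWeak h hB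

/-- The conversion rule assumes only that the target is well-formed; validity supplies the source,
so that conversions used in derivations become links of `TyEq`. -/
theorem Typed.validity {Γ T : Ctx} {t : Tm} {A : Ty} (h : Typed Γ t T A) :
    HasKind [] (T ++ Γ) A [] := by
  refine h.ind (mT := fun Γ _ T A => HasKind [] (T ++ Γ) A []) .one ?_ (fun _ _ h _ => h)
    (fun h => h.shift h) ?_ ?_ ?_ ?_ ?_
  · intro Γ T t s A B _ hs h _
    rw [List.append_assoc] at h
    exact h.subst ((SubstOk.single hs).lift h.isCtx)
  · intro Γ T t A B _ hB h
    rw [Ty.ren_eq_subst, ← upN_var, Ctx.ren_eq_subst]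
    exact h.subst ((SubstOk.drop (T := [B]) (.cons h.isCtx.tail hB)).lift h.isCtx)
  · intro S k c h hc
    have hmem := List.mem_of_getElem? hc
    have hm := h.fp_inv.2.2.1 c hmem
    rw [List.append_nil]
    exact (h.instMor hm).shift ((h.fp_inv.2.2.2 c hmem).tySubst1 h)
  · intro S k c h hc
    have hmem := List.mem_of_getElem? hc
    have hm := h.fp_inv.2.2.1 c hmem
    rw [List.append_nil]
    exact ((h.fp_inv.2.2.2 c hmem).tySubst1 h).shift (h.instMor hm)
  · intro Δ S C gs hΔ h hC _ _
    have hp := h.fp_inv.2.1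
    exact ((hC.instMor_id hp).shift (h.instMor_id hp)).append_closed hΔ
  · intro Δ S C gs hΔ h hC _ _
    have hp := h.fp_inv.2.1
    exact ((h.instMor_id hp).shift (hC.instMor_id hp)).append_closed hΔ

/-! ### Conversion of types and of terms -/

theorem path_lift {α β : Type} {r : α → α → Prop} {p : β → β → Prop} (f : α → β)
    (h : ∀ a b, r a b → p (f a) (f b)) {a b : α} (hab : ReflTransGen r a b) :
    ReflTransGen p (f a) (f b) := by
  induction hab with
  | refl => exact .refl
  | tail _ hr ih => exact ih.tail (h _ _ hr)

theorem path_symm {α : Type} {r : α → α → Prop} (h : ∀ a b, r a b → r b a) {a b : α}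
    (hab : ReflTransGen r a b) : ReflTransGen r b a := by
  induction hab with
  | refl => exact .refl
  | tail _ hr ih => exact .head (h _ _ hr) ih

/-- Conversion of well-formed types in the context `Γ`. -/
def TyEq (Γ : Ctx) : Ty → Ty → Prop :=
  ReflTransGen fun A B => TyConv A B ∧ HasKind [] Γ A [] ∧ HasKind [] Γ B []

theorem TyConv.symm {A B : Ty} (h : TyConv A B) : TyConv B A := Or.symm h

theorem TyEq.symm {Γ : Ctx} {A B : Ty} (h : TyEq Γ A B) : TyEq Γ B A :=
  path_symm (fun _ _ h => ⟨h.1.symm, h.2.2, h.2.1⟩) h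

theorem TyEq.trans {Γ : Ctx} {A B C : Ty} (h₁ : TyEq Γ A B) (h₂ : TyEq Γ B C) : TyEq Γ A C :=
  ReflTransGen.trans h₁ h₂

theorem TyEq.refl (Γ : Ctx) (A : Ty) : TyEq Γ A A := ReflTransGen.refl

theorem TyEq.of_conv {Γ : Ctx} {A B : Ty} (h : TyConv A B) (hA : HasKind [] Γ A [])
    (hB : HasKind [] Γ B []) : TyEq Γ A B := .single ⟨h, hA, hB⟩

theorem TyEq.subst {Γ Δ : Ctx} {A B : Ty} {θ : ℕ → Tm} (h : TyEq Γ A B) (hθ : SubstOk Δ θ Γ) :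
    TyEq Δ (A.subst θ) (B.subst θ) :=
  path_lift (Ty.subst θ)
    (fun _ _ h => ⟨h.1.subst h.2.1.ws h.2.2.ws θ, h.2.1.subst hθ, h.2.2.subst hθ⟩) h

theorem Typed.convEq {Γ T : Ctx} {t : Tm} {A B : Ty} (h : Typed Γ t T A)
    (hAB : TyEq (T ++ Γ) A B) : Typed Γ t T B := by
  induction hAB with
  | refl => exact h
  | tail _ hs ih => exact .conv ih hs.1 hs.2.2

/-- One-step conversion of terms. -/
def TmConv (t t' : Tm) : Prop := Step t t' ∨ Step t' t

/-- Conversion of terms of the type `A` in the context `Δ`. -/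
def TmEq (Δ : Ctx) (A : Ty) (t t' : Tm) : Prop :=
  Typed Δ t [] A ∧
    ReflTransGen (fun t t' => TmConv t t' ∧ Typed Δ t [] A ∧ Typed Δ t' [] A) t t'

theorem TmEq.refl {Δ : Ctx} {A : Ty} {t : Tm} (h : Typed Δ t [] A) : TmEq Δ A t t := ⟨h, .refl⟩

theorem TmEq.right {Δ : Ctx} {A : Ty} {t t' : Tm} (h : TmEq Δ A t t') : Typed Δ t' [] A := by
  obtain ⟨h, h'⟩ := h
  induction h' with
  | refl => exact h
  | tail _ h _ => exact h.2.2

theorem TmEq.trans {Δ : Ctx} {A : Ty} {t t' t'' : Tm} (h : TmEq Δ A t t')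
    (h' : TmEq Δ A t' t'') : TmEq Δ A t t'' := ⟨h.1, h.2.trans h'.2⟩

theorem TmEq.of_conv {Δ : Ctx} {A : Ty} {t t' : Tm} (h : TmConv t t') (ht : Typed Δ t [] A)
    (ht' : Typed Δ t' [] A) : TmEq Δ A t t' := ⟨ht, .single ⟨h, ht, ht'⟩⟩

theorem TmEq.convEq {Δ : Ctx} {A B : Ty} {t t' : Tm} (h : TmEq Δ A t t') (hAB : TyEq Δ A B) :
    TmEq Δ B t t' :=
  ⟨h.1.convEq hAB, path_lift id (fun _ _ h => ⟨h.1, h.2.1.convEq hAB, h.2.2.convEq hAB⟩) h.2⟩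

theorem TmConv.subst {p q : ℕ} {t t' : Tm} (h : TmConv t t') (ht : TmWS p t) (ht' : TmWS q t')
    (θ : ℕ → Tm) : TmConv (t.subst θ) (t'.subst θ) :=
  h.imp (fun h => h.subst ht θ) fun h => h.subst ht' θ

theorem TmEq.subst {Γ Δ : Ctx} {A : Ty} {t t' : Tm} {θ : ℕ → Tm} (h : TmEq Γ A t t')
    (hθ : SubstOk Δ θ Γ) : TmEq Δ (A.subst θ) (t.subst θ) (t'.subst θ) :=
  ⟨h.1.subst hθ, path_lift (Tm.subst θ)
    (fun _ _ h => ⟨h.1.subst h.2.1.ws h.2.2.ws θ, h.2.1.subst hθ, h.2.2.subst hθ⟩) h.2⟩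

theorem TmEq.weak {Δ : Ctx} {A B : Ty} {t t' : Tm} (h : TmEq Δ A t t') (hB : HasKind [] Δ B []) :
    TmEq (B :: Δ) A.shift t.shift t'.shift := by
  have := h.subst (SubstOk.drop (T := [B]) (.cons h.1.isCtx hB))
  rwa [← Ty.ren_eq_subst, ← Tm.ren_eq_subst, ← Tm.ren_eq_subst] at this

/-! ### Convertible substitutions -/

/-- `SubstEq Δ η η' Γ`: the substitutions `η` and `η'` from `Δ` to `Γ` are convertible. -/
def SubstEq (Δ : Ctx) : (ℕ → Tm) → (ℕ → Tm) → Ctx → Prop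
  | _, _, [] => IsCtx Δ
  | η, η', A :: Γ => SubstEq Δ (fun i => η (i + 1)) (fun i => η' (i + 1)) Γ ∧
      TmEq Δ (A.subst fun i => η (i + 1)) (η 0) (η' 0) ∧
      Typed Δ (η' 0) [] (A.subst fun i => η' (i + 1))

theorem SubstEq.left {Δ Γ : Ctx} {η η' : ℕ → Tm} (h : SubstEq Δ η η' Γ) : SubstOk Δ η Γ := by
  induction Γ generalizing η η' with
  | nil => exact h
  | cons A Γ ih => exact ⟨ih h.1, h.2.1.1⟩

/-- Immediate only because `SubstEq` asks for each entry of `η'` at its own type as well. Deriving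
that from the conversion would need that the types of `Γ` respect convertible substitutions, which
is proved later with `SubstEq` as a tool. -/
theorem SubstEq.right {Δ Γ : Ctx} {η η' : ℕ → Tm} (h : SubstEq Δ η η' Γ) : SubstOk Δ η' Γ := by
  induction Γ generalizing η η' with
  | nil => exact h
  | cons A Γ ih => exact ⟨ih h.1, h.2.2⟩

theorem SubstOk.eq {Δ Γ : Ctx} {η : ℕ → Tm} (h : SubstOk Δ η Γ) : SubstEq Δ η η Γ := by
  induction Γ generalizing η with
  | nil => exact h
  | cons A Γ ih => exact ⟨ih h.1, .refl h.2, h.2⟩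

theorem SubstEq.tail {Δ T Γ : Ctx} {η η' : ℕ → Tm} (h : SubstEq Δ η η' (T ++ Γ)) :
    SubstEq Δ (fun i => η (i + T.length)) (fun i => η' (i + T.length)) Γ := by
  induction T generalizing η η' with
  | nil => exact h
  | cons A T ih =>
    have := ih h.1
    simpa only [List.length_cons, add_assoc, add_comm 1] using this

theorem SubstEq.prefix {Δ T Γ : Ctx} {η η' : ℕ → Tm} (h : SubstEq Δ η η' (T ++ Γ)) :
    SubstEq Δ η η' T := by
  induction T generalizing η η' with
  | nil => exact h.left.isCtx
  | cons A T ih => exact ⟨ih h.1, h.2⟩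

theorem SubstEq.weak {Δ Γ : Ctx} {η η' : ℕ → Tm} {B : Ty} (h : SubstEq Δ η η' Γ)
    (hB : HasKind [] Δ B []) :
    SubstEq (B :: Δ) (fun i => (η i).shift) (fun i => (η' i).shift) Γ := by
  induction Γ generalizing η η' with
  | nil => exact .cons h hB
  | cons A Γ ih =>
    have h' := (SubstEq.right h).weak hB
    refine ⟨ih h.1, ?_, h'.2⟩
    have := h.2.1.weak hB
    rwa [Ty.shift, Ty.ren_subst] at this

theorem IsCtx.append_closed {T Δ : Ctx} (hT : IsCtx T) (hΔ : IsCtx Δ) : IsCtx (T ++ Δ) :=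
  (SubstOk.append_closed hT hΔ).isCtx

/-- The contexts bound by bodies of (co)recursors are closed, so this case suffices; the new
variables have the same type under `θ` and `θ'`, and no conversion of contexts arises. -/
theorem SubstEq.lift_closed {Δ U Γ : Ctx} {θ θ' : ℕ → Tm} (h : SubstEq Δ θ θ' Γ)
    (hU : IsCtx U) : SubstEq (U ++ Δ) (upN U.length θ) (upN U.length θ') (U ++ Γ) := by
  induction U with
  | nil => exact h
  | cons A U ih =>
    cases hU with | cons hU hA =>
    have hA' := hA.append_closed h.left.isCtx
    have key : ∀ φ : ℕ → Tm, A.subst (fun i => (upN U.length φ i).shift) = A.shift := fun φ => by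
      simp only [Tm.shift, ← Ty.ren_subst]
      rw [hA.ws.subst_upN le_rfl]; rfl
    have h0 := Typed.proj hA'
    refine ⟨(ih hU).weak hA', ?_, ?_⟩
    · rw [show (fun i => upN (A :: U).length θ (i + 1)) = fun i => (upN U.length θ i).shift
          from rfl,
        key]
      exact .refl h0
    · rw [show (fun i => upN (A :: U).length θ' (i + 1)) = fun i => (upN U.length θ' i).shift
        from rfl, key]
      exact h0

theorem splice_lt {n i : ℕ} (ρ η : ℕ → Tm) (h : i < n) : (upN n ρ i).subst η = η i := by
  rw [upN_lt _ h]; rfl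

theorem splice_add (n i : ℕ) (ρ η : ℕ → Tm) :
    (upN n ρ (i + n)).subst η = (ρ i).subst fun j => η (j + n) := by
  rw [upN_add, Tm.subst_ren]

/-- Arguments for the parameters `T[ρ]` over `Γ'` serve as arguments for `T` over `Γ`. With `ρ` a
shift this settles weakening, with `ρ = [t]` instantiation. -/
theorem SubstEq.splice {Δ T Γ Γ' : Ctx} {ρ η η' : ℕ → Tm}
    (h : SubstEq Δ η η' (T.subst ρ ++ Γ'))
    (h' : SubstEq Δ (fun i => (ρ i).subst fun j => η (j + T.length))
      (fun i => (ρ i).subst fun j => η' (j + T.length)) Γ) :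
    SubstEq Δ (fun i => (upN T.length ρ i).subst η) (fun i => (upN T.length ρ i).subst η')
      (T ++ Γ) := by
  induction T generalizing η η' with
  | nil => exact h'
  | cons A T ih =>
    simp only [SubstEq, List.cons_append, List.length_cons, upN, up, Tm.subst_shift]
    obtain ⟨h₁, h₂, h₃⟩ := h
    rw [Ty.subst_subst] at h₂ h₃
    exact ⟨ih h₁ (by simpa only [List.length_cons, add_assoc, add_comm 1] using h'), h₂, h₃⟩

/-! ### Lists with one entry converted -/

/-- One entry of a list of terms is converted. -/
def ListConv (hs hs' : List Tm) : Prop :=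
  ∃ σ₁ σ₂ t t', TmConv t t' ∧ hs = σ₁ ++ t :: σ₂ ∧ hs' = σ₁ ++ t' :: σ₂

theorem ListConv.cons {hs hs' : List Tm} (h : ListConv hs hs') (t : Tm) :
    ListConv (t :: hs) (t :: hs') := by
  obtain ⟨σ₁, σ₂, s, s', h, rfl, rfl⟩ := h
  exact ⟨t :: σ₁, σ₂, s, s', h, rfl, rfl⟩

theorem ListConv.head {t t' : Tm} (h : TmConv t t') (hs : List Tm) :
    ListConv (t :: hs) (t' :: hs) := ⟨[], hs, t, t', h, rfl, rfl⟩

theorem TyStep.instMor {A A' : Ty} (h : TyStep A A') (σ : Mor) :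
    TyStep (A.instMor σ) (A'.instMor σ) := by
  induction σ with
  | nil => exact h
  | cons t σ ih => exact .inst t ih

theorem Step.appMor {t t' : Tm} (h : Step t t') (σ : Mor) : Step (t.appMor σ) (t'.appMor σ) := by
  induction σ with
  | nil => exact h
  | cons s σ ih => exact .appLeft s ih

theorem TyStep.instMor_entry (A : Ty) {t t' : Tm} (h : Step t t') (σ₁ σ₂ : Mor) :
    TyStep (A.instMor (σ₁ ++ t :: σ₂)) (A.instMor (σ₁ ++ t' :: σ₂)) := by
  rw [Ty.instMor_append, Ty.instMor_append]
  exact TyStep.instMor (.param _ h) σ₁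

theorem Step.appMor_entry (s : Tm) {t t' : Tm} (h : Step t t') (σ₁ σ₂ : Mor) :
    Step (s.appMor (σ₁ ++ t :: σ₂)) (s.appMor (σ₁ ++ t' :: σ₂)) := by
  rw [Tm.appMor_append, Tm.appMor_append]
  exact Step.appMor (.appRight _ h) σ₁

theorem ListConv.instMor {σ σ' : Mor} (h : ListConv σ σ') (A : Ty) :
    TyConv (A.instMor σ) (A.instMor σ') := by
  obtain ⟨σ₁, σ₂, t, t', h, rfl, rfl⟩ := h
  exact h.imp (fun h => .instMor_entry A h _ _) fun h => .instMor_entry A h _ _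

theorem ListConv.appMor {σ σ' : Mor} (h : ListConv σ σ') (s : Tm) :
    TmConv (s.appMor σ) (s.appMor σ') := by
  obtain ⟨σ₁, σ₂, t, t', h, rfl, rfl⟩ := h
  exact h.imp (fun h => .appMor_entry s h _ _) fun h => .appMor_entry s h _ _

theorem ListConv.recur {gs gs' : List Tm} (h : ListConv gs gs') (S : Sig) (C : Ty) :
    TmConv (.recur S C gs) (.recur S C gs') := by
  obtain ⟨σ₁, σ₂, t, t', h, rfl, rfl⟩ := h
  exact h.imp (fun h => .recur S C _ _ h) fun h => .recur S C _ _ h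

theorem ListConv.corecur {gs gs' : List Tm} (h : ListConv gs gs') (S : Sig) (C : Ty) :
    TmConv (.corecur S C gs) (.corecur S C gs') := by
  obtain ⟨σ₁, σ₂, t, t', h, rfl, rfl⟩ := h
  exact h.imp (fun h => .corecur S C _ _ h) fun h => .corecur S C _ _ h

/-- The entries are converted from left to right. Carrying `P` along keeps every intermediate list
admissible as a list of bodies. -/
theorem list_chain {P : ℕ → Tm → Prop} {gs gs' : List Tm} (hl : gs.length = gs'.length)
    (h : ∀ k g g', gs[k]? = some g → gs'[k]? = some g' →
      ReflTransGen (fun t t' => TmConv t t' ∧ P k t ∧ P k t') g g')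
    (hP : ∀ k g, gs[k]? = some g → P k g) :
    ReflTransGen (fun hs hs' => ListConv hs hs' ∧
      (hs.length = gs.length ∧ ∀ k g, hs[k]? = some g → P k g) ∧
      (hs'.length = gs.length ∧ ∀ k g, hs'[k]? = some g → P k g)) gs gs' := by
  induction gs generalizing P gs' with
  | nil =>
    rw [List.length_nil] at hl
    rw [List.length_eq_zero_iff.1 hl.symm]
  | cons g gs ih =>
    cases gs' with
    | nil => simp at hl
    | cons g' gs' =>
      have hl' : gs.length = gs'.length := by simpa using hl
      have hg := h 0 g g' rfl rfl
      have good : ∀ {t : Tm} {hs : List Tm}, P 0 t → (∀ k g, hs[k]? = some g → P (k + 1) g) →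
          ∀ k g, (t :: hs)[k]? = some g → P k g := by
        intro t hs ht hhs k g hk
        cases k with
        | zero => simp only [List.getElem?_cons_zero, Option.some.injEq] at hk; subst hk; exact ht
        | succ k => exact hhs k g (by simpa using hk)
      have hrest : ∀ k g, gs[k]? = some g → P (k + 1) g := fun k g hk => hP (k + 1) g (by simpa)
      have hg' : P 0 g' := by
        have h0 : P 0 g := hP 0 g rfl
        clear h ih
        induction hg with
        | refl => exact h0
        | tail _ hr _ => exact hr.2.2
      refine (path_lift (fun t => t :: gs) (fun t t' ht => ?_) hg).trans
        (path_lift (fun hs => g' :: hs) (fun hs hs' hh => ?_)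
          (ih (P := fun k => P (k + 1)) hl'
            (fun k g g' h₁ h₂ => h (k + 1) g g' (by simpa) (by simpa))
            hrest))
      · exact ⟨.head ht.1 gs, ⟨rfl, good ht.2.1 hrest⟩, ⟨rfl, good ht.2.2 hrest⟩⟩
      · exact ⟨hh.1.cons g', ⟨by simp [hh.2.1.1], good hg' hh.2.1.2⟩,
          ⟨by simp [hh.2.2.1], good hg' hh.2.2.2⟩⟩

/-! ### Types and terms respect convertible substitutions -/

/-- The type constructor `A` respects convertible substitutions and arguments. -/
def TyRespects (Γ : Ctx) (A : Ty) (T : Ctx) : Prop :=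
  ∀ Δ η η', SubstEq Δ η η' (T ++ Γ) →
    TyEq Δ ((A.subst fun i => η (i + T.length)).instMor (argsOf T.length η))
      ((A.subst fun i => η' (i + T.length)).instMor (argsOf T.length η'))

/-- The term `t` respects convertible substitutions and arguments. -/
def TmRespects (Γ : Ctx) (t : Tm) (T : Ctx) (A : Ty) : Prop :=
  ∀ Δ η η', SubstEq Δ η η' (T ++ Γ) →
    TmEq Δ (A.subst η) ((t.subst fun i => η (i + T.length)).appMor (argsOf T.length η))
      ((t.subst fun i => η' (i + T.length)).appMor (argsOf T.length η'))

/-- The types of the context respect convertible substitutions. -/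
def CtxRespects : Ctx → Prop
  | [] => True
  | A :: Γ => CtxRespects Γ ∧ TyRespects Γ A []

/-- The morphism `σ` respects convertible substitutions. -/
def MorRespects (Γ₁ : Ctx) (σ : Mor) (Γ₂ : Ctx) : Prop :=
  ∀ Δ η η', SubstEq Δ η η' Γ₁ →
    SubstEq Δ (fun i => (ofMor σ i).subst η) (fun i => (ofMor σ i).subst η') Γ₂

theorem TyRespects.apply {Γ Δ : Ctx} {A : Ty} {η η' : ℕ → Tm} (h : TyRespects Γ A [])
    (hη : SubstEq Δ η η' Γ) : TyEq Δ (A.subst η) (A.subst η') := h Δ η η' hη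

theorem TmRespects.apply {Γ Δ : Ctx} {t : Tm} {A : Ty} {η η' : ℕ → Tm}
    (h : TmRespects Γ t [] A) (hη : SubstEq Δ η η' Γ) :
    TmEq Δ (A.subst η) (t.subst η) (t.subst η') := h Δ η η' hη

theorem scons_eta {α : Type} (f : ℕ → α) : (scons (f 0) fun i => f (i + 1)) = f := by
  funext i; cases i <;> rfl

/-- Convertible substitutions are connected by conversions of single entries. -/
theorem SubstEq.chain {P Δ : Ctx} {η η' : ℕ → Tm} (hP : CtxRespects P)
    (h : SubstEq Δ η η' P) :
    ReflTransGen (fun ζ ζ' => SubstEq Δ η ζ P ∧ SubstEq Δ η ζ' P ∧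
      (argsOf P.length ζ = argsOf P.length ζ' ∨
        ListConv (argsOf P.length ζ) (argsOf P.length ζ'))) η η' := by
  induction P generalizing η η' with
  | nil => exact .single ⟨h, h, .inl rfl⟩
  | cons A P ih =>
    -- The tail is converted first, with `η 0` kept; `η 0` stays well typed because `A` respects the
    -- conversion of the tail.
    have step₁ : ∀ ζ, SubstEq Δ (fun i => η (i + 1)) ζ P →
        SubstEq Δ η (scons (η 0) ζ) (A :: P) := fun ζ hζ =>
      ⟨hζ, .refl h.2.1.1, h.2.1.1.convEq (hP.2.apply hζ)⟩
    -- Then the head follows its own path over the new tail; that path runs in the old type and is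
    -- transported to the new one.
    have step₂ : ∀ t, TmEq Δ (A.subst fun i => η (i + 1)) (η 0) t →
        SubstEq Δ η (scons t fun i => η' (i + 1)) (A :: P) := fun t ht =>
      ⟨h.1, ht, ht.right.convEq (hP.2.apply h.1)⟩
    have c₁ := path_lift (p := fun ζ ζ' => SubstEq Δ η ζ (A :: P) ∧
      SubstEq Δ η ζ' (A :: P) ∧ (argsOf (A :: P).length ζ = argsOf (A :: P).length ζ' ∨
        ListConv (argsOf (A :: P).length ζ) (argsOf (A :: P).length ζ')))
      (scons (η 0)) (fun ζ ζ' hζ => by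
        refine ⟨step₁ _ hζ.1, step₁ _ hζ.2.1, ?_⟩
        simp only [List.length_cons, argsOf_succ]
        exact hζ.2.2.imp (fun h => congrArg _ h) fun h => h.cons _) (ih hP.1 h.1)
    rw [scons_eta] at c₁
    refine c₁.trans ?_
    obtain ⟨h₀, hc⟩ := h.2.1
    rw [← scons_eta η']
    have : ∀ t, ReflTransGen (fun t t' => TmConv t t' ∧
        Typed Δ t [] (A.subst fun i => η (i + 1)) ∧
        Typed Δ t' [] (A.subst fun i => η (i + 1))) (η 0) t →
        ReflTransGen (fun ζ ζ' => SubstEq Δ η ζ (A :: P) ∧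
          SubstEq Δ η ζ' (A :: P) ∧ (argsOf (A :: P).length ζ = argsOf (A :: P).length ζ' ∨
            ListConv (argsOf (A :: P).length ζ) (argsOf (A :: P).length ζ')))
          (scons (η 0) fun i => η' (i + 1)) (scons t fun i => η' (i + 1)) := by
      intro t ht
      induction ht with
      | refl => exact .refl
      | tail ht hs ih =>
        refine ih.tail ⟨step₂ _ ⟨h₀, ht⟩, step₂ _ ⟨h₀, ht.tail hs⟩, .inr ?_⟩
        simp only [List.length_cons, argsOf_succ]
        exact .head hs.1 _
    exact this _ hc

/-- An argument of a spine is a position where type reduction may act, so each link of the chain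
that changes an entry is a single conversion of types. -/
theorem HasKind.respects_args {P Δ : Ctx} {C : Ty} {η η' : ℕ → Tm} (hC : HasKind [] [] C P)
    (hP : CtxRespects P) (h : SubstEq Δ η η' P) :
    TyEq Δ (C.instMor (argsOf P.length η)) (C.instMor (argsOf P.length η')) := by
  have := h.chain hP
  clear h
  induction this with
  | refl => exact .refl _ _
  | tail _ hs ih =>
    refine ih.trans ?_
    obtain ⟨h₁, h₂, h₃ | h₃⟩ := hs
    · rw [h₃]; exact .refl _ _
    · exact .of_conv (h₃.instMor C) (hC.instClosed h₁.right) (hC.instClosed h₂.right)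

theorem Typed.appClosed {U Δ : Ctx} {H : Tm} {D : Ty} {η : ℕ → Tm} (h : Typed Δ H U D)
    (hU : HasKind [] U D []) (hη : SubstOk Δ η U) :
    Typed Δ (H.appMor (argsOf U.length η)) [] (D.subst η) := by
  refine Typed.spine (Q := []) (Γ := []) (η := η) ?_ (by simpa using hη)
  rw [List.nil_append, hU.isCtx.closed, hU.ws.subst_upN (by simp)]
  exact h

theorem Typed.respects_args {U Δ : Ctx} {H : Tm} {D : Ty} {η η' : ℕ → Tm} (h : Typed Δ H U D)
    (hU : HasKind [] U D []) (hD : TyRespects U D []) (hP : CtxRespects U)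
    (hη : SubstEq Δ η η' U) :
    TmEq Δ (D.subst η) (H.appMor (argsOf U.length η)) (H.appMor (argsOf U.length η')) := by
  have hc := hη.chain hP
  have h0 := h.appClosed hU hη.left
  clear hη
  induction hc with
  | refl => exact .refl h0
  | tail _ hs ih =>
    refine ih.trans ?_
    obtain ⟨h₁, h₂, h₃ | h₃⟩ := hs
    · rw [h₃]; exact .refl ((h.appClosed hU h₂.right).convEq (hD.apply h₂).symm)
    -- Each intermediate application has its own result type; `hD` brings all of them to the fixed
    -- type `D[η]`.
    · exact .of_conv (h₃.appMor H) ((h.appClosed hU h₁.right).convEq (hD.apply h₁).symm)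
        ((h.appClosed hU h₂.right).convEq (hD.apply h₂).symm)

theorem HasKind.respects_closed {P : Ctx} {C : Ty} (hC : HasKind [] [] C P)
    (hP : CtxRespects P) : TyRespects [] C P := by
  intro Δ η η' h
  rw [hC.closed, hC.closed]
  exact hC.respects_args hP h.prefix

theorem instMor_idMor_subst {C : Ty} (hC : C.Closed) (n : ℕ) (η : ℕ → Tm) :
    (C.instMor (idMor n)).subst η = C.instMor (argsOf n η) := by
  rw [Ty.instMor_subst, hC, idMor_eq, argsOf_map]; rfl

theorem instMor_subst_ofMor {C : Ty} (hC : C.Closed) (σ : Mor) (η : ℕ → Tm) :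
    (C.instMor σ).subst η = C.instMor (argsOf σ.length fun i => (ofMor σ i).subst η) := by
  rw [Ty.instMor_subst, hC, ← argsOf_map σ.length (ofMor σ), argsOf_ofMor]

theorem HasKind.respects_idMor {P : Ctx} {C : Ty} (hC : HasKind [] [] C P)
    (hP : CtxRespects P) : TyRespects P (C.instMor (idMor P.length)) [] := by
  intro Δ η η' h
  simp only [List.length_nil, add_zero, argsOf_zero, Ty.instMor, List.foldr_nil]
  rw [← Ty.instMor, instMor_idMor_subst hC.closed, instMor_idMor_subst hC.closed]
  exact hC.respects_args hP h

theorem HasKind.respects_instMor {P Γ : Ctx} {C : Ty} {σ : Mor} (hC : HasKind [] [] C P)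
    (hP : CtxRespects P) (hσ : MorRespects Γ σ P) (hl : σ.length = P.length) :
    TyRespects Γ (C.instMor σ) [] := by
  intro Δ η η' h
  simp only [List.length_nil, add_zero, argsOf_zero]
  change TyEq Δ ((C.instMor σ).subst η) ((C.instMor σ).subst η')
  rw [instMor_subst_ofMor hC.closed, instMor_subst_ofMor hC.closed, hl]
  exact hC.respects_args hP (hσ Δ η η' h)

-- Respecting conversion under weakening, instantiation and abstraction.

theorem TyRespects.shift {Γ T : Ctx} {A B : Ty} (h : TyRespects Γ A T) :
    TyRespects (B :: Γ) A.shift (T.ren Nat.succ) := by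
  intro Δ η η' hη
  have h1 := hη.tail.1
  rw [Ctx.ren_eq_subst] at hη
  have := h Δ _ _ (hη.splice (Γ := Γ) (by
    simpa only [Tm.subst, Nat.succ_eq_add_one, Ctx.ren_length] using h1))
  simp only [splice_add] at this
  rw [argsOf_congr fun i hi => splice_lt _ η hi, argsOf_congr fun i hi => splice_lt _ η' hi] at this
  simpa only [Ctx.ren_length, Ty.subst_shift, Tm.subst] using this

theorem TmRespects.shift {Γ T : Ctx} {t : Tm} {A B : Ty} (h : TmRespects Γ t T A) :
    TmRespects (B :: Γ) t.shift (T.ren Nat.succ) (A.ren (upRenN T.length Nat.succ)) := by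
  intro Δ η η' hη
  have h1 := hη.tail.1
  rw [Ctx.ren_eq_subst] at hη
  have := h Δ _ _ (hη.splice (Γ := Γ) (by
    simpa only [Tm.subst, Nat.succ_eq_add_one, Ctx.ren_length] using h1))
  simp only [splice_add] at this
  rw [argsOf_congr fun i hi => splice_lt _ η hi, argsOf_congr fun i hi => splice_lt _ η' hi] at this
  rw [Ty.ren_eq_subst, ← upN_var, Ty.subst_subst]
  simpa only [Ctx.ren_length, Tm.subst_shift, Tm.subst] using this

theorem SubstEq.single {Γ Δ : Ctx} {t t' : Tm} {B : Ty} {θ θ' : ℕ → Tm} (h : SubstEq Δ θ θ' Γ)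
    (ht : TmEq Δ (B.subst θ) t t') (ht' : Typed Δ t' [] (B.subst θ')) :
    SubstEq Δ (scons t θ) (scons t' θ') (B :: Γ) := ⟨h, ht, ht'⟩

theorem ofMor_singleton_subst (t : Tm) (θ : ℕ → Tm) :
    (fun i => (ofMor [t] i).subst θ) = scons (t.subst θ) θ := by
  funext i; cases i <;> simp [scons, ofMor_nil, Tm.subst]

theorem SubstEq.splice_single {Γ Δ T : Ctx} {t : Tm} {B : Ty} {η η' : ℕ → Tm}
    (hη : SubstEq Δ η η' (Ctx.subst (ofMor [t]) T ++ Γ)) (ht : Typed Γ t [] B)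
    (h : TmRespects Γ t [] B) :
    SubstEq Δ (fun i => (upN T.length (ofMor [t]) i).subst η)
      (fun i => (upN T.length (ofMor [t]) i).subst η') (T ++ B :: Γ) := by
  have h1 := hη.tail
  rw [Ctx.subst_length] at h1
  refine hη.splice ?_
  rw [ofMor_singleton_subst, ofMor_singleton_subst]
  exact h1.single (h.apply h1) (ht.subst h1.right)

theorem argsOf_splice_single (n : ℕ) (t : Tm) (η : ℕ → Tm) :
    argsOf (n + 1) (fun i => (upN n (ofMor [t]) i).subst η) =
      argsOf n η ++ [t.subst fun i => η (i + n)] := by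
  rw [argsOf_add, argsOf_congr fun i hi => splice_lt _ η hi]
  simp only [splice_add]
  simp [argsOf_succ]

theorem TyRespects.inst {Γ T : Ctx} {A B : Ty} {t : Tm} (h : TyRespects Γ A (T ++ [B]))
    (ht : Typed Γ t [] B) (h' : TmRespects Γ t [] B) :
    TyRespects Γ (.inst A t) (Ctx.subst (ofMor [t]) T) := by
  intro Δ η η' hη
  have := h Δ _ _ (by simpa using hη.splice_single ht h')
  rw [List.length_append, List.length_singleton, argsOf_splice_single, argsOf_splice_single,
    Ty.instMor_append, Ty.instMor_append] at this
  simp only [show ∀ i, i + (T.length + 1) = (i + 1) + T.length by omega, splice_add,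
    ofMor_cons_succ, ofMor_nil, Tm.subst] at this
  simp only [Ctx.subst_length]
  exact this

theorem TmRespects.app {Γ T : Ctx} {t s : Tm} {A B : Ty} (h : TmRespects Γ t (T ++ [A]) B)
    (hs : Typed Γ s [] A) (h' : TmRespects Γ s [] A) :
    TmRespects Γ (.app t s) (Ctx.subst (ofMor [s]) T) (B.subst (upN T.length (ofMor [s]))) := by
  intro Δ η η' hη
  have := h Δ _ _ (by simpa using hη.splice_single hs h')
  rw [List.length_append, List.length_singleton, argsOf_splice_single, argsOf_splice_single,
    Tm.appMor_append, Tm.appMor_append] at this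
  simp only [show ∀ i, i + (T.length + 1) = (i + 1) + T.length by omega, splice_add,
    ofMor_cons_succ, ofMor_nil, Tm.subst] at this
  rw [Ty.subst_subst]
  simp only [Ctx.subst_length]
  exact this

/-- The abstracted parameter is the last list entry, so its argument is innermost and forms a redex
with the abstraction; the arguments for `T` are carried along by compatibility. -/
theorem HasKind.beta_args {Γ T Δ : Ctx} {A B : Ty} {η : ℕ → Tm} (hB : HasKind [] (A :: Γ) B T)
    (hη : SubstOk Δ η ((T ++ [A]) ++ Γ)) :
    TyEq Δ (((Ty.pabs B).subst fun i => η (i + (T ++ [A]).length)).instMor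
        (argsOf (T ++ [A]).length η))
      ((B.subst fun i => η (i + T.length)).instMor (argsOf T.length η)) := by
  refine .of_conv (.inl ?_) (hB.pabs.instArgs hη) (hB.instArgs (by simpa using hη))
  rw [List.length_append, List.length_singleton, argsOf_add, Ty.instMor_append]
  refine TyStep.instMor ?_ _
  have := TyStep.beta (B.subst (up fun i => η (i + (T.length + 1)))) (η T.length)
  rw [Ty.subst_subst] at this
  convert this using 1
  · simp [argsOf_succ, Ty.instMor, Ty.subst]
  · congr 1
    funext i
    cases i with
    | zero => simp [up, Tm.subst]
    | succ i =>
      simp only [up, Tm.subst_shift, ofMor_cons_succ, ofMor_nil]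
      rw [show (fun i => Tm.var i) = Tm.var from rfl, Tm.subst_var]
      congr 1; omega

/-- Full application exposes a β-redex for both substitutions, so the path for `B` only has to be
extended by one step at each end. -/
theorem TyRespects.pabs {Γ T : Ctx} {A B : Ty} (hB : HasKind [] (A :: Γ) B T)
    (h : TyRespects (A :: Γ) B T) : TyRespects Γ (.pabs B) (T ++ [A]) := by
  intro Δ η η' hη
  exact ((hB.beta_args hη.left).trans (h Δ η η' (by simpa using hη))).trans
    (hB.beta_args hη.right).symm

/-- Closed type constructors for the variables of `Ξ`. -/
def TySubstOk (a : ℕ → Ty) (Ξ : TyCtx) : Prop :=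
  (∀ X, (a X).Closed) ∧ ∀ X P, Ξ[X]? = some P → HasKind [] [] (a X) P

theorem TySubstOk.scons {a : ℕ → Ty} {Ξ : TyCtx} (h : TySubstOk a Ξ) {C : Ty} {P : Ctx}
    (hC : HasKind [] [] C P) : TySubstOk (scons C a) (P :: Ξ) := by
  refine ⟨closed_scons hC.closed h.1, fun X Q hX => ?_⟩
  cases X with
  | zero => simp only [List.getElem?_cons_zero, Option.some.injEq] at hX; subst hX; exact hC
  | succ X => exact h.2 X Q (by simpa using hX)

theorem TySubstOk.nil : TySubstOk Ty.tvar [] := ⟨Ty.closed_tvar, by simp⟩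

theorem HasKind.tySubst_closed {Ξ : TyCtx} {Γ T : Ctx} {A : Ty} {a : ℕ → Ty}
    (h : HasKind Ξ Γ A T) (ha : TySubstOk a Ξ) : HasKind [] Γ (A.tySubst a) T :=
  h.tySubst .nil ha.1 ha.2

/-- The components of the data of a fixed point type respect convertible substitutions. -/
def SigRespects (S : Sig) : Prop :=
  CtxRespects S.par ∧ ∀ c ∈ S.comps, CtxRespects c.dom ∧ MorRespects c.dom c.mor S.par ∧
    ∀ a, TySubstOk a [S.par] → TyRespects c.dom (c.ty.tySubst a) []

theorem CtxRespects.cons {Γ : Ctx} {A : Ty} (h : CtxRespects Γ) (hA : TyRespects Γ A []) :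
    CtxRespects (A :: Γ) := ⟨h, hA⟩

theorem list_chain_typed {S : Sig} {gs gs' : List Tm} {Γ : Comp → Ctx} {D : Comp → Ty}
    (hl : gs.length = S.comps.length) (hl' : gs'.length = S.comps.length)
    (h : ∀ (k : ℕ) (c : Comp) (g g' : Tm), S.comps[k]? = some c → gs[k]? = some g →
      gs'[k]? = some g' →
      TmEq (Γ c) (D c) g g') :
    ReflTransGen (fun hs hs' => ListConv hs hs' ∧
      (hs.length = S.comps.length ∧
        ∀ (k : ℕ) (c : Comp) (g : Tm), S.comps[k]? = some c → hs[k]? = some g →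
        Typed (Γ c) g [] (D c)) ∧
      (hs'.length = S.comps.length ∧
        ∀ (k : ℕ) (c : Comp) (g : Tm), S.comps[k]? = some c → hs'[k]? = some g →
        Typed (Γ c) g [] (D c))) gs gs' := by
  have h1 := list_chain (P := fun k g => ∀ c, S.comps[k]? = some c → Typed (Γ c) g [] (D c))
    (gs := gs) (gs' := gs') (by omega) (fun k g g' hg hg' => by
      obtain ⟨c, hc⟩ := exists_comp hl hg
      refine path_lift id (fun t t' ht => ⟨ht.1, fun c' hc' => ?_, fun c' hc' => ?_⟩)
        (h k c g g' hc hg hg').2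
      · rw [hc] at hc'; cases hc'; exact ht.2.1
      · rw [hc] at hc'; cases hc'; exact ht.2.2) (fun k g hg c hc => by
      have hk : k < gs'.length := by
        have := (List.getElem?_eq_some_iff.1 hg).1; omega
      exact (h k c g _ hc hg (List.getElem?_eq_getElem hk)).1)
  exact path_lift id (fun hs hs' hh => ⟨hh.1,
    ⟨by rw [id, hh.2.1.1, hl], fun k c g hc hg => hh.2.1.2 k g hg c hc⟩,
    ⟨by rw [id, hh.2.2.1, hl], fun k c g hc hg => hh.2.2.2 k g hg c hc⟩⟩) h1

/-- The substituted bodies of a (co)recursor are convertible. -/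
theorem bodies_eq {S : Sig} {gs : List Tm} {Γ Δ : Ctx} {D E : Comp → Ty} {θ θ' : ℕ → Tm}
    (hctx : ∀ c ∈ S.comps, HasKind [] (D c :: c.dom) (E c) [])
    (hg : ∀ (k : ℕ) (c : Comp) (g : Tm), S.comps[k]? = some c → gs[k]? = some g →
      TmRespects (D c :: (c.dom ++ Γ)) g [] (E c))
    (hθ : SubstEq Δ θ θ' Γ) (k : ℕ) (c : Comp) (g g' : Tm) (hc : S.comps[k]? = some c)
    (hs : (substBodies θ S.binders gs)[k]? = some g)
    (hs' : (substBodies θ' S.binders gs)[k]? = some g') :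
    TmEq (D c :: (c.dom ++ Δ)) (E c) g g' := by
  obtain ⟨g₀, hk, rfl⟩ := substBodies_some_inv hc hs
  obtain ⟨g₁, hk', rfl⟩ := substBodies_some_inv hc hs'
  rw [hk] at hk'
  cases hk'
  have hE := hctx c (List.mem_of_getElem? hc)
  have := (hg k c g₀ hc hk).apply (hθ.lift_closed hE.isCtx)
  rwa [hE.ws.subst_upN le_rfl] at this

theorem TmEq.appClosed {U Δ : Ctx} {h h' : Tm} {D : Ty} {η : ℕ → Tm} (hU : HasKind [] U D [])
    (hη : SubstOk Δ η U) (ht : Typed Δ h U D)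
    (hc : ReflTransGen (fun h h' => TmConv h h' ∧ Typed Δ h U D ∧ Typed Δ h' U D) h h') :
    TmEq Δ (D.subst η) (h.appMor (argsOf U.length η)) (h'.appMor (argsOf U.length η)) := by
  refine ⟨ht.appClosed hU hη, path_lift (fun h => h.appMor (argsOf U.length η)) ?_ hc⟩
  exact fun t t' h => ⟨h.1.imp (fun h => h.appMor _) fun h => h.appMor _,
    h.2.1.appClosed hU hη, h.2.2.appClosed hU hη⟩

/-- Types are treated under all closed replacements `a` because the rules for constants mention
`Aₖ[C/X]`, which has no subderivation of its own: it comes from `Aₖ`, derived with `X` free. The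
clause for `Ξ = []` hands the results about the components of `S` to those rules, whose premise is
merely that the fixed point type is well-formed. -/
theorem respects :
    (∀ {Γ}, IsCtx Γ → CtxRespects Γ) ∧
    (∀ {Γ₁ σ Γ₂}, IsMor Γ₁ σ Γ₂ → CtxRespects Γ₁ ∧ MorRespects Γ₁ σ Γ₂) ∧
    (∀ {Ξ Γ A T}, HasKind Ξ Γ A T → CtxRespects Γ ∧
      (∀ a, TySubstOk a Ξ → TyRespects Γ (A.tySubst a) T) ∧
      (Ξ = [] → ∀ ρ S, A = .fp ρ S → SigRespects S)) ∧
    (∀ {Γ t T A}, Typed Γ t T A → CtxRespects Γ ∧ TmRespects Γ t T A) := by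
  refine judgement_induction (mX := fun _ => True) trivial ?_ trivial (fun _ _ _ _ => trivial)
    ?_ ?_ ?_ ?_ ?_ ?_ ?_ ?_ ?_ ?_ ?_ ?_ ?_ ?_ ?_ ?_ ?_ ?_
  · intro Γ A _ _ h hA
    have := hA.2.1 _ .nil
    rw [Ty.tySubst_tvar] at this
    exact ⟨h, this⟩
  · exact fun _ h => ⟨h, fun Δ η η' hη => hη.left.isCtx⟩
  · intro Γ₁ Γ₂ σ t A hσ _ ht h₁ _ h₂
    refine ⟨h₁.1, fun Δ η η' hη => ?_⟩
    simp only [SubstEq, ofMor_cons_succ, ofMor_cons_zero]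
    have h₃ := h₂.2.apply hη
    have h₄ := ht.subst hη.right
    rw [Ty.subst_subst] at h₃
    rw [List.length_nil, upN, Ty.subst_subst] at h₄
    exact ⟨h₁.2 Δ η η' hη, h₃, h₄⟩
  · refine ⟨trivial, fun a _ Δ η η' _ => ?_, by simp⟩
    simp only [Ty.tySubst, Ty.subst]
    exact .refl _ _
  · intro Ξ T _ _ _ hT
    exact ⟨trivial, fun a ha => (ha.2 0 T (by simp)).respects_closed hT, by simp⟩
  · intro Ξ Γ T U A _ _ h _
    refine ⟨h.1, fun a ha => ?_, by simp⟩
    rw [Ty.tyShift, Ty.tySubst_tyRen]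
    exact h.2.1 _ ⟨fun X => ha.1 _, fun X P hX => ha.2 (X + 1) P (by simpa using hX)⟩
  · intro Ξ Γ T A B _ _ h hB
    have hB' := hB.2.1 _ .nil
    rw [Ty.tySubst_tvar] at hB'
    refine ⟨⟨h.1, hB'⟩, fun a ha => ?_, fun hΞ ρ S hS => ?_⟩
    · rw [Ty.shift, Ty.ren_eq_subst, Ty.tySubst_subst ha.1, ← Ty.ren_eq_subst]
      exact (h.2.1 a ha).shift
    · refine h.2.2 hΞ ρ S ?_
      cases A <;> simp_all [Ty.shift, Ty.ren]
  · intro Ξ Γ T A B t _ ht h₁ h₂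
    exact ⟨h₁.1, fun a ha => (h₁.2.1 a ha).inst ht h₂.2, by simp⟩
  · intro Ξ Γ T A B hB h
    exact ⟨h.1.1, fun a ha => (h.2.1 a ha).pabs (hB.tySubst_closed ha), by simp⟩
  · intro Ξ ρ S hΞ hp hm hk _ h₁ h₂ h₃
    refine ⟨trivial, fun a ha => ?_, ?_⟩
    · exact ((HasKind.fp ρ hΞ hp hm hk).tySubst_closed ha).respects_closed h₁
    · rintro rfl _ _ ⟨⟩
      exact ⟨h₁, fun c hc => ⟨(h₂ c hc).1, (h₂ c hc).2, (h₃ c hc).2.1⟩⟩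
  · exact ⟨trivial, fun Δ η η' h => .refl (Typed.unit.weak_closed trivial h.left.isCtx)⟩
  · exact fun _ hs h₁ h₂ => ⟨h₁.1, h₁.2.app hs h₂.2⟩
  · intro Γ T t A B ht hc hB h _
    refine ⟨h.1, fun Δ η η' hη => ?_⟩
    exact (h.2 Δ η η' hη).convEq ((TyEq.of_conv hc ht.validity hB).subst hη.left)
  · intro Γ A hA h
    have hA' := h.2.1 _ .nil
    rw [Ty.tySubst_tvar] at hA'
    refine ⟨⟨h.1, hA'⟩, fun Δ η η' hη => ?_⟩
    rw [Ty.subst_shift]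
    exact hη.2.1
  · intro Γ T t A B _ _ h hB
    have hB' := hB.2.1 _ .nil
    rw [Ty.tySubst_tvar] at hB'
    exact ⟨⟨h.1, hB'⟩, h.2.shift⟩
  · intro S k c h hc ih
    refine ⟨trivial, fun Δ η η' hη => ?_⟩
    obtain ⟨hp, hcs⟩ := ih.2.2 rfl _ _ rfl
    have hmem := List.mem_of_getElem? hc
    obtain ⟨hd, hm, hA⟩ := hcs c hmem
    have hlen := (h.fp_inv.2.2.1 c hmem).length_eq
    have ht := Typed.con h hc
    have hv := ht.validity
    rw [List.append_nil] at hv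
    exact Typed.respects_args (ht.weak_closed hv.isCtx.ws hη.left.isCtx) hv
      (h.respects_instMor hp hm hlen).shift (hd.cons (hA _ (TySubstOk.nil.scons h))) hη.prefix
  · intro S k c h hc ih
    refine ⟨trivial, fun Δ η η' hη => ?_⟩
    obtain ⟨hp, hcs⟩ := ih.2.2 rfl _ _ rfl
    have hmem := List.mem_of_getElem? hc
    obtain ⟨hd, hm, hA⟩ := hcs c hmem
    have hlen := (h.fp_inv.2.2.1 c hmem).length_eq
    have ht := Typed.des h hc
    have hv := ht.validity
    rw [List.append_nil] at hv
    exact Typed.respects_args (ht.weak_closed hv.isCtx.ws hη.left.isCtx) hv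
      (hA _ (TySubstOk.nil.scons h)).shift (hd.cons (h.respects_instMor hp hm hlen)) hη.prefix
  · intro Γ S C gs hΓ h hC hl hg h₁ ih _ ihg
    refine ⟨h₁, fun Δ η η' hη => ?_⟩
    obtain ⟨hp, -⟩ := ih.2.2 rfl _ _ rfl
    have hpar := h.fp_inv.2.1
    have hv := (hC.instMor_id hpar).shift (h.instMor_id hpar)
    have htyp : ∀ hs : List Tm, (hs.length = S.comps.length ∧
        ∀ (k : ℕ) (c : Comp) (g : Tm), S.comps[k]? = some c →
        hs[k]? = some g → Typed (c.ty.tySubst1 C :: (c.dom ++ Δ)) g [] (C.instMor c.mor).shift) →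
        Typed Δ (.recur S C hs) ((Ty.fp .mu S).instMor (idMor S.par.length) :: S.par)
          (C.instMor (idMor S.par.length)).shift :=
      fun hs hh => .recur hη.left.isCtx h hC hh.1 hh.2
    have hch := list_chain_typed (Γ := fun c => c.ty.tySubst1 C :: (c.dom ++ Δ))
      (D := fun c => (C.instMor c.mor).shift)
      (by rw [substBodies_length, hl]) (by rw [substBodies_length, hl])
      (bodies_eq (gs := gs) (fun c hc => (hC.instMor (h.fp_inv.2.2.1 c hc)).shift
        ((h.fp_inv.2.2.2 c hc).tySubst1 hC)) (fun k c g hc hk => (ihg k c g hc hk).2) hη.tail)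
    have h2 := path_lift (p := fun h h' => TmConv h h' ∧
      Typed Δ h ((Ty.fp .mu S).instMor (idMor S.par.length) :: S.par)
        (C.instMor (idMor S.par.length)).shift ∧
      Typed Δ h' ((Ty.fp .mu S).instMor (idMor S.par.length) :: S.par)
        (C.instMor (idMor S.par.length)).shift)
      (Tm.recur S C) (fun hs hs' hh => ⟨hh.1.recur S C, htyp _ hh.2.1, htyp _ hh.2.2⟩) hch
    have ht := fun θ hθ => (Typed.recur hΓ h hC hl hg).subst (Δ := Δ) (θ := θ) hθ
    simp only [hv.isCtx.closed, hv.ws.subst_upN le_rfl] at ht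
    -- The bodies are converted first, with the arguments `η` kept; the arguments follow, with the
    -- new bodies in place.
    refine (TmEq.appClosed hv hη.prefix.left (ht _ hη.tail.left) h2).trans ?_
    exact (ht _ hη.tail.right).respects_args hv (hC.respects_idMor hp).shift
      (hp.cons (h.respects_idMor hp)) hη.prefix
  · intro Γ S C gs hΓ h hC hl hg h₁ ih _ ihg
    refine ⟨h₁, fun Δ η η' hη => ?_⟩
    obtain ⟨hp, -⟩ := ih.2.2 rfl _ _ rfl
    have hpar := h.fp_inv.2.1
    have hv := (h.instMor_id hpar).shift (hC.instMor_id hpar)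
    have htyp : ∀ hs : List Tm, (hs.length = S.comps.length ∧
        ∀ (k : ℕ) (c : Comp) (g : Tm), S.comps[k]? = some c →
        hs[k]? = some g → Typed (C.instMor c.mor :: (c.dom ++ Δ)) g [] (c.ty.tySubst1 C).shift) →
        Typed Δ (.corecur S C hs) (C.instMor (idMor S.par.length) :: S.par)
          ((Ty.fp .nu S).instMor (idMor S.par.length)).shift :=
      fun hs hh => .corecur hη.left.isCtx h hC hh.1 hh.2
    have hch := list_chain_typed (Γ := fun c => C.instMor c.mor :: (c.dom ++ Δ))
      (D := fun c => (c.ty.tySubst1 C).shift)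
      (by rw [substBodies_length, hl]) (by rw [substBodies_length, hl])
      (bodies_eq (gs := gs) (fun c hc => ((h.fp_inv.2.2.2 c hc).tySubst1 hC).shift
        (hC.instMor (h.fp_inv.2.2.1 c hc))) (fun k c g hc hk => (ihg k c g hc hk).2) hη.tail)
    have h2 := path_lift (p := fun h h' => TmConv h h' ∧
      Typed Δ h (C.instMor (idMor S.par.length) :: S.par)
        ((Ty.fp .nu S).instMor (idMor S.par.length)).shift ∧
      Typed Δ h' (C.instMor (idMor S.par.length) :: S.par)
        ((Ty.fp .nu S).instMor (idMor S.par.length)).shift)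
      (Tm.corecur S C) (fun hs hs' hh => ⟨hh.1.corecur S C, htyp _ hh.2.1, htyp _ hh.2.2⟩) hch
    have ht := fun θ hθ => (Typed.corecur hΓ h hC hl hg).subst (Δ := Δ) (θ := θ) hθ
    simp only [hv.isCtx.closed, hv.ws.subst_upN le_rfl] at ht
    refine (TmEq.appClosed hv hη.prefix.left (ht _ hη.tail.left) h2).trans ?_
    exact (ht _ hη.tail.right).respects_args hv (h.respects_idMor hp).shift
      (hp.cons (hC.respects_idMor hp)) hη.prefix

theorem IsCtx.respects {Γ : Ctx} (h : IsCtx Γ) : CtxRespects Γ := DTT.respects.1 h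

theorem HasKind.respects {Γ T : Ctx} {A : Ty} (h : HasKind [] Γ A T) : TyRespects Γ A T := by
  have := (DTT.respects.2.2.1 h).2.1 _ .nil
  rwa [Ty.tySubst_tvar] at this

/-! ### Typing of the action of types -/

theorem Ty.shift_subst_up (A : Ty) (θ : ℕ → Tm) : A.shift.subst (up θ) = (A.subst θ).shift := by
  rw [Ty.subst_shift, Ty.shift, Ty.ren_subst]; rfl

/-- The instance `A @ id` of a type constructor with `n` parameters, in the context extended by its
parameters. -/
def Ty.full (A : Ty) (n : ℕ) : Ty := (A.ren (· + n)).instMor (idMor n)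

theorem Ty.Closed.full {A : Ty} (h : A.Closed) (n : ℕ) : A.full n = A.instMor (idMor n) := by
  rw [Ty.full, h.ren]

theorem Ty.full_zero (A : Ty) : A.full 0 = A := by
  rw [Ty.full, Ty.ren_eq_subst]
  exact Ty.subst_var A

theorem Ty.full_subst (A : Ty) (n : ℕ) (θ : ℕ → Tm) :
    (A.full n).subst (upN n θ) = (A.subst θ).full n := by
  rw [Ty.full, Ty.full, Ty.instMor_subst, Ty.subst_ren, Ty.ren_subst, idMor_eq, argsOf_map]
  simp only [upN_add]
  congr 1
  exact argsOf_congr fun i hi => upN_lt _ hi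

theorem idMor_subst_upN (n : ℕ) (t : Tm) :
    (idMor (n + 1)).map (Tm.subst (upN n (ofMor [t]))) = idMor n ++ [t.ren (· + n)] := by
  rw [idMor_eq, idMor_eq, argsOf_map, argsOf_add]
  congr 1
  · exact argsOf_congr fun i hi => upN_lt _ hi
  · have := upN_add n 0 (ofMor [t])
    rw [ofMor_cons_zero, zero_add] at this
    rw [argsOf_succ, argsOf_zero, Tm.subst, zero_add, this]

theorem Ty.full_inst (A : Ty) (n : ℕ) (t : Tm) :
    (A.full (n + 1)).subst (upN n (ofMor [t])) = (Ty.inst A t).full n := by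
  have h1 : ∀ i, upN n (ofMor [t]) (i + (n + 1)) = .var (i + n) := fun i => by
    rw [show i + (n + 1) = (i + 1) + n by omega, upN_add, ofMor_cons_succ, ofMor_nil, Tm.ren]
  rw [Ty.full, Ty.full, Ty.instMor_subst, idMor_subst_upN, Ty.instMor_append, Ty.subst_ren]
  simp only [h1]
  rw [← Ty.ren_eq_subst]
  rfl

theorem HasKind.full {Γ T : Ctx} {A : Ty} (h : HasKind [] Γ A T) :
    HasKind [] (T ++ Γ) (A.full T.length) [] := by
  have := h.instArgs (SubstOk.id h.isCtx_params)
  rwa [← Ty.ren_eq_subst] at this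

theorem SubstOk.prefix {Δ T Γ : Ctx} {η : ℕ → Tm} (h : SubstOk Δ η (T ++ Γ)) : SubstOk Δ η T :=
  (SubstEq.prefix h.eq).left

theorem Typed.append_closed {Γ Δ : Ctx} {t : Tm} {A : Ty} (h : Typed Γ t [] A)
    (hΔ : IsCtx Δ) : Typed (Γ ++ Δ) t [] A := by
  have := h.subst (SubstOk.append_closed h.isCtx hΔ)
  rwa [Tm.subst_var, List.length_nil, upN, Ty.subst_var] at this

theorem SubstOk.replaceLast {Γ : Ctx} {A B : Ty} {s : Tm} (h : Typed (B :: Γ) s [] A.shift) :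
    SubstOk (B :: Γ) (DTT.replaceLast s) (A :: Γ) := by
  refine ⟨SubstOk.drop (T := [B]) h.isCtx, ?_⟩
  rw [Ty.shift, Ty.ren_eq_subst] at h
  exact h

theorem Typed.replaceLast {Γ : Ctx} {A B D : Ty} {t s : Tm} (h : Typed (A :: Γ) t [] D.shift)
    (hs : Typed (B :: Γ) s [] A.shift) :
    Typed (B :: Γ) (t.subst (DTT.replaceLast s)) [] D.shift := by
  have := h.subst (SubstOk.replaceLast hs)
  rw [List.length_nil, upN, Ty.subst_shift] at this
  rwa [Ty.shift, Ty.ren_eq_subst]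

theorem TyEq.weak {Δ : Ctx} {A B C : Ty} (h : TyEq Δ A B) (hC : HasKind [] Δ C []) :
    TyEq (C :: Δ) A.shift B.shift := by
  have := h.subst (SubstOk.drop (T := [C]) (.cons hC.isCtx hC))
  rwa [← Ty.ren_eq_subst, ← Ty.ren_eq_subst] at this

/-- The variable of the new type is converted to the old type and substituted for the old variable;
on raw terms this substitution is the identity. -/
theorem Typed.ctx_conv {Γ : Ctx} {A A' D : Ty} {t : Tm} (h : Typed (A :: Γ) t [] D.shift)
    (hA : HasKind [] Γ A' []) (hAA : TyEq Γ A' A) : Typed (A' :: Γ) t [] D.shift := by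
  have h0 : Typed (A' :: Γ) (.var 0) [] A.shift := (Typed.proj hA).convEq (hAA.weak hA)
  have := h.replaceLast h0
  have hv : DTT.replaceLast (.var 0) = Tm.var := by funext i; cases i <;> rfl
  rwa [hv, Tm.subst_var] at this

theorem tySubst_tySubst1 (A R : Ty) (a : ℕ → Ty) :
    (A.tySubst (tyUp a)).tySubst1 R = A.tySubst (scons R a) := by
  rw [Ty.tySubst1, Ty.tySubst_tySubst]
  congr 1
  funext i
  cases i with
  | zero => rfl
  | succ i =>
    simp only [tyUp, Ty.tyShift, Ty.tySubst_tyRen, scons]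
    exact Ty.tySubst_tvar _

theorem Typed.lift_closed {U Γ Δ : Ctx} {t : Tm} {D : Ty} {θ : ℕ → Tm}
    (h : Typed (U ++ Γ) t [] D) (hD : HasKind [] U D []) (hθ : SubstOk Δ θ Γ) :
    Typed (U ++ Δ) (t.subst (upN U.length θ)) [] D := by
  have := h.subst (hθ.lift h.isCtx)
  rwa [hD.isCtx.closed, List.length_nil, upN, hD.ws.subst_upN le_rfl] at this

theorem appMor_id (h : Tm) (n : ℕ) :
    Tm.app (h.appMor (idMorS n)) (.var 0) = h.appMor (argsOf (n + 1) Tm.var) := by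
  rw [argsOf_succ, idMorS_eq]; rfl

/-- An identity spine, in the context extended by the parameters. -/
theorem Typed.appMor_id {P Δ : Ctx} {B D : Ty} {h : Tm} (ht : Typed (B :: (P ++ Δ)) h (B :: P) D)
    (hD : HasKind [] (B :: P) D []) (hΔ : IsCtx Δ) :
    Typed (B :: (P ++ Δ)) (.app (h.appMor (idMorS P.length)) (.var 0)) [] D := by
  have := ht.appClosed hD (SubstOk.append_closed (T := B :: P) hD.isCtx hΔ)
  rw [Ty.subst_var] at this
  rw [DTT.appMor_id]
  exact this

theorem TySubstOk.fp_kind {Ξ : TyCtx} {a : ℕ → Ty} {ρ : Fix} {S : Sig} (ha : TySubstOk a Ξ)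
    (h : HasKind Ξ [] (.fp ρ S) S.par) : HasKind [] [] (.fp ρ (S.tySubst (tyUp a))) S.par := by
  have := h.tySubst_closed ha
  rwa [Ty.tySubst] at this

/-- The hypothesis on the terms for the variables in the action of types. -/
def ActOk (Δ : Ctx) (a b : ℕ → Ty) (ts : ℕ → Tm) (Ξ : TyCtx) : Prop :=
  ∀ X P, Ξ[X]? = some P → Typed ((a X).instMor (idMor P.length) :: (P ++ Δ)) (ts X) []
    ((b X).instMor (idMor P.length)).shift

theorem ActOk.scons {Δ : Ctx} {a b : ℕ → Ty} {ts : ℕ → Tm} {Ξ : TyCtx} (h : ActOk Δ a b ts Ξ)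
    {P : Ctx} {A B : Ty} {t : Tm}
    (hR : Typed (A.instMor (idMor P.length) :: (P ++ Δ)) t []
      (B.instMor (idMor P.length)).shift) :
    ActOk Δ (DTT.scons A a) (DTT.scons B b) (DTT.scons t ts) (P :: Ξ) := by
  intro X Q hX
  cases X with
  | zero => simp only [List.getElem?_cons_zero, Option.some.injEq] at hX; subst hX; exact hR
  | succ X => exact h X Q (by simpa using hX)

theorem mapIdx_some {cs : List Comp} {f : ℕ → Comp → Tm} {F : Comp → Comp} {k : ℕ} {c' : Comp}
    {g : Tm} (hc : (cs.map F)[k]? = some c') (hg : (cs.mapIdx f)[k]? = some g) :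
    ∃ c, cs[k]? = some c ∧ c' = F c ∧ g = f k c := by
  rw [List.getElem?_map] at hc
  rw [List.getElem?_mapIdx] at hg
  cases h : cs[k]? with
  | none => simp [h] at hc
  | some c => exact ⟨c, rfl, by simpa [h] using hc.symm, by simpa [h] using hg.symm⟩

/-- The recursor eliminates into `R = μ(S_B)`. Its `k`-th body receives an element of `D_k` with `R`
for the bound variable; that variable acts as the identity on `R`, so the action of `D_k` produces
an argument for the `k`-th constructor of `R`. -/
theorem act_mu_typed {Ξ : TyCtx} {S : Sig} {Δ : Ctx} {a b : ℕ → Ty} {ts : ℕ → Tm}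
    (h : HasKind Ξ [] (.fp .mu S) S.par)
    (hk : ∀ c ∈ S.comps, HasKind (S.par :: Ξ) c.dom c.ty []) (hp : IsCtx S.par)
    (hΔ : IsCtx Δ) (ha : TySubstOk a Ξ) (hb : TySubstOk b Ξ)
    (ih : ∀ c ∈ S.comps, ∀ R, HasKind [] [] R S.par →
      Typed (c.ty.tySubst (scons R a) :: (c.dom ++ Δ))
        (c.ty.act (scons R a) (scons R b) (scons (.var 0) ts) c.dom.length 0) []
        (c.ty.tySubst (scons R b)).shift) :
    Typed ((Ty.fp .mu (S.tySubst (tyUp a))).instMor (idMor S.par.length) :: (S.par ++ Δ))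
      ((Ty.fp .mu S).act a b ts 0 S.par.length) []
      ((Ty.fp .mu (S.tySubst (tyUp b))).instMor (idMor S.par.length)).shift := by
  have hA := ha.fp_kind h
  have hB := hb.fp_kind h
  have hA' := hA.instMor_id hp
  have hB' := hB.instMor_id hp
  rw [Ty.act_mu]
  split_ifs with hbelow
  -- Without free constructor variables source and target agree, and the variable itself has the
  -- required type.
  · rw [Sig.tySubst_eq_of_tyBelow (b := b) hbelow]
    exact .proj (hB'.append_closed hΔ)
  · set R := Ty.fp .mu (S.tySubst (tyUp b)) with hR
    set Θ := (Ty.fp .mu (S.tySubst (tyUp a))).instMor (idMor S.par.length) :: (S.par ++ Δ) with hΘ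
    have hΘc : IsCtx Θ := (hA'.append_closed hΔ).isCtx.cons (hA'.append_closed hΔ)
    have hdrop : SubstOk Θ (fun i => .var (i + (S.par.length + 1))) Δ :=
      SubstOk.drop (T := (Ty.fp .mu (S.tySubst (tyUp a))).instMor (idMor S.par.length) :: S.par)
        hΘc
    refine Typed.appMor_id ?_ (hB'.shift hA') hΔ
    have := Typed.recur (Δ := Θ) (S := S.tySubst (tyUp a)) (C := R)
      (gs := S.comps.mapIdx fun k c =>
        .app ((Tm.con (S.tySubst (tyUp b)) k).appMor (idMorS c.dom.length))
          ((c.ty.act (scons R a) (scons R b) (scons (.var 0) ts) c.dom.length 0).ren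
            (upRenN (c.dom.length + 1) (· + (0 + S.par.length + 1)))))
      hΘc (by simpa using hA) (by simpa using hB) (by simp) (by
        intro k c' g hc' hg
        rw [Sig.tySubst_comps] at hc'
        obtain ⟨c, hc, rfl, rfl⟩ := mapIdx_some hc' hg
        have hmem := List.mem_of_getElem? hc
        simp only [Comp.tySubst_ty, Comp.tySubst_dom, Comp.tySubst_mor, tySubst_tySubst1]
        have hDA := (hk c hmem).tySubst_closed (ha.scons hB)
        have hDB := (hk c hmem).tySubst_closed (hb.scons hB)
        have hF := (ih c hmem R hB).lift_closed (U := c.ty.tySubst (scons R a) :: c.dom)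
          (hDB.shift hDA) hdrop
        rw [List.length_cons, upN_var, ← Tm.ren_eq_subst] at hF
        rw [zero_add]
        set F := (c.ty.act (scons R a) (scons R b) (scons (.var 0) ts) c.dom.length 0).ren
          (upRenN (c.dom.length + 1) (· + (S.par.length + 1)))
        have hcon := Typed.con (S := S.tySubst (tyUp b)) (k := k) (c := c.tySubst (tyUp b))
          (by simpa using hB) (by simp [hc])
        simp only [Comp.tySubst_ty, Comp.tySubst_dom, Comp.tySubst_mor, tySubst_tySubst1,
          ← hR] at hcon
        have hv := hcon.validity
        rw [List.append_nil] at hv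
        -- The constructor is applied to the identity on `Γₖ`, shifted past the last variable, and
        -- then to `F`.
        have hok : SubstOk (c.ty.tySubst (scons R a) :: (c.dom ++ Θ))
            (scons F fun i => .var (i + 1)) (c.ty.tySubst (scons R b) :: c.dom) := by
          refine ⟨(SubstOk.drop (T := [c.ty.tySubst (scons R a)]) hF.isCtx).prefix, ?_⟩
          rw [Ty.shift, Ty.ren_eq_subst] at hF
          exact hF
        have := (hcon.weak_closed hv.isCtx.ws hF.isCtx).appClosed hv hok
        rw [List.length_cons, argsOf_succ, Ty.subst_shift] at this
        rw [idMorS_eq, Ty.shift, Ty.ren_eq_subst]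
        exact this)
    simpa only [Sig.tySubst_par] using this

/-- Dual to the inductive case: the corecursor starts from `R = ν(S_A)`, and the action of `D_k` is
precomposed with the `k`-th destructor of `R`. -/
theorem act_nu_typed {Ξ : TyCtx} {S : Sig} {Δ : Ctx} {a b : ℕ → Ty} {ts : ℕ → Tm}
    (h : HasKind Ξ [] (.fp .nu S) S.par)
    (hk : ∀ c ∈ S.comps, HasKind (S.par :: Ξ) c.dom c.ty []) (hp : IsCtx S.par)
    (hΔ : IsCtx Δ) (ha : TySubstOk a Ξ) (hb : TySubstOk b Ξ)
    (ih : ∀ c ∈ S.comps, ∀ R, HasKind [] [] R S.par →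
      Typed (c.ty.tySubst (scons R a) :: (c.dom ++ Δ))
        (c.ty.act (scons R a) (scons R b) (scons (.var 0) ts) c.dom.length 0) []
        (c.ty.tySubst (scons R b)).shift) :
    Typed ((Ty.fp .nu (S.tySubst (tyUp a))).instMor (idMor S.par.length) :: (S.par ++ Δ))
      ((Ty.fp .nu S).act a b ts 0 S.par.length) []
      ((Ty.fp .nu (S.tySubst (tyUp b))).instMor (idMor S.par.length)).shift := by
  have hA := ha.fp_kind h
  have hB := hb.fp_kind h
  have hA' := hA.instMor_id hp
  have hB' := hB.instMor_id hp
  rw [Ty.act_nu]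
  split_ifs with hbelow
  · rw [Sig.tySubst_eq_of_tyBelow (b := b) hbelow]
    exact .proj (hB'.append_closed hΔ)
  · set R := Ty.fp .nu (S.tySubst (tyUp a)) with hR
    set Θ := R.instMor (idMor S.par.length) :: (S.par ++ Δ) with hΘ
    have hΘc : IsCtx Θ := (hA'.append_closed hΔ).isCtx.cons (hA'.append_closed hΔ)
    have hdrop : SubstOk Θ (fun i => .var (i + (S.par.length + 1))) Δ :=
      SubstOk.drop (T := R.instMor (idMor S.par.length) :: S.par) hΘc
    refine Typed.appMor_id ?_ (hB'.shift hA') hΔ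
    have := Typed.corecur (Δ := Θ) (S := S.tySubst (tyUp b)) (C := R)
      (gs := S.comps.mapIdx fun k c =>
        ((c.ty.act (scons R a) (scons R b) (scons (.var 0) ts) c.dom.length 0).ren
            (upRenN (c.dom.length + 1) (· + (0 + S.par.length + 1)))).subst
          (DTT.replaceLast (.app ((Tm.des (S.tySubst (tyUp a)) k).appMor (idMorS c.dom.length))
            (.var 0))))
      hΘc (by simpa using hB) (by simpa using hA) (by simp) (by
        intro k c' g hc' hg
        rw [Sig.tySubst_comps] at hc'
        obtain ⟨c, hc, rfl, rfl⟩ := mapIdx_some hc' hg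
        have hmem := List.mem_of_getElem? hc
        simp only [Comp.tySubst_ty, Comp.tySubst_dom, Comp.tySubst_mor, tySubst_tySubst1]
        have hDA := (hk c hmem).tySubst_closed (ha.scons hA)
        have hDB := (hk c hmem).tySubst_closed (hb.scons hA)
        have hF := (ih c hmem R hA).lift_closed (U := c.ty.tySubst (scons R a) :: c.dom)
          (hDB.shift hDA) hdrop
        rw [List.length_cons, upN_var, ← Tm.ren_eq_subst] at hF
        rw [zero_add]
        have hdes := Typed.des (S := S.tySubst (tyUp a)) (k := k) (c := c.tySubst (tyUp a))
          (by simpa using hA) (by simp [hc])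
        simp only [Comp.tySubst_ty, Comp.tySubst_dom, Comp.tySubst_mor, tySubst_tySubst1,
          ← hR] at hdes
        have hv := hdes.validity
        rw [List.append_nil] at hv
        refine hF.replaceLast ?_
        exact Typed.appMor_id (hdes.weak_closed hv.isCtx.ws
          (hv.isCtx.append_closed (T := R.instMor c.mor :: c.dom) hΘc)) hv hΘc)
    simpa only [Sig.tySubst_par] using this

/-- The families vary in the induction because a fixed point extends them by `R` with the identity
on it. Speaking of `A @ id` lets the induction pass through constructors with parameters;
abstraction is the one case where the types match only up to β. -/
theorem HasKind.act_typed {Ξ : TyCtx} {Γ T Δ : Ctx} {A : Ty} {a b : ℕ → Ty} {ts : ℕ → Tm}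
    (h : HasKind Ξ Γ A T) (hΔ : IsCtx Δ) (ha : TySubstOk a Ξ) (hb : TySubstOk b Ξ)
    (hts : ActOk Δ a b ts Ξ) :
    Typed ((A.tySubst a).full T.length :: (T ++ (Γ ++ Δ))) (A.act a b ts Γ.length T.length) []
      ((A.tySubst b).full T.length).shift := by
  revert Δ a b ts
  refine h.ind (mK := fun Ξ Γ A T => ∀ {Δ : Ctx} {a b : ℕ → Ty} {ts : ℕ → Tm}, IsCtx Δ →
    TySubstOk a Ξ → TySubstOk b Ξ → ActOk Δ a b ts Ξ →
    Typed ((A.tySubst a).full T.length :: (T ++ (Γ ++ Δ))) (A.act a b ts Γ.length T.length) []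
      ((A.tySubst b).full T.length).shift) ?_ ?_ ?_ ?_ ?_ ?_ ?_
  · intro Δ a b ts hΔ _ _ _
    simp only [Ty.tySubst, Ty.act, List.length_nil, Ty.full_zero]
    exact .proj (HasKind.one.weak_closed trivial hΔ)
  · intro Ξ T _ _ Δ a b ts hΔ ha hb hts
    simp only [Ty.tySubst, Ty.act, (ha.1 0).full, (hb.1 0).full]
    -- The variable rule has the empty term context, so the shift by its length is trivial.
    have h0 : upRenN (T.length + 1) (· + ([] : Ctx).length) = fun i => i := by
      funext i; rw [upRenN_apply]; split_ifs <;> simp; omega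
    rw [h0, Tm.ren_id]
    exact hts 0 T (by simp)
  · intro Ξ Γ T U A _ _ ih Δ a b ts hΔ ha hb hts
    rw [Ty.tyShift, Ty.tySubst_tyRen, Ty.tySubst_tyRen, Ty.act_tyRen]
    exact ih hΔ ⟨fun X => ha.1 _, fun X P hX => ha.2 (X + 1) P (by simpa using hX)⟩
      ⟨fun X => hb.1 _, fun X P hX => hb.2 (X + 1) P (by simpa using hX)⟩
      fun X P hX => hts (X + 1) P (by simpa using hX)
  · intro Ξ Γ T A B hA hB ih Δ a b ts hΔ ha hb hts
    have h1 := ih hΔ ha hb hts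
    have hB' := hB.append_closed hΔ
    have h2 := h1.subst ((SubstOk.drop (T := [B]) (.cons hB'.isCtx hB')).lift
      (T := (A.tySubst a).full T.length :: T) h1.isCtx)
    simp only [Ctx.subst, List.length_nil, upN, List.length_cons, Ty.shift_subst_up,
      Ty.full_subst, ← Ty.ren_eq_subst, ← Ctx.ren_eq_subst] at h2
    have e : ∀ {a : ℕ → Ty}, (∀ X, (a X).Closed) → A.shift.tySubst a = (A.tySubst a).shift := by
      intro a ha
      rw [Ty.shift, Ty.ren_eq_subst, Ty.tySubst_subst ha, ← Ty.ren_eq_subst]; rfl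
    have e' := Ty.act_ren (k := 0) (a := a) (b := b) (ts := ts) hA.ws (Nat.zero_le _)
    rw [Ctx.ren_length, e ha.1, e hb.1]
    have e'' : A.shift.act a b ts (B :: Γ).length T.length = _ := e'
    rw [e'', Tm.ren_eq_subst, ← upN_var]
    exact h2
  · intro Ξ Γ T A B t hA ht ih Δ a b ts hΔ ha hb hts
    have h1 := ih hΔ ha hb hts
    simp only [List.length_append, List.length_singleton, List.append_assoc,
      List.singleton_append] at h1
    have h2 := h1.subst ((SubstOk.single (ht.append_closed hΔ)).lift
      (T := (A.tySubst a).full (T.length + 1) :: T) h1.isCtx)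
    simp only [Ctx.subst, List.length_nil, upN, List.length_cons, Ty.shift_subst_up,
      Ty.full_inst] at h2
    simp only [Ty.tySubst, Ctx.subst_length, Ty.act]
    exact h2
  · intro Ξ Γ T A B hB ih Δ a b ts hΔ ha hb hts
    have h1 := ih hΔ ha hb hts
    have key : ∀ {a : ℕ → Ty}, TySubstOk a Ξ →
        HasKind [] (T ++ (A :: Γ ++ Δ)) ((Ty.pabs (B.tySubst a)).full (T.length + 1)) [] ∧
        TyEq (T ++ (A :: Γ ++ Δ)) ((Ty.pabs (B.tySubst a)).full (T.length + 1))
          ((B.tySubst a).full T.length) := by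
      intro a ha
      have hk : HasKind [] (A :: (Γ ++ Δ)) (B.tySubst a) T :=
        (hB.tySubst_closed ha).append_closed hΔ
      have h3 := hk.pabs.full
      have h4 := hk.beta_args (SubstOk.id hk.pabs.isCtx_params)
      simp only [← Ty.ren_eq_subst, List.length_append, List.length_singleton,
        List.append_assoc, List.singleton_append] at h3 h4
      exact ⟨h3, h4⟩
    -- The type of the last variable is β-expanded here; the result type is expanded by the final
    -- conversion of this case.
    have h2 := h1.ctx_conv (key ha).1 (key ha).2
    simp only [Ty.tySubst, Ty.act, List.length_append, List.length_singleton, List.append_assoc,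
      List.singleton_append, Nat.add_sub_cancel]
    exact h2.convEq ((key hb).2.symm.weak (key ha).1)
  · intro Ξ ρ S hΞ hp hm hk ih Δ a b ts hΔ ha hb hts
    have h := HasKind.fp ρ hΞ hp hm hk
    have ih' : ∀ c ∈ S.comps, ∀ R, HasKind [] [] R S.par →
        Typed (c.ty.tySubst (scons R a) :: (c.dom ++ Δ))
          (c.ty.act (scons R a) (scons R b) (scons (.var 0) ts) c.dom.length 0) []
          (c.ty.tySubst (scons R b)).shift := by
      intro c hc R hR
      have := ih c hc hΔ (ha.scons hR) (hb.scons hR) (hts.scons (t := .var 0)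
        (.proj ((hR.instMor_id hp).append_closed hΔ)))
      simpa only [List.length_nil, Ty.full_zero, List.nil_append] using this
    simp only [Ty.tySubst, (Ty.closed_fp _ _).full, List.length_nil, List.nil_append]
    cases ρ with
    | mu => exact act_mu_typed h hk hp hΔ ha hb ih'
    | nu => exact act_nu_typed h hk hp hΔ ha hb ih'

theorem HasKind.act1_typed {P Γ Δ : Ctx} {A B C : Ty} {t : Tm} (h : HasKind [P] Γ A [])
    (hΔ : IsCtx Δ) (hB : HasKind [] [] B P) (hC : HasKind [] [] C P)
    (ht : Typed (B.instMor (idMor P.length) :: (P ++ Δ)) t []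
      (C.instMor (idMor P.length)).shift) :
    Typed (A.tySubst1 B :: (Γ ++ Δ)) (A.act1 B C t Γ.length) [] (A.tySubst1 C).shift := by
  have hn : ActOk Δ Ty.tvar Ty.tvar Tm.var [] := fun X P hX => by simp at hX
  have := h.act_typed hΔ (TySubstOk.nil.scons hB) (TySubstOk.nil.scons hC)
    (hn.scons ht)
  simp only [List.length_nil, Ty.full_zero, List.nil_append] at this
  exact this

theorem Typed.generic {P Δ : Ctx} {B C : Ty} {h : Tm} (ht : Typed Δ h (B :: P) C)
    (hC : HasKind [] (B :: P) C []) : Typed (B :: (P ++ Δ)) (h.generic P.length) [] C := by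
  have hctx : IsCtx ((B :: P) ++ Δ) := hC.isCtx.append_closed ht.isCtx
  have := ht.subst (SubstOk.drop (T := B :: P) hctx)
  rw [← Tm.ren_eq_subst, hC.isCtx.closed, hC.ws.subst_upN le_rfl] at this
  exact this.appMor_id hC ht.isCtx

/-! ### Inversion of typing derivations -/

theorem TyEq.weak_params {Γ T : Ctx} {D A B : Ty} (h : TyEq (T ++ Γ) D A) (hB : HasKind [] Γ B [])
    (hT : IsCtx (T ++ Γ)) :
    TyEq (T.ren Nat.succ ++ B :: Γ) (D.ren (upRenN T.length Nat.succ))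
      (A.ren (upRenN T.length Nat.succ)) := by
  have := h.subst ((SubstOk.drop (T := [B]) (.cons hB.isCtx hB)).lift hT)
  rw [List.length_singleton, upN_var, ← Ty.ren_eq_subst, ← Ty.ren_eq_subst,
    ← Ctx.ren_eq_subst] at this
  exact this

/-- Conversion touches only the result type, so the parameter context is recovered by an equation
and only `A` up to `TyEq`. Weakening preserves this form since it commutes with instantiation. -/
theorem Typed.app_inv {Γ T : Ctx} {t s : Tm} {A : Ty} (h : Typed Γ (.app t s) T A) :
    ∃ T₀ B C, Typed Γ t (T₀ ++ [B]) C ∧ Typed Γ s [] B ∧ T = Ctx.subst (ofMor [s]) T₀ ∧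
      TyEq (T ++ Γ) (C.subst (upN T₀.length (ofMor [s]))) A := by
  refine h.ind (mT := fun Γ r T A => ∀ t s, r = .app t s → ∃ T₀ B C, Typed Γ t (T₀ ++ [B]) C ∧
      Typed Γ s [] B ∧ T = Ctx.subst (ofMor [s]) T₀ ∧
      TyEq (T ++ Γ) (C.subst (upN T₀.length (ofMor [s]))) A)
    (by simp) ?_ ?_ (by simp) ?_ (by simp) (by simp) (by simp) (by simp) t s rfl
  · intro Γ T t' s' A B ht hs _ _ t s e
    cases e
    exact ⟨T, A, B, ht, hs, rfl, .refl _ _⟩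
  · intro Γ T r A B hr hc hB ih t s e
    obtain ⟨T₀, B', C, ht, hs, hT, hC⟩ := ih t s e
    exact ⟨T₀, B', C, ht, hs, hT, hC.trans (.of_conv hc hr.validity hB)⟩
  · intro Γ T r A B hr hB ih t' s' e
    cases r with
    | app t s =>
      simp only [Tm.shift, Tm.ren, Tm.app.injEq] at e
      obtain ⟨rfl, rfl⟩ := e
      obtain ⟨T₀, B', C, ht, hs, hT, hC⟩ := ih t s rfl
      have hd := SubstOk.drop (T := [B]) (.cons hB.isCtx hB)
      have ht' := ht.subst hd
      have hs' := hs.subst hd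
      have hC' := hC.weak_params hB hr.validity.isCtx
      rw [Ctx.subst_append, List.length_append, ← Tm.ren_eq_subst] at ht'
      rw [← Tm.ren_eq_subst] at hs'
      refine ⟨_, _, _, ht', hs', ?_, ?_⟩
      · rw [hT, Ctx.ren_eq_subst, Ctx.subst_ofMor, Tm.ren_eq_subst]; rfl
      · have hl : T.length = T₀.length := by rw [hT, Ctx.subst_length]
        rw [Ty.ren_eq_subst _ (Ty.subst _ _), ← upN_var, hl, subst_app_ty, ← hl] at hC'
        rw [Ctx.subst_length, Tm.ren_eq_subst, ← hl]
        exact hC'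
    | _ => simp [Tm.shift, Tm.ren] at e

theorem upN_one_ofMor (σ : Mor) (s : Tm) :
    (fun i => (upN 1 (ofMor σ) i).subst (ofMor [s])) = ofMor (s :: σ) := by
  funext i
  cases i with
  | zero => rfl
  | succ i => simp [upN, up, Tm.subst_shift, ofMor_nil, Tm.subst_var]

theorem Ctx.eq_subst_snoc {T T₀ : Ctx} {B : Ty} {θ : ℕ → Tm}
    (h : (T ++ [B] : List Ty) = T₀.subst θ) :
    ∃ T₁ B₁, T₀ = T₁ ++ [B₁] ∧ T = Ctx.subst (upN 1 θ) T₁ ∧ B = B₁.subst θ := by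
  rcases T₀.eq_nil_or_concat with rfl | ⟨T₁, B₁, rfl⟩
  · simp [Ctx.subst] at h
  · rw [List.concat_eq_append, Ctx.subst_append] at h
    obtain ⟨h₁, h₂⟩ := List.append_inj' h (by simp [Ctx.subst])
    refine ⟨T₁, B₁, by simp, h₁, ?_⟩
    simpa [Ctx.subst, upN] using h₂

/-- `Typed.app_inv` is iterated from the outermost argument inwards. Parameter contexts are compared
as lists, so splitting off a parameter needs no injectivity of conversion. -/
theorem Typed.spine_inv {Γ T : Ctx} {h : Tm} {σ : Mor} {A : Ty} (ht : Typed Γ (h.appMor σ) T A) :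
    ∃ U T₀ D, U.length = σ.length ∧ Typed Γ h (T₀ ++ U) D ∧ SubstOk Γ (ofMor σ) (U ++ Γ) ∧
      T = Ctx.subst (ofMor σ) T₀ ∧ TyEq (T ++ Γ) (D.subst (upN T₀.length (ofMor σ))) A := by
  induction σ generalizing T A with
  | nil =>
    refine ⟨[], T, A, rfl, by rw [List.append_nil]; exact ht, ?_, ?_, ?_⟩
    · rw [ofMor_nil]
      exact .id ht.isCtx
    · rw [ofMor_nil, Ctx.subst_var]
    · rw [ofMor_nil, upN_var_id, Ty.subst_var]
      exact .refl _ _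
  | cons s σ ih =>
    rw [Tm.appMor_cons] at ht
    obtain ⟨T₁, B, C, h₁, hs, rfl, hC⟩ := ht.app_inv
    obtain ⟨U, T₀, D, hl, h₂, hσ, hT, hD⟩ := ih h₁
    obtain ⟨T₂, B₂, rfl, rfl, rfl⟩ := Ctx.eq_subst_snoc hT
    refine ⟨B₂ :: U, T₂, D, by simp [hl], by simpa using h₂, ?_, ?_, ?_⟩
    · simp only [SubstOk, List.cons_append, ofMor_cons_succ, ofMor_cons_zero]
      exact ⟨hσ, hs⟩
    · rw [Ctx.subst_subst, upN_one_ofMor]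
    · refine TyEq.trans ?_ hC
      rw [List.append_assoc] at hD
      have := hD.subst ((SubstOk.single hs).lift (by simpa using h₁.validity.isCtx))
      rw [Ty.subst_subst, Ctx.subst_length, List.length_append, List.length_singleton,
        ← upN_upN, upN_subst, upN_one_ofMor] at this
      rw [Ctx.subst_length]
      exact this

/-- The types of the constructors, destructors, recursors and corecursors according to the typing
rules. -/
inductive Head : Ctx → Tm → Ctx → Ty → Prop
  | con {Γ : Ctx} {S : Sig} {k : ℕ} {c : Comp} : HasKind [] [] (.fp .mu S) S.par →
      S.comps[k]? = some c →
      Head Γ (.con S k) (c.ty.tySubst1 (.fp .mu S) :: c.dom) ((Ty.fp .mu S).instMor c.mor).shift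
  | des {Γ : Ctx} {S : Sig} {k : ℕ} {c : Comp} : HasKind [] [] (.fp .nu S) S.par →
      S.comps[k]? = some c →
      Head Γ (.des S k) ((Ty.fp .nu S).instMor c.mor :: c.dom) (c.ty.tySubst1 (.fp .nu S)).shift
  | recur {Γ : Ctx} {S : Sig} {C : Ty} {gs : List Tm} :
      HasKind [] [] (.fp .mu S) S.par → HasKind [] [] C S.par → gs.length = S.comps.length →
      (∀ (k : ℕ) (c : Comp) (g : Tm), S.comps[k]? = some c → gs[k]? = some g →
        Typed (c.ty.tySubst1 C :: (c.dom ++ Γ)) g [] (C.instMor c.mor).shift) →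
      Head Γ (.recur S C gs) ((Ty.fp .mu S).instMor (idMor S.par.length) :: S.par)
        (C.instMor (idMor S.par.length)).shift
  | corecur {Γ : Ctx} {S : Sig} {C : Ty} {gs : List Tm} :
      HasKind [] [] (.fp .nu S) S.par → HasKind [] [] C S.par → gs.length = S.comps.length →
      (∀ (k : ℕ) (c : Comp) (g : Tm), S.comps[k]? = some c → gs[k]? = some g →
        Typed (C.instMor c.mor :: (c.dom ++ Γ)) g [] (c.ty.tySubst1 C).shift) →
      Head Γ (.corecur S C gs) (C.instMor (idMor S.par.length) :: S.par)
        ((Ty.fp .nu S).instMor (idMor S.par.length)).shift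

theorem Head.kind {Γ T : Ctx} {t : Tm} {D : Ty} (h : Head Γ t T D) : HasKind [] T D [] := by
  cases h with
  | con h hc => simpa using (Typed.con h hc).validity
  | des h hc => simpa using (Typed.des h hc).validity
  | recur h hC =>
    have hp := h.fp_inv.2.1
    exact (hC.instMor_id hp).shift (h.instMor_id hp)
  | corecur h hC =>
    have hp := h.fp_inv.2.1
    exact (h.instMor_id hp).shift (hC.instMor_id hp)

theorem Typed.weak_body {U Γ : Ctx} {g : Tm} {D B : Ty} (h : Typed (U ++ Γ) g [] D)
    (hD : HasKind [] U D []) (hB : HasKind [] Γ B []) :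
    Typed (U ++ B :: Γ) (g.ren (upRenN U.length Nat.succ)) [] D := by
  have := h.lift_closed hD (SubstOk.drop (T := [B]) (.cons hB.isCtx hB))
  rwa [List.length_singleton, upN_var, ← Tm.ren_eq_subst] at this

theorem Head.weak {Γ T : Ctx} {t : Tm} {D B : Ty} (h : Head Γ t T D) (hB : HasKind [] Γ B []) :
    Head (B :: Γ) t.shift T D := by
  cases h with
  | con h hc => exact .con h hc
  | des h hc => exact .des h hc
  | recur h hC hl hg =>
    refine .recur h hC (by rw [renBodies_length, hl]) fun k c g' hc hg' => ?_
    obtain ⟨g, hk, rfl⟩ := renBodies_some_inv hc hg'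
    have hmem := List.mem_of_getElem? hc
    exact (hg k c g hc hk).weak_body (U := c.ty.tySubst1 _ :: c.dom)
      ((hC.instMor (h.fp_inv.2.2.1 c hmem)).shift ((h.fp_inv.2.2.2 c hmem).tySubst1 hC)) hB
  | corecur h hC hl hg =>
    refine .corecur h hC (by rw [renBodies_length, hl]) fun k c g' hc hg' => ?_
    obtain ⟨g, hk, rfl⟩ := renBodies_some_inv hc hg'
    have hmem := List.mem_of_getElem? hc
    exact (hg k c g hc hk).weak_body (U := Ty.instMor _ c.mor :: c.dom)
      (((h.fp_inv.2.2.2 c hmem).tySubst1 hC).shift (hC.instMor (h.fp_inv.2.2.1 c hmem))) hB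

/-- The constructors, destructors, recursors and corecursors. -/
def Tm.IsHead : Tm → Prop
  | .unit | .var _ | .app _ _ => False
  | _ => True

/-- The parameters and the result type declared by the rule of a head are closed, so weakening
affects only bodies, and conversion moves only the result type. -/
theorem Typed.head_inv {Γ T : Ctx} {t : Tm} {A : Ty} (h : Typed Γ t T A) (ht : t.IsHead) :
    ∃ D, Head Γ t T D ∧ TyEq (T ++ Γ) D A := by
  revert ht
  refine h.ind (mT := fun Γ t T A => t.IsHead → ∃ D, Head Γ t T D ∧ TyEq (T ++ Γ) D A)
    False.elim (fun _ _ _ _ => False.elim) ?_ (fun _ => False.elim) ?_ ?_ ?_ ?_ ?_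
  · intro Γ T t A B ht hc hB ih hh
    obtain ⟨D, hD, hA⟩ := ih hh
    exact ⟨D, hD, hA.trans (.of_conv hc ht.validity hB)⟩
  · intro Γ T t A B ht hB ih hh
    obtain ⟨D, hD, hA⟩ := ih (by cases t <;> exact hh)
    have hk := hD.kind
    have := hA.weak_params hB ht.validity.isCtx
    rw [Ctx.ren_eq_subst, hk.isCtx.closed] at this ⊢
    rw [Ty.ren_eq_subst _ D, ← upN_var, hk.ws.subst_upN le_rfl] at this
    exact ⟨D, hD.weak hB, this⟩
  · exact fun h hc _ => ⟨_, .con h hc, .refl _ _⟩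
  · exact fun h hc _ => ⟨_, .des h hc, .refl _ _⟩
  · exact fun _ h hC hl hg _ => ⟨_, .recur h hC hl hg, .refl _ _⟩
  · exact fun _ h hC hl hg _ => ⟨_, .corecur h hC hl hg, .refl _ _⟩

theorem Head.typed {Γ T : Ctx} {t : Tm} {D : Ty} (h : Head Γ t T D) (hΓ : IsCtx Γ) :
    Typed Γ t T D := by
  cases h with
  | con h hc =>
    have := Typed.con h hc
    exact this.weak_closed (by simpa using this.validity.isCtx.ws) hΓ
  | des h hc =>
    have := Typed.des h hc
    exact this.weak_closed (by simpa using this.validity.isCtx.ws) hΓ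
  | recur h hC hl hg => exact .recur hΓ h hC hl hg
  | corecur h hC hl hg => exact .corecur hΓ h hC hl hg

/-- Inversion of a full spine. -/
theorem Typed.head_spine_inv {Γ T : Ctx} {h : Tm} {σ : Mor} {A : Ty}
    (ht : Typed Γ (h.appMor σ) T A) (hh : h.IsHead) :
    ∃ V D, Head Γ h V D ∧ (σ.length = V.length → T = [] ∧ SubstOk Γ (ofMor σ) (V ++ Γ) ∧
      TyEq Γ (D.subst (ofMor σ)) A) := by
  obtain ⟨U, T₀, D', hl, hd, hσ, rfl, hA⟩ := ht.spine_inv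
  obtain ⟨D, hD, hDD⟩ := hd.head_inv hh
  refine ⟨T₀ ++ U, D, hD, fun hlen => ?_⟩
  -- A spine as long as the parameter list of the head leaves no parameter open.
  have : T₀ = [] := List.eq_nil_of_length_eq_zero (by simp at hlen; omega)
  subst this
  exact ⟨rfl, hσ, (hDD.subst hσ).trans hA⟩

theorem Typed.appMor {Γ T : Ctx} {t : Tm} {A : Ty} {σ : Mor} (h : Typed Γ t T A)
    (hl : σ.length = T.length) (hσ : SubstOk Γ (ofMor σ) (T ++ Γ)) :
    Typed Γ (t.appMor σ) [] (A.subst (ofMor σ)) := by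
  have := h.appArgs hσ
  simp only [← hl, ofMor_add, argsOf_ofMor] at this
  rwa [show (fun i => Tm.var i) = Tm.var from rfl, Tm.subst_var] at this

/-! ### Subject reduction -/

/-- The values for `T` do not change, but their types depend on the values for `Γ` that do; they are
retyped along the conversion. -/
theorem SubstEq.extend {Δ T Γ : Ctx} {η η' : ℕ → Tm} (hc : CtxRespects (T ++ Γ))
    (h : SubstOk Δ η (T ++ Γ)) (hi : ∀ i < T.length, η' i = η i)
    (ht : SubstEq Δ (fun i => η (i + T.length)) (fun i => η' (i + T.length)) Γ) :
    SubstEq Δ η η' (T ++ Γ) := by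
  induction T generalizing η η' with
  | nil => exact ht
  | cons A T ih =>
    have := ih hc.1 h.1 (fun i hi' => hi (i + 1) (by simpa using hi')) (by
      simpa only [List.length_cons, add_assoc, add_comm 1] using ht)
    refine ⟨this, ?_, ?_⟩
    · rw [hi 0 (by simp)]
      exact .refl h.2
    · rw [hi 0 (by simp)]
      exact h.2.convEq (hc.2.apply this)

theorem ofMor_append_lt {σ : Mor} {i : ℕ} (s : Tm) (h : i < σ.length) :
    ofMor (σ ++ [s]) i = ofMor σ i := by
  rw [ofMor_lt h, ofMor_lt (by simp; omega), List.getElem_append_left h]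

theorem splice_ofMor {n : ℕ} {σ : Mor} (hl : σ.length = n) (s : Tm) :
    (fun i => (upN n (ofMor [s]) i).subst (ofMor σ)) = ofMor (σ ++ [s]) := by
  subst hl
  funext i
  rcases lt_or_ge i σ.length with h | h
  · rw [splice_lt _ _ h]
    rw [ofMor_append_lt s h]
  · obtain ⟨j, rfl⟩ := Nat.exists_eq_add_of_le' h
    rw [splice_add]
    simp only [ofMor_add]
    rw [show (fun i => Tm.var i) = Tm.var from rfl, Tm.subst_var]
    cases j with
    | zero => simp [ofMor]
    | succ j =>
      have : j + 1 + σ.length = j + (σ ++ [s]).length := by simp; omega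
      rw [this, ofMor_add, ofMor_cons_succ, ofMor_nil]

/-- Turns arguments for `T₀[s/x]` into arguments for `T₀` over `x : B`. The value of `x` goes to the
end of the list because `x` is the first parameter. -/
theorem SubstOk.snoc {Γ T₀ : Ctx} {B : Ty} {s : Tm} {σ : Mor} (hs : Typed Γ s [] B)
    (hT : IsCtx (T₀ ++ B :: Γ)) (hl : σ.length = T₀.length)
    (hσ : SubstOk Γ (ofMor σ) (Ctx.subst (ofMor [s]) T₀ ++ Γ)) :
    SubstOk Γ (ofMor (σ ++ [s])) (T₀ ++ B :: Γ) := by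
  have := ((SubstOk.single hs).lift hT).comp hσ
  rwa [splice_ofMor hl] at this

theorem getElem?_replace {α : Type} {l₁ l₂ : List α} {a b x : α} {k : ℕ}
    (h : (l₁ ++ b :: l₂)[k]? = some x) :
    (k = l₁.length ∧ x = b) ∨ (l₁ ++ a :: l₂)[k]? = some x := by
  rcases lt_trichotomy k l₁.length with hk | rfl | hk
  · rw [List.getElem?_append_left hk] at h ⊢
    exact .inr h
  · simp at h
    exact .inl ⟨rfl, h.symm⟩
  · rw [List.getElem?_append_right hk.le] at h ⊢
    obtain ⟨m, hm⟩ : ∃ m, k - l₁.length = m + 1 := ⟨k - l₁.length - 1, by omega⟩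
    rw [hm, List.getElem?_cons_succ] at h ⊢
    exact .inr h

theorem Mor.comp_length (σ τ : Mor) : (σ.comp τ).length = σ.length := by simp [Mor.comp]

theorem shift_subst_ofMor_cons (A : Ty) (u : Tm) (τ : Mor) :
    A.shift.subst (ofMor (u :: τ)) = A.subst (ofMor τ) := by
  rw [Ty.subst_shift]
  simp only [ofMor_cons_succ]

theorem instMor_comp {C : Ty} (hC : C.Closed) (σ τ : Mor) :
    (C.instMor σ).subst (ofMor τ) = C.instMor (σ.comp τ) := by
  rw [Ty.instMor_subst, hC, Mor.comp]

theorem instMor_idMor_ofMor {C : Ty} (hC : C.Closed) {n : ℕ} {σ : Mor} (hl : σ.length = n) :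
    (C.instMor (idMor n)).subst (ofMor σ) = C.instMor σ := by
  rw [instMor_idMor_subst hC, ← hl, argsOf_ofMor]

/-- A redex is a full spine of its outer head, which is why no parameters remain. -/
theorem Contr.preserves {Γ T : Ctx} {t t' : Tm} {A : Ty} (h : Contr t t') (ht : Typed Γ t T A) :
    T = [] ∧ Typed Γ t' [] A := by
  have hΓ := ht.isCtx
  cases h with
  | recur S C gs k c g τ u hc hg hτ =>
    obtain ⟨V, D, hV, h₁⟩ := Typed.head_spine_inv
      (σ := .app ((Tm.con S k).appMor τ) u :: c.mor.comp τ) ht trivial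
    have hrec := hV.typed hΓ
    have hkind := hV.kind
    cases hV with | recur hμ hC hl hgs =>
    have hmem := List.mem_of_getElem? hc
    have hm := hμ.fp_inv.2.2.1 c hmem
    have hlen := hm.length_eq
    obtain ⟨rfl, h₂, h₃⟩ := h₁ (by simp [Mor.comp_length, hlen])
    refine ⟨rfl, ?_⟩
    rw [shift_subst_ofMor_cons, instMor_idMor_ofMor hC.closed (by simp [Mor.comp_length, hlen])]
      at h₃
    -- The last argument of the recursor is itself a full spine; as its head carries the same `S`
    -- and `k`, it types `τ, u` against `Γₖ, Aₖ[μ]`.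
    obtain ⟨V', D', hV', h₄⟩ := Typed.head_spine_inv (σ := u :: τ) h₂.2 trivial
    cases hV' with | con _ hc' =>
    rw [hc] at hc'
    cases hc'
    obtain ⟨-, h₅, -⟩ := h₄ (by simp [hτ])
    have hF := (hμ.fp_inv.2.2.2 c hmem).act1_typed hΓ hμ hC (hrec.generic hkind)
    have := ((hgs k c g hc hg).replaceLast hF).subst h₅
    -- The contractum has the type `(C @ σₖ)[τ]`, which is `C @ (σₖ • τ)`, found above for the redex
    -- up to conversion.
    rw [List.length_nil, upN, shift_subst_ofMor_cons, instMor_comp hC.closed] at this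
    exact this.convEq h₃
  | corecur S C gs k c g τ u hc hg hτ =>
    obtain ⟨V, D, hV, h₁⟩ := Typed.head_spine_inv
      (σ := .app ((Tm.corecur S C gs).appMor (c.mor.comp τ)) u :: τ) ht trivial
    cases hV with | des hν hc' =>
    rw [hc] at hc'
    cases hc'
    obtain ⟨rfl, h₂, h₃⟩ := h₁ (by simp [hτ])
    refine ⟨rfl, ?_⟩
    rw [shift_subst_ofMor_cons] at h₃
    obtain ⟨V', D', hV', h₄⟩ := Typed.head_spine_inv (σ := u :: c.mor.comp τ) h₂.2 trivial
    have hrec := hV'.typed hΓ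
    have hkind := hV'.kind
    cases hV' with | corecur _ hC hl hgs =>
    have hmem := List.mem_of_getElem? hc
    have hlen := (hν.fp_inv.2.2.1 c hmem).length_eq
    obtain ⟨-, h₅, -⟩ := h₄ (by simp [Mor.comp_length, hlen])
    have hu := h₅.2
    simp only [ofMor_cons_zero, ofMor_cons_succ] at hu
    rw [show (fun i => ofMor (c.mor.comp τ) i) = ofMor (c.mor.comp τ) from rfl,
      instMor_idMor_ofMor hC.closed (by simp [Mor.comp_length, hlen]),
      ← instMor_comp hC.closed] at hu
    -- The typing of `τ` comes from the spine of the destructor, that of `u` from the spine of the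
    -- corecursor.
    have h₆ : SubstOk Γ (ofMor (u :: τ)) (C.instMor c.mor :: (c.dom ++ Γ)) := by
      simp only [SubstOk, ofMor_cons_zero, ofMor_cons_succ]
      refine ⟨?_, hu⟩
      have := h₂.1
      simp only [ofMor_cons_succ] at this
      exact this
    have hF := (hν.fp_inv.2.2.2 c hmem).act1_typed hΓ hC hν (hrec.generic hkind)
    have := (hF.replaceLast (hgs k c g hc hg)).subst h₆
    rw [List.length_nil, upN, shift_subst_ofMor_cons] at this
    exact this.convEq h₃

/-- Subject reduction for a parameterised term that is applied to arguments. -/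
theorem Step.preserves {t t' : Tm} (h : Step t t') {Γ T : Ctx} {A : Ty} (ht : Typed Γ t T A)
    {σ : Mor} (hl : σ.length = T.length) (hσ : SubstOk Γ (ofMor σ) (T ++ Γ)) :
    Typed Γ (t'.appMor σ) [] (A.subst (ofMor σ)) := by
  -- Arguments and bodies have no parameters, so for them the hypothesis with `σ = []` is plain
  -- subject reduction.
  have key : ∀ {g' : Tm} {Γ : Ctx} {A : Ty}, (∀ {σ : Mor}, σ.length = List.length ([] : Ctx) →
      SubstOk Γ (ofMor σ) ([] ++ Γ) → Typed Γ (g'.appMor σ) [] (A.subst (ofMor σ))) → IsCtx Γ →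
      Typed Γ g' [] A := by
    intro g' Γ A h hΓ
    have := h (σ := []) rfl (by rw [ofMor_nil]; exact .id hΓ)
    rwa [ofMor_nil, Ty.subst_var] at this
  induction h generalizing Γ T A σ with
  | contr h =>
    obtain ⟨rfl, h'⟩ := h.preserves ht
    obtain rfl := List.eq_nil_of_length_eq_zero hl
    rw [ofMor_nil, Ty.subst_var]
    exact h'
  | @appLeft t t' s h ih =>
    obtain ⟨T₀, B, C, h₁, hs, rfl, hC⟩ := ht.app_inv
    rw [Ctx.subst_length] at hl
    -- The argument `s` joins the given ones as the value of the first parameter of `t`, so the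
    -- hypothesis for `t` applies to a full application.
    have := ih h₁ (σ := σ ++ [s]) (by simp [hl]) (by
      simpa using SubstOk.snoc hs (by simpa using h₁.validity.isCtx) hl hσ)
    rw [Tm.appMor_append] at this
    refine this.convEq (TyEq.trans ?_ (hC.subst hσ))
    rw [Ty.subst_subst, splice_ofMor hl]
    exact .refl _ _
  | @appRight t s s' h ih =>
    obtain ⟨T₀, B, C, h₁, hs, rfl, hC⟩ := ht.app_inv
    rw [Ctx.subst_length] at hl
    have hs' := key (ih hs) hs.isCtx
    have hctx : IsCtx (T₀ ++ B :: Γ) := by simpa using h₁.validity.isCtx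
    have e : ∀ r, (fun i => ofMor (σ ++ [r]) (i + T₀.length)) = ofMor [r] := by
      intro r
      rw [← splice_ofMor hl]
      funext i
      change (upN T₀.length (ofMor [r]) (i + T₀.length)).subst (ofMor σ) = _
      rw [splice_add, ← hl]
      simp only [ofMor_add]
      exact Tm.subst_var _
    -- The entries of `σ` were typed against `T₀[s/x]` and have to be retyped against `T₀[s'/x]`.
    have heq : SubstEq Γ (ofMor (σ ++ [s])) (ofMor (σ ++ [s'])) (T₀ ++ B :: Γ) := by
      refine SubstEq.extend hctx.respects (SubstOk.snoc hs hctx hl hσ) (fun i hi => ?_) ?_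
      · rw [← hl] at hi
        rw [ofMor_append_lt s hi, ofMor_append_lt s' hi]
      · rw [e, e]
        exact ⟨(SubstOk.single hs).1.eq, .of_conv (.inl h) (SubstOk.single hs).2
          (SubstOk.single hs').2, (SubstOk.single hs').2⟩
    have := h₁.appMor (σ := σ ++ [s']) (by simp [hl]) (by simpa using heq.right)
    rw [Tm.appMor_append] at this
    -- The reduct has the type `C` with `s'` for the first parameter; as types respect conversion,
    -- this converts back to the type with `s`.
    have hCC := (h₁.validity.respects.apply (by simpa using heq)).symm
    refine this.convEq (hCC.trans (TyEq.trans ?_ (hC.subst hσ)))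
    rw [Ty.subst_subst, splice_ofMor hl]
    exact .refl _ _
  | @recur S C gs₁ gs₂ g g' h ih =>
    obtain ⟨D, hD, hA⟩ := ht.head_inv trivial
    cases hD with | recur hμ hC hlen hgs =>
    have := Typed.recur (gs := gs₁ ++ g' :: gs₂) ht.isCtx hμ hC (by simpa using hlen) (by
      intro k c x hc hx
      rcases getElem?_replace (a := g) hx with ⟨rfl, rfl⟩ | hx
      · have hg := hgs _ c g hc (by simp)
        exact key (ih hg) hg.isCtx
      · exact hgs k c x hc hx)
    exact (this.convEq hA).appMor hl hσ
  | @corecur S C gs₁ gs₂ g g' h ih =>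
    obtain ⟨D, hD, hA⟩ := ht.head_inv trivial
    cases hD with | corecur hμ hC hlen hgs =>
    have := Typed.corecur (gs := gs₁ ++ g' :: gs₂) ht.isCtx hμ hC (by simpa using hlen) (by
      intro k c x hc hx
      rcases getElem?_replace (a := g) hx with ⟨rfl, rfl⟩ | hx
      · have hg := hgs _ c g hc (by simp)
        exact key (ih hg) hg.isCtx
      · exact hgs k c x hc hx)
    exact (this.convEq hA).appMor hl hσ

end DTT

theorem mainTheorem1 (Γ : DTT.Ctx) (t₁ t₂ : DTT.Tm) (A : DTT.Ty)
    (ht : DTT.Typed Γ t₁ [] A) (hr : DTT.Step t₁ t₂) : DTT.Typed Γ t₂ [] A := by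
  have := hr.preserves ht (σ := []) rfl (by
    rw [DTT.ofMor_nil]
    exact .id ht.isCtx)
  rwa [DTT.ofMor_nil, DTT.Ty.subst_var] at this
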